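/- \textbf{Theorem (existence of classical solutions).} Let $N\ge 1$ and let $W\in L^1_{loc}(\mathbb{R}^N)$ be an interaction potential whose distributional derivatives satisfy $$\nabla W\in L^1(\mathbb{R}^N),\qquad D^2W\in L^1(\mathbb{R}^N),\qquad (\Delta W)_+\in L^\infty(\mathbb{R}^N).$$ Consider the aggregation equation $$\partial_t\rho+\operatorname{div}(\rho v)=0,\qquad v=-\nabla W*\rho,\qquad \rho(0,\cdot)=\rho_0. \tag{1}$$ For $m\ge 0$ let $\mathcal W^{m,\infty}(\mathbb{R}^N)$ be the Sobolev space of functions whose weak derivatives of order at most $m$ are in $L^\infty$. For $T\in(0,\infty]$, let $\mathcal W^{0,\infty}_{loc}([0,T),\mathcal W^{m,\infty})$ be the set of $u$ that are bounded in $\mathcal W^{m,\infty}(\mathbb{R}^N)$ on each $[0,S]$, $S<T$; for $j\ge 1$, let $\mathcal W^{j,\infty}_{loc}([0,T),\mathcal W^{m,\infty})$ be the set of $u:[0,T)\to\mathcal W^{m,\infty}(\mathbb{R}^N)$ that are $j-1$ times differentiable in time in the norm of $\mathcal W^{m,\infty}$, with $\partial_t^{j-1}u$ Lipschitz on each $[0,S]$,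 $S<T$ (so for $j=1$: locally Lipschitz in time). A classical solution of (1) on $[0,T)$ is a function $\rho\in C^1([0,T)\times\mathbb{R}^N)\cap\mathcal W^{1,\infty}_{loc}([0,T),\mathcal W^{1,\infty}(\mathbb{R}^N))$ that satisfies (1) pointwise (with the one-sided time derivative at $t=0$). Let $\rho_0\in\mathcal W^{2,\infty}(\mathbb{R}^N)$. Then there exist $T\in(0,\infty]$ and a classical solution $\rho$ of (1) on $[0,T)$ such that: (i) if $\rho_0$ is a mass density, that is $\rho_0\ge 0$ and $\rho_0\in L^1(\mathbb{R}^N)$, then $T=\infty$, so that $\rho\in C^1([0,\infty)\times\mathbb{R}^N)\cap \mathcal W^{1,\infty}_{loc}([0,\infty),\mathcal W^{1,\infty}(\mathbb{R}^N))$; (ii) for every integer $\kappa\ge2$, if $\rho_0\in\mathcal W^{\kappa,\infty}(\mathbb{R}^N)$, then $\rho\in\mathcal W^{j,\infty}_{loc}([0,T),\mathcal W^{m,\infty}(\mathbb{R}^N))$ for all integers $j,m\ge0$ with $j+m\le\kappa$; in particular $\rho\in L^\infty_{loc}([0,T),\mathcal W^{\kappa,\infty})\cap\mathcal W^{1,\infty}_{loc}([0,T),\mathcal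 W^{\kappa-1,\infty})$; (iii) if $\rho_0\in L^1(\mathbb{R}^N)$ and $\int|x|^2|\rho_0(x)|\,dx<\infty$, then the solution is unique: every classical solution of (1) on an interval $[0,T')$ coincides with $\rho$ on $[0,\min(T,T'))\times\mathbb{R}^N$. -/

import Mathlib

open MeasureTheory Set
open scoped ContDiff Convolution

noncomputable section

namespace Aggregation

/-- `ℝᴺ` with its Euclidean norm and Lebesgue measure. -/
abbrev Space (N : ℕ) : Type := EuclideanSpace ℝ (Fin N)

/-- The `i`-th vector of the canonical basis. -/
abbrev basisVec {N : ℕ} (i : Fin N) : Space N := EuclideanSpace.single i 1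

/-- `g` is the weak (distributional) partial derivative `∂ᵢ f`, both being locally integrable. -/
structure HasWeakPartial {N : ℕ} (i : Fin N) (f g : Space N → ℝ) : Prop where
  locInt_left : LocallyIntegrable f volume
  locInt_right : LocallyIntegrable g volume
  integral_eq : ∀ φ : Space N → ℝ, ContDiff ℝ ∞ φ → HasCompactSupport φ →
    ∫ x, f x * fderiv ℝ φ x (basisVec i) = -∫ x, g x * φ x

/-- `f ∈ 𝒲^{m,∞}(ℝᴺ)` with norm at most `C`, the norm being the largest of the `L^∞` norms of the
weak derivatives of order `0, …, m`. -/
def SobolevLE {N : ℕ} : ℕ → ℝ → (Space N → ℝ) → Prop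
  | 0, C, f => AEStronglyMeasurable f volume ∧ ∀ᵐ x, |f x| ≤ C
  | m + 1, C, f => (AEStronglyMeasurable f volume ∧ ∀ᵐ x, |f x| ≤ C) ∧
      ∀ i : Fin N, ∃ g : Space N → ℝ, HasWeakPartial i f g ∧ SobolevLE m C g

/-- The Sobolev space `𝒲^{m,∞}(ℝᴺ)`. -/
def MemSobolev {N : ℕ} (m : ℕ) (f : Space N → ℝ) : Prop := ∃ C : ℝ, SobolevLE m C f

/-- The time interval `[0, T)`; it is `[0, ∞)` for `T = ⊤`. -/
def timeInterval (T : EReal) : Set ℝ := {t | 0 ≤ t ∧ (t : EReal) < T}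

/-- `u ∈ 𝒲^{j,∞}_loc([0, T), 𝒲^{m,∞}(ℝᴺ))`.
For `j = 0` this is local boundedness in time, for `j = 1` it is local Lipschitz continuity in time
for the norm of `𝒲^{m,∞}(ℝᴺ)`, and for `j ≥ 2` it means that `u` has a time derivative `u'`, in the
norm of `𝒲^{m,∞}(ℝᴺ)`, that belongs to `𝒲^{j-1,∞}_loc([0, T), 𝒲^{m,∞}(ℝᴺ))`. Locally means: on
every interval `[0, S]` with `S < T`. -/
def MemTimeSobolev {N : ℕ} (T : EReal) : ℕ → ℕ → (ℝ → Space N → ℝ) → Prop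
  | 0, m, u => ∀ S ∈ timeInterval T, ∃ C : ℝ, ∀ t ∈ Icc 0 S, SobolevLE m C (u t)
  | 1, m, u => (∀ S ∈ timeInterval T, ∃ C : ℝ, ∀ t ∈ Icc 0 S, SobolevLE m C (u t)) ∧
      ∀ S ∈ timeInterval T, ∃ L : ℝ, ∀ s ∈ Icc 0 S, ∀ t ∈ Icc 0 S,
        SobolevLE m (L * |t - s|) (fun x => u t x - u s x)
  | j + 2, m, u => (∀ S ∈ timeInterval T, ∃ C : ℝ, ∀ t ∈ Icc 0 S, SobolevLE m C (u t)) ∧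
      ∃ u' : ℝ → Space N → ℝ, MemTimeSobolev T (j + 1) m u' ∧
        ∀ t ∈ timeInterval T, ∀ ε > 0, ∃ δ > 0, ∀ s ∈ timeInterval T, |s - t| < δ →
          SobolevLE m (ε * |s - t|) (fun x => u s x - u t x - (s - t) * u' t x)

/-- The `i`-th component of the velocity `v = -∇W * μ` generated by the density `μ`, where
`gradW i` is the weak derivative `∂ᵢ W`. -/
def velocity {N : ℕ} (gradW : Fin N → Space N → ℝ) (μ : Space N → ℝ) (i : Fin N) :
    Space N → ℝ :=
  fun x => -(gradW i ⋆[ContinuousLinearMap.mul ℝ ℝ, volume] μ) x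

/-- The divergence of a vector field given by its components. -/
def divergence {N : ℕ} (F : Fin N → Space N → ℝ) (x : Space N) : ℝ :=
  ∑ i, fderiv ℝ (F i) x (basisVec i)

/-- `ρ` is a classical solution on `[0, T) × ℝᴺ`, with initial datum `ρ₀`, of the aggregation
equation `∂ₜ ρ + div (ρ v) = 0`, `v = -∇W * ρ`, in the class
`C¹([0, T) × ℝᴺ) ∩ 𝒲^{1,∞}_loc([0, T), 𝒲^{1,∞}(ℝᴺ))`. At `t = 0` the time derivative is the
one-sided one. -/
structure IsClassicalSolution {N : ℕ} (gradW : Fin N → Space N → ℝ) (ρ₀ : Space N → ℝ)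
    (T : EReal) (ρ : ℝ → Space N → ℝ) : Prop where
  contDiffOn : ContDiffOn ℝ 1 (Function.uncurry ρ) (timeInterval T ×ˢ univ)
  memTimeSobolev : MemTimeSobolev T 1 1 ρ
  initial : ρ 0 =ᵐ[volume] ρ₀
  flux_differentiable : ∀ t ∈ timeInterval T, ∀ i,
    Differentiable ℝ (fun x => ρ t x * velocity gradW (ρ t) i x)
  equation : ∀ t ∈ timeInterval T, ∀ x,
    HasDerivWithinAt (fun s => ρ s x)
      (-divergence (fun i y => ρ t y * velocity gradW (ρ t) i y) x) (timeInterval T) t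

end Aggregation

end

/-! With `w = ∇W * ρ = -v` the equation reads `∂ₜ ρ = div (ρ w)`. As `∇W` and `D²W` are integrable,
`ρ ↦ w` gains one derivative at every level `𝒲^{m,∞}`, and this compensates the derivative in the
nonlocal factor. The solution is the uniform limit of an explicit finite difference scheme with mesh
`h = 2⁻ⁿ`, time step `h²` and artificial viscosity proportional to `h`.

Under the condition `Stable`, a new value is a combination of neighbouring old values with
nonnegative weights whose sum is `1 + τ div_h w` (`lin_eq`). This gives a maximum principle
(`SobolevLE.lin_zero`). Differentiating the scheme shows that the norm of order `m + 1` grows at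
most exponentially, at a rate fixed by the norm of order `m` (`SobolevLE.step_succ`). Hence a bound
in `L^∞`, encoded in `Admissible`, propagates every Sobolev norm of the datum uniformly in `n`
(`exists_bound`).

The scheme is also stable in `L^∞` without loss of derivatives (`SobolevLE.step_sub`), so successive
discretisations differ by `O(h)` (`seq_compare`) and the approximations converge geometrically.
Sobolev balls are closed under distributional limits (`SobolevLE.of_tendsto`). The limit therefore
inherits the bounds and satisfies the equation with a quadratic remainder in time
(`Convergent.exists_taylor`). Since `∂ₜ ρ` is a spatial expression costing one derivative, time
regularity is traded for space regularity by induction (`Convergent.reg`).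

The `L^∞` bound always holds for a short time, by comparison with a Riccati equation
(`admissible_local`). For a density, sign and mass are conserved by the scheme, so `div w = ΔW * ρ`
is at most `‖(ΔW)₊‖_∞ ∫ ρ₀`. The growth is then only exponential and the solution is global
(`admissible_global`).

Uniqueness follows by differentiating the difference of two solutions along the characteristics of
one of them. The gradient of that solution drops out (`abs_rate_sub_le`), and an exponentially
weighted sup norm is halved at each iteration. -/

noncomputable section

namespace Aggregation

open Filter Topology

variable {N : ℕ}

section

/-! ### Mollification and weak partial derivatives -/

/-- A sequence of bump functions whose supports shrink to the origin. -/
def bump (N n : ℕ) : ContDiffBump (0 : Space N) where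
  rIn := 1 / ((n : ℝ) + 1)
  rOut := 2 / ((n : ℝ) + 1)
  rIn_pos := by positivity
  rIn_lt_rOut := by gcongr; norm_num

/-- The normalised mollifier. -/
def eta (N n : ℕ) : Space N → ℝ := (bump N n).normed volume

/-- The mollification of `f` at scale `2 / (n + 1)`. -/
def mol (n : ℕ) (f : Space N → ℝ) : Space N → ℝ :=
  f ⋆[ContinuousLinearMap.mul ℝ ℝ, volume] eta N n

lemma contDiff_eta (n : ℕ) : ContDiff ℝ ∞ (eta N n) := (bump N n).contDiff_normed

lemma hasCompactSupport_eta (n : ℕ) : HasCompactSupport (eta N n) :=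
  (bump N n).hasCompactSupport_normed

lemma eta_nonneg (n : ℕ) (x : Space N) : 0 ≤ eta N n x := (bump N n).nonneg_normed x

lemma integral_eta (n : ℕ) : ∫ x, eta N n x = 1 := (bump N n).integral_normed

lemma mol_apply (n : ℕ) (f : Space N → ℝ) (x : Space N) :
    mol n f x = ∫ y, f y * eta N n (x - y) := rfl

lemma contDiff_eta_sub (n : ℕ) (x : Space N) : ContDiff ℝ ∞ (fun y => eta N n (x - y)) :=
  (contDiff_eta n).comp (contDiff_const.sub contDiff_id)

lemma hasCompactSupport_eta_sub (n : ℕ) (x : Space N) :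
    HasCompactSupport (fun y => eta N n (x - y)) :=
  (hasCompactSupport_eta n).comp_homeomorph (Homeomorph.subLeft x)

lemma integral_eta_sub (n : ℕ) (x : Space N) : ∫ y, eta N n (x - y) = 1 := by
  rw [integral_sub_left_eq_self (eta N n) volume x, integral_eta]

lemma integrable_eta_sub (n : ℕ) (x : Space N) : Integrable (fun y => eta N n (x - y)) :=
  (contDiff_eta_sub n x).continuous.integrable_of_hasCompactSupport (hasCompactSupport_eta_sub n x)

lemma fderiv_eta_sub (n : ℕ) (x y v : Space N) :
    fderiv ℝ (fun y => eta N n (x - y)) y v = -fderiv ℝ (eta N n) (x - y) v := by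
  have h : HasFDerivAt (fun y => eta N n (x - y))
      ((fderiv ℝ (eta N n) (x - y)).comp (-(ContinuousLinearMap.id ℝ (Space N)))) y :=
    ((contDiff_eta n).differentiable (by simp)).differentiableAt.hasFDerivAt.comp y
      ((hasFDerivAt_id y).const_sub x)
  rw [h.fderiv]; simp

/-- Puts the mollifier on the left, the form used by the convergence theorems for bump functions. -/
lemma mol_eq_bump (n : ℕ) (f : Space N → ℝ) :
    mol n f = (bump N n).normed volume ⋆[ContinuousLinearMap.lsmul ℝ ℝ, volume] f := by
  rw [← convolution_flip]
  unfold mol eta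
  congr 1
  ext; simp

lemma tendsto_bump : Tendsto (fun n => (bump N n).rOut) atTop (𝓝 0) := by
  have h := (tendsto_one_div_add_atTop_nhds_zero_nat (𝕜 := ℝ)).const_mul 2
  simpa [bump, div_eq_mul_inv] using h

lemma ae_tendsto_mol {f : Space N → ℝ} (hf : LocallyIntegrable f volume) :
    ∀ᵐ x, Tendsto (fun n => mol n f x) atTop (𝓝 (f x)) := by
  simp_rw [mol_eq_bump]
  -- The outer and inner radii of `bump` have the fixed ratio `2`; a bounded ratio is what the
  -- Lebesgue differentiation argument needs.
  refine ContDiffBump.ae_convolution_tendsto_right_of_locallyIntegrable (K := 2) tendsto_bump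
    (Eventually.of_forall fun n => le_of_eq ?_) hf
  simp [bump]; ring

lemma tendsto_mol_of_continuous {f : Space N → ℝ} (hf : Continuous f) (x : Space N) :
    Tendsto (fun n => mol n f x) atTop (𝓝 (f x)) := by
  simp_rw [mol_eq_bump]
  exact ContDiffBump.convolution_tendsto_right_of_continuous tendsto_bump hf x

lemma dist_mol_le {f : Space N → ℝ} {ε : ℝ} {n : ℕ} {x : Space N} (hf : Continuous f)
    (h : ∀ y ∈ Metric.ball x (bump N n).rOut, dist (f y) (f x) ≤ ε) : dist (mol n f x) (f x) ≤ ε := by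
  rw [mol_eq_bump]
  exact ContDiffBump.dist_normed_convolution_le hf.aestronglyMeasurable h

lemma contDiff_mol (n : ℕ) {f : Space N → ℝ} (hf : LocallyIntegrable f volume) :
    ContDiff ℝ ∞ (mol n f) :=
  (hasCompactSupport_eta n).contDiff_convolution_right (n := ⊤) _ hf (contDiff_eta n)

lemma integrable_mul_test {f φ : Space N → ℝ} (hf : LocallyIntegrable f volume)
    (hφ : Continuous φ) (hc : HasCompactSupport φ) : Integrable (fun x => f x * φ x) := by
  simpa [mul_comm] using hf.integrable_smul_left_of_hasCompactSupport hφ hc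

lemma abs_integral_mul_le {f φ : Space N → ℝ} {C : ℝ} (hb : ∀ᵐ x, |f x| ≤ C)
    (hφ : Integrable φ) : |∫ x, f x * φ x| ≤ C * ∫ x, |φ x| := by
  rw [← integral_const_mul]
  refine norm_integral_le_of_norm_le (f := fun x => f x * φ x) (hφ.abs.const_mul C) ?_
  filter_upwards [hb] with x hx
  rw [Real.norm_eq_abs, abs_mul]
  gcongr

lemma abs_mol_le {f : Space N → ℝ} {C : ℝ} (n : ℕ) (x : Space N) (hb : ∀ᵐ x, |f x| ≤ C) :
    |mol n f x| ≤ C := by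
  have := abs_integral_mul_le hb (integrable_eta_sub n x)
  simpa [mol_apply, abs_of_nonneg (eta_nonneg n _), integral_eta_sub] using this

/-- The derivative falls on the mollifier, and `y ↦ eta N n (x - y)` is an admissible test function.
The sign from reflecting the argument cancels the sign of the integration by parts. -/
lemma fderiv_mol {i : Fin N} {f g : Space N → ℝ} (h : HasWeakPartial i f g) (n : ℕ)
    (x : Space N) : fderiv ℝ (mol n f) x (basisVec i) = mol n g x := by
  have h1 := (hasCompactSupport_eta n).hasFDerivAt_convolution_right
    (ContinuousLinearMap.mul ℝ ℝ) h.locInt_left ((contDiff_eta (N := N) n).of_le (by simp)) x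
  have h2 := h.integral_eq _ (contDiff_eta_sub n x) (hasCompactSupport_eta_sub n x)
  change fderiv ℝ (f ⋆[ContinuousLinearMap.mul ℝ ℝ, volume] eta N n) x (basisVec i) = _
  rw [h1.fderiv, convolution_precompR_apply _ h.locInt_left ((hasCompactSupport_eta n).fderiv ℝ)
    ((contDiff_eta n).continuous_fderiv (by simp))]
  simp_rw [fderiv_eta_sub] at h2
  simp only [mul_neg, integral_neg, neg_inj] at h2
  exact h2

/-- Weak partial derivatives are unique. -/
lemma HasWeakPartial.unique {i : Fin N} {f g g' : Space N → ℝ} (h : HasWeakPartial i f g)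
    (h' : HasWeakPartial i f g') : g =ᵐ[volume] g' := by
  refine ae_eq_of_integral_contDiff_smul_eq h.locInt_right h'.locInt_right fun φ hφ hc => ?_
  have := (h.integral_eq φ hφ hc).symm.trans (h'.integral_eq φ hφ hc)
  simpa [mul_comm] using this

lemma HasWeakPartial.congr {i : Fin N} {f f' g g' : Space N → ℝ} (h : HasWeakPartial i f g)
    (hf : f =ᵐ[volume] f') (hg : g =ᵐ[volume] g') : HasWeakPartial i f' g' where
  locInt_left := h.locInt_left.congr hf
  locInt_right := h.locInt_right.congr hg
  integral_eq φ hφ hc := by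
    have h1 : ∫ x, f x * fderiv ℝ φ x (basisVec i) = ∫ x, f' x * fderiv ℝ φ x (basisVec i) :=
      integral_congr_ae (hf.mono fun x hx => by simp [hx])
    have h2 : ∫ x, g x * φ x = ∫ x, g' x * φ x :=
      integral_congr_ae (hg.mono fun x hx => by simp [hx])
    rw [← h1, ← h2]
    exact h.integral_eq φ hφ hc

lemma hasCompactSupport_partial {φ : Space N → ℝ} (hc : HasCompactSupport φ) (v : Space N) :
    HasCompactSupport (fun x => fderiv ℝ φ x v) :=
  (hc.fderiv ℝ).comp_left (g := fun L : Space N →L[ℝ] ℝ => L v) rfl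

lemma contDiff_partial {φ : Space N → ℝ} (hφ : ContDiff ℝ ∞ φ) (v : Space N) :
    ContDiff ℝ ∞ (fun x => fderiv ℝ φ x v) :=
  (hφ.fderiv_right (m := ∞) (by simp)).clm_apply contDiff_const

lemma HasWeakPartial.add {i : Fin N} {f f' g g' : Space N → ℝ} (h : HasWeakPartial i f g)
    (h' : HasWeakPartial i f' g') :
    HasWeakPartial i (fun x => f x + f' x) (fun x => g x + g' x) where
  locInt_left := h.locInt_left.add h'.locInt_left
  locInt_right := h.locInt_right.add h'.locInt_right
  integral_eq φ hφ hc := by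
    have hD := (contDiff_partial hφ (basisVec i)).continuous
    have hDc := hasCompactSupport_partial hc (basisVec i)
    simp_rw [add_mul]
    rw [integral_add (integrable_mul_test h.locInt_left hD hDc)
      (integrable_mul_test h'.locInt_left hD hDc),
      integral_add (integrable_mul_test h.locInt_right hφ.continuous hc)
      (integrable_mul_test h'.locInt_right hφ.continuous hc), h.integral_eq φ hφ hc,
      h'.integral_eq φ hφ hc]
    ring

lemma HasWeakPartial.const_mul {i : Fin N} {f g : Space N → ℝ} (c : ℝ)
    (h : HasWeakPartial i f g) : HasWeakPartial i (fun x => c * f x) (fun x => c * g x) where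
  locInt_left := h.locInt_left.smul c
  locInt_right := h.locInt_right.smul c
  integral_eq φ hφ hc := by
    simp_rw [mul_assoc, integral_const_mul, h.integral_eq φ hφ hc]
    ring

lemma locallyIntegrable_comp_add {f : Space N → ℝ} (hf : LocallyIntegrable f volume)
    (a : Space N) : LocallyIntegrable (fun x => f (x + a)) volume := by
  have h : Measure.map (Homeomorph.addRight a) volume = (volume : Measure (Space N)) :=
    (measurePreserving_add_right volume a).map_eq
  rw [← h, locallyIntegrable_map_homeomorph] at hf
  exact hf

lemma HasWeakPartial.shift {i : Fin N} {f g : Space N → ℝ} (h : HasWeakPartial i f g)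
    (a : Space N) : HasWeakPartial i (fun x => f (x + a)) (fun x => g (x + a)) where
  locInt_left := locallyIntegrable_comp_add h.locInt_left a
  locInt_right := locallyIntegrable_comp_add h.locInt_right a
  integral_eq φ hφ hc := by
    have h1 := h.integral_eq (fun x => φ (x - a)) (hφ.comp (contDiff_id.sub contDiff_const))
      (hc.comp_homeomorph (Homeomorph.subRight a))
    have h2 : ∀ x, fderiv ℝ (fun x => φ (x - a)) x (basisVec i)
        = fderiv ℝ φ (x - a) (basisVec i) := fun x => by rw [fderiv_comp_sub]
    simp_rw [h2] at h1
    rw [← integral_add_right_eq_self _ a, ← integral_add_right_eq_self (fun x => g x * _) a] at h1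
    simpa using h1

lemma ae_comp_add {p : Space N → Prop} (h : ∀ᵐ x, p x) (a : Space N) : ∀ᵐ x, p (x + a) :=
  (measurePreserving_add_right volume a).quasiMeasurePreserving.ae h

lemma locallyIntegrable_of_bound {f : Space N → ℝ} {C : ℝ} (hf : AEStronglyMeasurable f volume)
    (hb : ∀ᵐ x, |f x| ≤ C) : LocallyIntegrable f volume :=
  (memLp_top_of_bound hf C hb).locallyIntegrable (by simp)

lemma tendsto_integral_mol_mul {f ψ : Space N → ℝ} {C : ℝ} (hf : AEStronglyMeasurable f volume)
    (hb : ∀ᵐ x, |f x| ≤ C) (hψ : Integrable ψ) :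
    Tendsto (fun n => ∫ x, mol n f x * ψ x) atTop (𝓝 (∫ x, f x * ψ x)) := by
  have hloc := locallyIntegrable_of_bound hf hb
  refine tendsto_integral_of_dominated_convergence (fun x => C * |ψ x|) (fun n => ?_)
    (hψ.abs.const_mul C) (fun n => ?_) ?_
  · exact (contDiff_mol n hloc).continuous.aestronglyMeasurable.mul hψ.aestronglyMeasurable
  · refine Eventually.of_forall fun x => ?_
    rw [Real.norm_eq_abs, abs_mul]
    gcongr
    exact abs_mol_le n x hb
  · filter_upwards [ae_tendsto_mol hloc] with x hx
    exact hx.mul_const _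

/-- Product rule for bounded functions with bounded weak partial derivatives. -/
lemma HasWeakPartial.mul {i : Fin N} {f f' g g' : Space N → ℝ} {A A' B B' : ℝ}
    (hf : HasWeakPartial i f f') (hg : HasWeakPartial i g g') (hA : ∀ᵐ x, |f x| ≤ A)
    (hA' : ∀ᵐ x, |f' x| ≤ A') (hB : ∀ᵐ x, |g x| ≤ B) (hB' : ∀ᵐ x, |g' x| ≤ B') :
    HasWeakPartial i (fun x => f x * g x) (fun x => f' x * g x + f x * g' x) := by
  have mf := hf.locInt_left.aestronglyMeasurable
  have mf' := hf.locInt_right.aestronglyMeasurable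
  have mg := hg.locInt_left.aestronglyMeasurable
  have mg' := hg.locInt_right.aestronglyMeasurable
  have l1 : LocallyIntegrable (fun x => f x * g x) volume := by
    refine locallyIntegrable_of_bound (C := A * B) (mf.mul mg) ?_
    filter_upwards [hA, hB] with x h1 h2
    rw [abs_mul]
    exact mul_le_mul h1 h2 (abs_nonneg _) ((abs_nonneg _).trans h1)
  have l2 : LocallyIntegrable (fun x => f' x * g x) volume := by
    refine locallyIntegrable_of_bound (C := A' * B) (mf'.mul mg) ?_
    filter_upwards [hA', hB] with x h1 h2
    rw [abs_mul]
    exact mul_le_mul h1 h2 (abs_nonneg _) ((abs_nonneg _).trans h1)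
  have l3 : LocallyIntegrable (fun x => f x * g' x) volume := by
    refine locallyIntegrable_of_bound (C := A * B') (mf.mul mg') ?_
    filter_upwards [hA, hB'] with x h1 h2
    rw [abs_mul]
    exact mul_le_mul h1 h2 (abs_nonneg _) ((abs_nonneg _).trans h1)
  refine ⟨l1, l2.add l3, fun φ hφ hc => ?_⟩
  have hD := (contDiff_partial hφ (basisVec i)).continuous
  have hDc := hasCompactSupport_partial hc (basisVec i)
  have i1 := integrable_mul_test hg.locInt_left hD hDc
  have i2 := integrable_mul_test hg.locInt_left hφ.continuous hc
  have i3 := integrable_mul_test hg.locInt_right hφ.continuous hc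
  -- Mollifying only one factor suffices: `mol n f * φ` is then a test function for the weak
  -- derivative of `g`. The limit is by dominated convergence, thanks to the bounds on `f` and `f'`.
  have key : ∀ n, ∫ x, mol n f x * (g x * fderiv ℝ φ x (basisVec i)) =
      -(∫ x, mol n f' x * (g x * φ x)) - ∫ x, mol n f x * (g' x * φ x) := by
    intro n
    have hm := contDiff_mol n hf.locInt_left
    have hm' := contDiff_mol n hf.locInt_right
    have e := hg.integral_eq (fun x => mol n f x * φ x) (hm.mul hφ) hc.mul_left
    have hd : ∀ x, fderiv ℝ (fun x => mol n f x * φ x) x (basisVec i)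
        = mol n f x * fderiv ℝ φ x (basisVec i) + φ x * mol n f' x := fun x => by
      rw [fderiv_fun_mul (hm.differentiable (by simp) x) (hφ.differentiable (by simp) x)]
      simp [fderiv_mol hf]
    simp_rw [hd, mul_add] at e
    rw [integral_add] at e
    · have e1 : ∫ x, g x * (mol n f x * fderiv ℝ φ x (basisVec i)) =
        ∫ x, mol n f x * (g x * fderiv ℝ φ x (basisVec i)) := by congr 1; ext x; ring
      have e2 : ∫ x, g x * (φ x * mol n f' x) = ∫ x, mol n f' x * (g x * φ x) := by
        congr 1; ext x; ring
      have e3 : ∫ x, g' x * (mol n f x * φ x) = ∫ x, mol n f x * (g' x * φ x) := by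
        congr 1; ext x; ring
      rw [e1, e2, e3] at e
      linarith
    · exact integrable_mul_test hg.locInt_left (hm.continuous.mul hD) hDc.mul_left
    · exact integrable_mul_test hg.locInt_left (hφ.continuous.mul hm'.continuous) hc.mul_right
  have t1 := tendsto_integral_mol_mul mf hA i1
  have t2 := tendsto_integral_mol_mul mf' hA' i2
  have t3 := tendsto_integral_mol_mul mf hA i3
  have := tendsto_nhds_unique (t1.congr key) (t2.neg.sub t3)
  simp_rw [mul_assoc, add_mul]
  rw [this, integral_add]
  · simp_rw [mul_assoc]; ring
  · exact integrable_mul_test l2 hφ.continuous hc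
  · exact integrable_mul_test l3 hφ.continuous hc

/-- Weak partial derivatives commute. -/
lemma HasWeakPartial.comm {i j : Fin N} {f fi fj fij : Space N → ℝ} (hi : HasWeakPartial i f fi)
    (hij : HasWeakPartial j fi fij) (hj : HasWeakPartial j f fj) : HasWeakPartial i fj fij where
  locInt_left := hj.locInt_right
  locInt_right := hij.locInt_right
  integral_eq φ hφ hc := by
    have e1 := hj.integral_eq _ (contDiff_partial hφ (basisVec i))
      (hasCompactSupport_partial hc (basisVec i))
    have e2 := hi.integral_eq _ (contDiff_partial hφ (basisVec j))
      (hasCompactSupport_partial hc (basisVec j))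
    have e3 := hij.integral_eq φ hφ hc
    -- Symmetry of second derivatives is needed for the smooth test function only.
    have e4 : ∀ x, fderiv ℝ (fun x => fderiv ℝ φ x (basisVec i)) x (basisVec j)
        = fderiv ℝ (fun x => fderiv ℝ φ x (basisVec j)) x (basisVec i) := fun x => by
      have hd : DifferentiableAt ℝ (fderiv ℝ φ) x :=
        (hφ.fderiv_right (m := ∞) (by simp)).differentiable (by simp) x
      rw [fderiv_clm_apply hd (by fun_prop), fderiv_clm_apply hd (by fun_prop)]
      simp
      have h2 : (2 : ℕ∞) ≤ ⊤ := le_top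
      have h2' : minSmoothness ℝ 2 ≤ ∞ := by simpa using WithTop.coe_le_coe.2 h2
      exact (hφ.contDiffAt.isSymmSndFDerivAt h2').eq _ _
    simp_rw [e4] at e1
    linarith

end

section

/-! ### The Sobolev classes -/

lemma SobolevLE.aestronglyMeasurable {m : ℕ} {C : ℝ} {f : Space N → ℝ} (h : SobolevLE m C f) :
    AEStronglyMeasurable f volume := by
  cases m with
  | zero => exact h.1
  | succ m => exact h.1.1

lemma SobolevLE.bound {m : ℕ} {C : ℝ} {f : Space N → ℝ} (h : SobolevLE m C f) :
    ∀ᵐ x, |f x| ≤ C := by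
  cases m with
  | zero => exact h.2
  | succ m => exact h.1.2

lemma SobolevLE.zero_level {m : ℕ} {C : ℝ} {f : Space N → ℝ} (h : SobolevLE m C f) :
    SobolevLE 0 C f := ⟨h.aestronglyMeasurable, h.bound⟩

lemma SobolevLE.locallyIntegrable {m : ℕ} {C : ℝ} {f : Space N → ℝ} (h : SobolevLE m C f) :
    LocallyIntegrable f volume := locallyIntegrable_of_bound h.aestronglyMeasurable h.bound

lemma SobolevLE.nonneg {m : ℕ} {C : ℝ} {f : Space N → ℝ} (h : SobolevLE m C f) : 0 ≤ C := by
  obtain ⟨x, hx⟩ := h.bound.exists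
  exact (abs_nonneg _).trans hx

/-- A set of full measure is dense, and for continuous `f` the set where the bound holds is closed.
-/
lemma SobolevLE.abs_le {m : ℕ} {C : ℝ} {f : Space N → ℝ} (h : SobolevLE m C f)
    (hf : Continuous f) (x : Space N) : |f x| ≤ C := by
  have h2 : Dense {x | |f x| ≤ C} := Measure.dense_of_ae h.bound
  have h3 : IsClosed {x | |f x| ≤ C} := isClosed_le hf.abs continuous_const
  have := h3.closure_eq ▸ h2.closure_eq
  exact (this ▸ mem_univ x : x ∈ {x | |f x| ≤ C})

lemma SobolevLE.congr {m : ℕ} {C : ℝ} {f g : Space N → ℝ} (h : SobolevLE m C f)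
    (hfg : f =ᵐ[volume] g) : SobolevLE m C g := by
  have h0 : AEStronglyMeasurable g volume ∧ ∀ᵐ x, |g x| ≤ C :=
    ⟨h.aestronglyMeasurable.congr hfg, by filter_upwards [h.bound, hfg] with x h1 h2; rwa [← h2]⟩
  cases m with
  | zero => exact h0
  | succ m =>
    refine ⟨h0, fun i => ?_⟩
    obtain ⟨g', h1, h2⟩ := h.2 i
    exact ⟨g', h1.congr hfg (ae_eq_refl _), h2⟩

lemma SobolevLE.mono {m : ℕ} {C C' : ℝ} {f : Space N → ℝ} (h : SobolevLE m C f) (hC : C ≤ C') :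
    SobolevLE m C' f := by
  induction m generalizing f with
  | zero => exact ⟨h.1, h.2.mono fun x hx => hx.trans hC⟩
  | succ m ih =>
    refine ⟨⟨h.1.1, h.1.2.mono fun x hx => hx.trans hC⟩, fun i => ?_⟩
    obtain ⟨g', h1, h2⟩ := h.2 i
    exact ⟨g', h1, ih h2⟩

lemma SobolevLE.of_succ {m : ℕ} {C : ℝ} {f : Space N → ℝ} (h : SobolevLE (m + 1) C f) :
    SobolevLE m C f := by
  induction m generalizing f with
  | zero => exact h.1
  | succ m ih =>
    refine ⟨h.1, fun i => ?_⟩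
    obtain ⟨g', h1, h2⟩ := h.2 i
    exact ⟨g', h1, ih h2⟩

lemma SobolevLE.of_le {m m' : ℕ} {C : ℝ} {f : Space N → ℝ} (h : SobolevLE m' C f) (hm : m ≤ m') :
    SobolevLE m C f := by
  induction m', hm using Nat.le_induction with
  | base => exact h
  | succ m' _ ih => exact ih h.of_succ

/-- A choice of the weak partial derivative of `f`, when there is one. -/
def weakD (i : Fin N) (f : Space N → ℝ) : Space N → ℝ :=
  open Classical in if h : ∃ g, HasWeakPartial i f g then h.choose else 0

lemma HasWeakPartial.weakD {i : Fin N} {f g : Space N → ℝ} (h : HasWeakPartial i f g) :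
    HasWeakPartial i f (weakD i f) := by
  have h' : ∃ g, HasWeakPartial i f g := ⟨g, h⟩
  rw [Aggregation.weakD, dif_pos h']
  exact h'.choose_spec

lemma HasWeakPartial.weakD_ae {i : Fin N} {f g : Space N → ℝ} (h : HasWeakPartial i f g) :
    Aggregation.weakD i f =ᵐ[volume] g := h.weakD.unique h

lemma SobolevLE.hasWeakPartial {m : ℕ} {C : ℝ} {f : Space N → ℝ} (h : SobolevLE (m + 1) C f)
    (i : Fin N) : HasWeakPartial i f (weakD i f) := (h.2 i).choose_spec.1.weakD

/-- By uniqueness of weak derivatives, the existential in `SobolevLE` may be instantiated with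
whichever weak derivative is at hand. -/
lemma SobolevLE.of_hasWeakPartial {m : ℕ} {C : ℝ} {i : Fin N} {f g : Space N → ℝ}
    (h : SobolevLE (m + 1) C f) (hg : HasWeakPartial i f g) : SobolevLE m C g := by
  obtain ⟨g', h1, h2⟩ := h.2 i
  exact h2.congr (h1.unique hg)

lemma SobolevLE.weakD {m : ℕ} {C : ℝ} {f : Space N → ℝ} (h : SobolevLE (m + 1) C f)
    (i : Fin N) : SobolevLE m C (weakD i f) := h.of_hasWeakPartial (h.hasWeakPartial i)

lemma SobolevLE.succ {m : ℕ} {C : ℝ} {f : Space N → ℝ} {g : Fin N → Space N → ℝ}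
    (h : SobolevLE 0 C f) (hg : ∀ i, HasWeakPartial i f (g i)) (hs : ∀ i, SobolevLE m C (g i)) :
    SobolevLE (m + 1) C f := ⟨h, fun i => ⟨g i, hg i, hs i⟩⟩

lemma SobolevLE.add {m : ℕ} {A B : ℝ} {f g : Space N → ℝ} (hf : SobolevLE m A f)
    (hg : SobolevLE m B g) : SobolevLE m (A + B) (fun x => f x + g x) := by
  induction m generalizing f g with
  | zero =>
    refine ⟨hf.1.add hg.1, ?_⟩
    filter_upwards [hf.2, hg.2] with x h1 h2
    exact (abs_add_le _ _).trans (add_le_add h1 h2)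
  | succ m ih =>
    refine SobolevLE.succ ?_ (fun i => (hf.hasWeakPartial i).add (hg.hasWeakPartial i))
      (fun i => ih (hf.weakD i) (hg.weakD i))
    refine ⟨hf.1.1.add hg.1.1, ?_⟩
    filter_upwards [hf.1.2, hg.1.2] with x h1 h2
    exact (abs_add_le _ _).trans (add_le_add h1 h2)

lemma SobolevLE.const_mul {m : ℕ} {A : ℝ} {f : Space N → ℝ} (c : ℝ) (hf : SobolevLE m A f) :
    SobolevLE m (|c| * A) (fun x => c * f x) := by
  induction m generalizing f with
  | zero =>
    refine ⟨hf.1.const_mul c, ?_⟩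
    filter_upwards [hf.2] with x h1
    rw [abs_mul]; gcongr
  | succ m ih =>
    refine SobolevLE.succ ?_ (fun i => (hf.hasWeakPartial i).const_mul c)
      (fun i => ih (hf.weakD i))
    refine ⟨hf.1.1.const_mul c, ?_⟩
    filter_upwards [hf.1.2] with x h1
    rw [abs_mul]; gcongr

lemma SobolevLE.neg {m : ℕ} {A : ℝ} {f : Space N → ℝ} (hf : SobolevLE m A f) :
    SobolevLE m A (fun x => -f x) := by
  simpa using hf.const_mul (-1)

lemma SobolevLE.sub {m : ℕ} {A B : ℝ} {f g : Space N → ℝ} (hf : SobolevLE m A f)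
    (hg : SobolevLE m B g) : SobolevLE m (A + B) (fun x => f x - g x) := by
  simpa [sub_eq_add_neg] using hf.add hg.neg

lemma HasWeakPartial.zero (i : Fin N) : HasWeakPartial i (fun _ : Space N => (0 : ℝ)) fun _ => 0 where
  locInt_left := locallyIntegrable_zero
  locInt_right := locallyIntegrable_zero
  integral_eq φ hφ hc := by simp

lemma SobolevLE.zero (m : ℕ) : SobolevLE m 0 (fun _ : Space N => 0) := by
  induction m with
  | zero => exact ⟨aestronglyMeasurable_const, by simp⟩
  | succ m ih =>
    exact SobolevLE.succ ⟨aestronglyMeasurable_const, by simp⟩ HasWeakPartial.zero fun _ => ih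

lemma SobolevLE.finset_sum {ι : Type*} {m : ℕ} {A : ι → ℝ} {f : ι → Space N → ℝ} (s : Finset ι)
    (hf : ∀ i ∈ s, SobolevLE m (A i) (f i)) :
    SobolevLE m (∑ i ∈ s, A i) (fun x => ∑ i ∈ s, f i x) := by
  classical
  induction s using Finset.induction_on with
  | empty => simpa using SobolevLE.zero m
  | insert a s ha ih =>
    simp only [Finset.sum_insert ha]
    exact (hf a (by simp)).add (ih fun i hi => hf i (by simp [hi]))

lemma SobolevLE.sum {m : ℕ} {A : ℝ} {f : Fin N → Space N → ℝ}
    (hf : ∀ i, SobolevLE m A (f i)) : SobolevLE m (N * A) (fun x => ∑ i, f i x) := by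
  simpa using SobolevLE.finset_sum (A := fun _ => A) Finset.univ fun i _ => hf i

lemma HasWeakPartial.sum {i : Fin N} {ι : Type*} {f g : ι → Space N → ℝ} (s : Finset ι)
    (h : ∀ k, HasWeakPartial i (f k) (g k)) :
    HasWeakPartial i (fun x => ∑ k ∈ s, f k x) (fun x => ∑ k ∈ s, g k x) := by
  classical
  induction s using Finset.induction_on with
  | empty => simpa using HasWeakPartial.zero i
  | insert a s ha ih =>
    simp only [Finset.sum_insert ha]
    exact (h a).add ih

lemma HasWeakPartial.sub {i : Fin N} {f f' g g' : Space N → ℝ} (h : HasWeakPartial i f g)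
    (h' : HasWeakPartial i f' g') :
    HasWeakPartial i (fun x => f x - f' x) (fun x => g x - g' x) := by
  simpa [sub_eq_add_neg] using h.add (h'.const_mul (-1))

lemma SobolevLE.shift {m : ℕ} {A : ℝ} {f : Space N → ℝ} (hf : SobolevLE m A f) (a : Space N) :
    SobolevLE m A (fun x => f (x + a)) := by
  have h0 : ∀ {m} {f : Space N → ℝ}, SobolevLE m A f → SobolevLE 0 A (fun x => f (x + a)) :=
    fun hf => ⟨hf.aestronglyMeasurable.comp_quasiMeasurePreserving
      (measurePreserving_add_right volume a).quasiMeasurePreserving, ae_comp_add hf.bound a⟩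
  induction m generalizing f with
  | zero => exact h0 hf
  | succ m ih =>
    exact SobolevLE.succ (h0 hf) (fun i => (hf.hasWeakPartial i).shift a) (fun i => ih (hf.weakD i))

lemma abs_mul_le_mul {a b A B : ℝ} (h1 : |a| ≤ A) (h2 : |b| ≤ B) : |a * b| ≤ A * B := by
  rw [abs_mul]
  exact mul_le_mul h1 h2 (abs_nonneg _) ((abs_nonneg _).trans h1)

/-- The product rule produces two terms at each level, hence the factor `2 ^ m`. -/
lemma SobolevLE.mul {m : ℕ} {A B : ℝ} {f g : Space N → ℝ} (hf : SobolevLE m A f)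
    (hg : SobolevLE m B g) : SobolevLE m (2 ^ m * (A * B)) (fun x => f x * g x) := by
  induction m generalizing f g with
  | zero =>
    refine ⟨hf.1.mul hg.1, ?_⟩
    filter_upwards [hf.2, hg.2] with x h1 h2
    simpa using abs_mul_le_mul h1 h2
  | succ m ih =>
    refine SobolevLE.succ ?_ (fun i => (hf.hasWeakPartial i).mul (hg.hasWeakPartial i)
      hf.bound (hf.weakD i).bound hg.bound (hg.weakD i).bound) (fun i => ?_)
    · refine ⟨hf.1.1.mul hg.1.1, ?_⟩
      filter_upwards [hf.1.2, hg.1.2] with x h1 h2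
      refine (abs_mul_le_mul h1 h2).trans (le_mul_of_one_le_left ?_ (one_le_pow₀ (by norm_num)))
      exact mul_nonneg hf.nonneg hg.nonneg
    · refine ((ih (hf.weakD i) hg.of_succ).add (ih hf.of_succ (hg.weakD i))).mono (le_of_eq ?_)
      ring

/-- A product estimate that is linear in the norms of the highest order. -/
lemma SobolevLE.mul_tame {m : ℕ} {A A' B B' : ℝ} {f g : Space N → ℝ} (hf : SobolevLE (m + 1) A f)
    (hf' : SobolevLE m A' f) (hg : SobolevLE (m + 1) B g) (hg' : SobolevLE m B' g) :
    SobolevLE (m + 1) (2 ^ m * (A * B' + A' * B)) (fun x => f x * g x) := by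
  refine SobolevLE.succ ?_ (fun i => (hf.hasWeakPartial i).mul (hg.hasWeakPartial i)
    hf.bound (hf.weakD i).bound hg.bound (hg.weakD i).bound) (fun i => ?_)
  · refine ⟨hf.1.1.mul hg.1.1, ?_⟩
    filter_upwards [hf.bound, hg'.bound] with x h1 h2
    have h3 : 0 ≤ A * B' := mul_nonneg hf.nonneg hg'.nonneg
    have h4 : 0 ≤ A' * B := mul_nonneg hf'.nonneg hg.nonneg
    calc |f x * g x| ≤ A * B' := abs_mul_le_mul h1 h2
      _ ≤ A * B' + A' * B := by linarith
      _ ≤ _ := le_mul_of_one_le_left (by linarith) (one_le_pow₀ (by norm_num))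
  · refine (((hf.weakD i).mul hg').add (hf'.mul (hg.weakD i))).mono (le_of_eq ?_)
    ring

end

section

/-! ### Differences, Lipschitz representatives and weak limits -/

lemma hasDerivAt_line {f : Space N → ℝ} (hf : Differentiable ℝ f) (x v : Space N) (s : ℝ) :
    HasDerivAt (fun s : ℝ => f (x + s • v)) (fderiv ℝ f (x + s • v) v) s := by
  have h1 : HasDerivAt (fun s : ℝ => x + s • v) v s := by
    simpa using ((hasDerivAt_id s).smul_const v).const_add x
  exact (hf (x + s • v)).hasFDerivAt.comp_hasDerivAt s h1

lemma abs_line_sub_le {f : Space N → ℝ} {C : ℝ} {i : Fin N} (hf : Differentiable ℝ f)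
    (hb : ∀ x, |fderiv ℝ f x (basisVec i)| ≤ C) (x : Space N) (h : ℝ) :
    |f (x + h • basisVec i) - f x| ≤ C * |h| := by
  have := Convex.norm_image_sub_le_of_norm_hasDerivWithin_le (s := univ) (x := 0) (y := h)
    (f := fun s : ℝ => f (x + s • basisVec i))
    (fun s _ => (hasDerivAt_line hf x (basisVec i) s).hasDerivWithinAt)
    (fun s _ => hb _) convex_univ (mem_univ _) (mem_univ _)
  simpa using this

/-- The mean value inequality holds for the mollifications with the same constant `C` and passes to
the almost everywhere limit. Higher orders follow because weak derivatives commute with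
translations. -/
lemma SobolevLE.difference {m : ℕ} {C : ℝ} {f : Space N → ℝ} (hf : SobolevLE (m + 1) C f)
    (i : Fin N) (h : ℝ) :
    SobolevLE m (C * |h|) (fun x => f (x + h • basisVec i) - f x) := by
  have h0 : ∀ {m} {f : Space N → ℝ}, SobolevLE (m + 1) C f →
      SobolevLE 0 (C * |h|) (fun x => f (x + h • basisVec i) - f x) := by
    intro m f hf
    refine ⟨((hf.shift (h • basisVec i)).sub hf).aestronglyMeasurable, ?_⟩
    have ht := ae_tendsto_mol hf.locallyIntegrable
    filter_upwards [ht, ae_comp_add ht (h • basisVec i)] with x h1 h2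
    refine le_of_tendsto (h2.sub h1).abs (Eventually.of_forall fun n => ?_)
    refine abs_line_sub_le ((contDiff_mol n hf.locallyIntegrable).differentiable (by simp))
      (fun y => ?_) x h
    rw [fderiv_mol (hf.hasWeakPartial i)]
    exact abs_mol_le n y (hf.weakD i).bound
  induction m generalizing f with
  | zero => exact h0 hf
  | succ m ih =>
    exact SobolevLE.succ (h0 hf)
      (fun j => ((hf.hasWeakPartial j).shift _).sub (hf.hasWeakPartial j))
      (fun j => ih (hf.weakD j))

lemma abs_line_taylor_le {f : Space N → ℝ} {C : ℝ} {i : Fin N} (hf : Differentiable ℝ f)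
    (hb : ∀ x h, |fderiv ℝ f (x + h • basisVec i) (basisVec i) - fderiv ℝ f x (basisVec i)|
      ≤ C * |h|) (hC : 0 ≤ C) (x : Space N) (h : ℝ) :
    |f (x + h • basisVec i) - f x - h * fderiv ℝ f x (basisVec i)| ≤ C * h ^ 2 := by
  have := Convex.norm_image_sub_le_of_norm_hasDerivWithin_le (s := uIcc 0 h) (x := 0) (y := h)
    (C := C * |h|)
    (f := fun s : ℝ => f (x + s • basisVec i) - s * fderiv ℝ f x (basisVec i))
    (fun s _ => ((hasDerivAt_line hf x (basisVec i) s).sub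
      ((hasDerivAt_id s).mul_const (fderiv ℝ f x (basisVec i)))).hasDerivWithinAt)
    (fun s hs => ?_) (convex_uIcc 0 h) left_mem_uIcc right_mem_uIcc
  · simp only [Real.norm_eq_abs, zero_smul, add_zero, zero_mul, sub_zero] at this
    calc _ = |f (x + h • basisVec i) - h * fderiv ℝ f x (basisVec i) - f x| := by
          congr 1; ring
      _ ≤ C * |h| * |h| := this
      _ = C * h ^ 2 := by rw [mul_assoc, ← sq, sq_abs]
  · have h1 := hb x s
    have h2 : |s| ≤ |h| := by simpa using abs_sub_left_of_mem_uIcc hs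
    simp only [one_mul, Real.norm_eq_abs]
    exact h1.trans (by gcongr)

/-- First order Taylor expansion in the direction of a basis vector. -/
lemma SobolevLE.taylor {m : ℕ} {C : ℝ} {f g : Space N → ℝ} {i : Fin N}
    (hf : SobolevLE (m + 2) C f) (hg : HasWeakPartial i f g) (h : ℝ) :
    SobolevLE m (C * h ^ 2) (fun x => f (x + h • basisVec i) - f x - h * g x) := by
  have h0 : ∀ {m} {f g : Space N → ℝ}, SobolevLE (m + 2) C f → HasWeakPartial i f g →
      SobolevLE 0 (C * h ^ 2) (fun x => f (x + h • basisVec i) - f x - h * g x) := by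
    intro m f g hf hg
    have hsg := hf.of_hasWeakPartial hg
    refine ⟨(((hf.shift (h • basisVec i)).sub hf).zero_level.sub
      (hsg.const_mul h).zero_level).aestronglyMeasurable, ?_⟩
    have ht := ae_tendsto_mol hf.locallyIntegrable
    filter_upwards [ht, ae_comp_add ht (h • basisVec i), ae_tendsto_mol hg.locInt_right]
      with x h1 h2 h3
    refine le_of_tendsto ((h2.sub h1).sub (h3.const_mul h)).abs (Eventually.of_forall fun n => ?_)
    rw [← fderiv_mol hg]
    refine abs_line_taylor_le ((contDiff_mol n hf.locallyIntegrable).differentiable (by simp))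
      (fun y k => ?_) hf.nonneg x h
    rw [fderiv_mol hg, fderiv_mol hg]
    refine abs_line_sub_le ((contDiff_mol n hg.locInt_right).differentiable (by simp))
      (fun z => ?_) y k
    rw [fderiv_mol (hsg.hasWeakPartial i)]
    exact abs_mol_le n z (hsg.weakD i).bound
  induction m generalizing f g with
  | zero => exact h0 hf hg
  | succ m ih =>
    have hsg := hf.of_hasWeakPartial hg
    exact SobolevLE.succ (h0 hf hg)
      (fun j => (((hf.hasWeakPartial j).shift _).sub (hf.hasWeakPartial j)).sub
        ((hsg.hasWeakPartial j).const_mul h))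
      (fun j => ih (hf.weakD j) (hg.comm (hsg.hasWeakPartial j) (hf.hasWeakPartial j)))

lemma norm_clm_le_sum (L : Space N →L[ℝ] ℝ) {C : ℝ} (hC : 0 ≤ C)
    (h : ∀ i, |L (basisVec i)| ≤ C) : ‖L‖ ≤ N * C := by
  refine L.opNorm_le_bound (by positivity) fun x => ?_
  have hx : x = ∑ i, x i • (basisVec i : Space N) := by
    ext j
    simp [Pi.single_apply]
  have h1 : L x = ∑ i, x i * L (basisVec i) := by
    conv_lhs => rw [hx]
    simp only [map_sum, map_smul, smul_eq_mul]
  rw [h1, Real.norm_eq_abs]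
  calc |∑ i, x i * L (basisVec i)| ≤ ∑ i, |x i * L (basisVec i)| := Finset.abs_sum_le_sum_abs _ _
    _ ≤ ∑ _i : Fin N, ‖x‖ * C := by
        refine Finset.sum_le_sum fun i _ => abs_mul_le_mul ?_ (h i)
        exact PiLp.norm_apply_le x i
    _ = N * C * ‖x‖ := by simp; ring

lemma lipschitzWith_of_partial {f : Space N → ℝ} {C : ℝ} (hC : 0 ≤ C) (hf : Differentiable ℝ f)
    (hb : ∀ x i, |fderiv ℝ f x (basisVec i)| ≤ C) : LipschitzWith (N * C).toNNReal f := by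
  refine lipschitzWith_of_nnnorm_fderiv_le hf fun x => ?_
  rw [← NNReal.coe_le_coe, Real.coe_toNNReal _ (by positivity)]
  exact norm_clm_le_sum _ hC (hb x)

/-- A bounded function whose distributional gradient is bounded agrees almost everywhere with a
Lipschitz function. -/
lemma exists_lipschitz_of_integral_le {f : Space N → ℝ} {C : ℝ}
    (hf : LocallyIntegrable f volume) (hC : 0 ≤ C)
    (h : ∀ i, ∀ φ : Space N → ℝ, ContDiff ℝ ∞ φ → HasCompactSupport φ →
      |∫ x, f x * fderiv ℝ φ x (basisVec i)| ≤ C * ∫ x, |φ x|) :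
    ∃ g : Space N → ℝ, LipschitzWith (N * C).toNNReal g ∧ f =ᵐ[volume] g := by
  have hL : ∀ n, LipschitzWith (N * C).toNNReal (mol n f) := by
    intro n
    refine lipschitzWith_of_partial hC ((contDiff_mol n hf).differentiable (by simp))
      fun x i => ?_
    have h1 := (hasCompactSupport_eta n).hasFDerivAt_convolution_right
      (ContinuousLinearMap.mul ℝ ℝ) hf ((contDiff_eta (N := N) n).of_le (by simp)) x
    have h2 := h i _ (contDiff_eta_sub n x) (hasCompactSupport_eta_sub n x)
    change |fderiv ℝ (f ⋆[ContinuousLinearMap.mul ℝ ℝ, volume] eta N n) x (basisVec i)| ≤ _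
    rw [h1.fderiv, convolution_precompR_apply _ hf ((hasCompactSupport_eta n).fderiv ℝ)
      ((contDiff_eta n).continuous_fderiv (by simp))]
    simp_rw [fderiv_eta_sub, abs_of_nonneg (eta_nonneg n _), integral_eta_sub] at h2
    simp only [mul_neg, integral_neg, abs_neg, mul_one] at h2
    exact h2
  have ht := ae_tendsto_mol hf
  -- The mollifications share a Lipschitz constant, so `f` is Lipschitz on the set of full measure
  -- where they converge to it. A Lipschitz function on a subset extends to the whole space with the
  -- same constant.
  have hon : LipschitzOnWith (N * C).toNNReal f {x | Tendsto (fun n => mol n f x) atTop (𝓝 (f x))} := by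
    refine LipschitzOnWith.of_dist_le_mul fun x hx y hy => ?_
    exact le_of_tendsto (Tendsto.dist hx hy) (Eventually.of_forall fun n => (hL n).dist_le_mul x y)
  obtain ⟨g, h1, h2⟩ := hon.extend_real
  exact ⟨g, h1, ht.mono fun x hx => h2 hx⟩

lemma hasWeakPartial_lipschitz {f : Space N → ℝ} {C : NNReal} (hf : LipschitzWith C f)
    (i : Fin N) : HasWeakPartial i f (fun x => lineDeriv ℝ f x (basisVec i)) where
  locInt_left := hf.continuous.locallyIntegrable
  locInt_right := hf.locallyIntegrable_lineDeriv _
  integral_eq φ hφ hc := by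
    obtain ⟨D, hD⟩ := (hφ.of_le (m := 1) (by simp)).lipschitzWith_of_hasCompactSupport hc (by simp)
    rw [hf.integral_lineDeriv_mul_eq hD hc]
    simp_rw [(hφ.differentiable (by simp)).differentiableAt.lineDeriv_eq_fderiv]
    simp [integral_neg, mul_comm]

lemma SobolevLE.abs_integral_partial_le {m : ℕ} {C : ℝ} {f : Space N → ℝ}
    (hf : SobolevLE (m + 1) C f) (i : Fin N) {φ : Space N → ℝ} (hφ : ContDiff ℝ ∞ φ)
    (hc : HasCompactSupport φ) : |∫ x, f x * fderiv ℝ φ x (basisVec i)| ≤ C * ∫ x, |φ x| := by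
  rw [(hf.hasWeakPartial i).integral_eq φ hφ hc, abs_neg]
  exact abs_integral_mul_le (hf.weakD i).bound (hφ.continuous.integrable_of_hasCompactSupport hc)

lemma SobolevLE.exists_lipschitz {m : ℕ} {C : ℝ} {f : Space N → ℝ} (hf : SobolevLE (m + 1) C f) :
    ∃ g : Space N → ℝ, LipschitzWith (N * C).toNNReal g ∧ f =ᵐ[volume] g :=
  exists_lipschitz_of_integral_le hf.locallyIntegrable hf.nonneg
    fun i _ hφ hc => hf.abs_integral_partial_le i hφ hc

/-- Duality between `L¹` and `L^∞`, tested on translated mollifiers, which have mass one and recover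
`f` almost everywhere. -/
lemma ae_abs_le_of_integral_le {f : Space N → ℝ} {C : ℝ} (hf : LocallyIntegrable f volume)
    (h : ∀ φ : Space N → ℝ, ContDiff ℝ ∞ φ → HasCompactSupport φ →
      |∫ x, f x * φ x| ≤ C * ∫ x, |φ x|) : ∀ᵐ x, |f x| ≤ C := by
  filter_upwards [ae_tendsto_mol hf] with x hx
  refine le_of_tendsto hx.abs (Eventually.of_forall fun n => ?_)
  have := h _ (contDiff_eta_sub n x) (hasCompactSupport_eta_sub n x)
  simpa [mol_apply, abs_of_nonneg (eta_nonneg n _), integral_eta_sub] using this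

/-- The balls of the Sobolev classes are closed under convergence in the sense of distributions. -/
lemma SobolevLE.of_tendsto {m : ℕ} {C : ℝ} {f : ℕ → Space N → ℝ} {g : Space N → ℝ}
    (hf : ∀ n, SobolevLE m C (f n)) (hg : LocallyIntegrable g volume)
    (h : ∀ φ : Space N → ℝ, ContDiff ℝ ∞ φ → HasCompactSupport φ →
      Tendsto (fun n => ∫ x, f n x * φ x) atTop (𝓝 (∫ x, g x * φ x))) : SobolevLE m C g := by
  have h0 : ∀ {m} {f : ℕ → Space N → ℝ} {g : Space N → ℝ}, (∀ n, SobolevLE m C (f n)) →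
      LocallyIntegrable g volume →
      (∀ φ : Space N → ℝ, ContDiff ℝ ∞ φ → HasCompactSupport φ →
        Tendsto (fun n => ∫ x, f n x * φ x) atTop (𝓝 (∫ x, g x * φ x))) → SobolevLE 0 C g := by
    intro m f g hf hg h
    refine ⟨hg.aestronglyMeasurable, ae_abs_le_of_integral_le hg fun φ hφ hc => ?_⟩
    exact le_of_tendsto (h φ hφ hc).abs (Eventually.of_forall fun n =>
      abs_integral_mul_le (hf n).bound (hφ.continuous.integrable_of_hasCompactSupport hc))
  induction m generalizing f g with
  | zero => exact h0 hf hg h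
  | succ m ih =>
    -- Weak compactness is avoided here. The bound on the distributional gradient passes to the
    -- limit and makes `g` almost everywhere equal to a Lipschitz function, whose line derivatives
    -- are the weak derivatives sought.
    obtain ⟨g', hg', hgg'⟩ := exists_lipschitz_of_integral_le hg (hf 0).nonneg
      fun i φ hφ hc => le_of_tendsto
        (h _ (contDiff_partial hφ (basisVec i)) (hasCompactSupport_partial hc _)).abs
        (Eventually.of_forall fun n => (hf n).abs_integral_partial_le i hφ hc)
    have hw : ∀ i, HasWeakPartial i g (fun x => lineDeriv ℝ g' x (basisVec i)) := fun i =>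
      (hasWeakPartial_lipschitz hg' i).congr hgg'.symm (ae_eq_refl _)
    refine SobolevLE.succ (h0 hf hg h) hw fun i => ?_
    refine ih (fun n => (hf n).weakD i) (hw i).locInt_right fun φ hφ hc => ?_
    have h1 := (h _ (contDiff_partial hφ (basisVec i)) (hasCompactSupport_partial hc _)).neg
    rw [(hw i).integral_eq φ hφ hc] at h1
    simpa [((hf _).hasWeakPartial i).integral_eq φ hφ hc] using h1

end

section

/-! ### Convolution with an integrable kernel -/

/-- The convolution of two real functions. -/
def conv (K f : Space N → ℝ) : Space N → ℝ := K ⋆[ContinuousLinearMap.mul ℝ ℝ, volume] f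

lemma conv_apply (K f : Space N → ℝ) (x : Space N) : conv K f x = ∫ y, K y * f (x - y) := rfl

lemma conv_apply_swap (K f : Space N → ℝ) (x : Space N) :
    conv K f x = ∫ z, K (x - z) * f z := convolution_mul_swap

lemma ae_comp_sub_left {p : Space N → Prop} (h : ∀ᵐ x, p x) (a : Space N) :
    ∀ᵐ x, p (a - x) :=
  (quasiMeasurePreserving_sub_left_of_right_invariant volume a).ae h

lemma integrable_conv_integrand {K f : Space N → ℝ} {C : ℝ} (hK : Integrable K)
    (hf : AEStronglyMeasurable f volume) (hb : ∀ᵐ x, |f x| ≤ C) (x : Space N) :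
    Integrable (fun y => K y * f (x - y)) := by
  refine (hK.abs.mul_const C).mono'
    (hK.aestronglyMeasurable.convolution_integrand_snd (ContinuousLinearMap.mul ℝ ℝ) hf x) ?_
  filter_upwards [ae_comp_sub_left hb x] with y hy
  rw [Real.norm_eq_abs, abs_mul]
  gcongr

lemma abs_conv_le {K f : Space N → ℝ} {C : ℝ} (hK : Integrable K) (hb : ∀ᵐ x, |f x| ≤ C)
    (x : Space N) : |conv K f x| ≤ (∫ y, |K y|) * C := by
  rw [conv_apply, ← integral_mul_const]
  refine norm_integral_le_of_norm_le (f := fun y => K y * f (x - y)) (hK.abs.mul_const C) ?_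
  filter_upwards [ae_comp_sub_left hb x] with y hy
  rw [Real.norm_eq_abs, abs_mul]
  gcongr

lemma aestronglyMeasurable_conv {K f : Space N → ℝ} (hK : Integrable K)
    (hf : AEStronglyMeasurable f volume) : AEStronglyMeasurable (conv K f) volume :=
  (hK.aestronglyMeasurable.convolution_integrand (ContinuousLinearMap.mul ℝ ℝ)
    hf).integral_prod_right'

lemma conv_add {K f g : Space N → ℝ} {A B : ℝ} {m m' : ℕ} (hK : Integrable K)
    (hf : SobolevLE m A f) (hg : SobolevLE m' B g) (x : Space N) :
    conv K (fun x => f x + g x) x = conv K f x + conv K g x := by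
  simp only [conv_apply, mul_add]
  exact integral_add (integrable_conv_integrand hK hf.aestronglyMeasurable hf.bound x)
    (integrable_conv_integrand hK hg.aestronglyMeasurable hg.bound x)

lemma conv_const_mul (K f : Space N → ℝ) (c : ℝ) (x : Space N) :
    conv K (fun x => c * f x) x = c * conv K f x := by
  simp only [conv_apply, ← integral_const_mul]
  congr 1; ext y; ring

lemma conv_sub {K f g : Space N → ℝ} {A B : ℝ} {m m' : ℕ} (hK : Integrable K)
    (hf : SobolevLE m A f) (hg : SobolevLE m' B g) (x : Space N) :
    conv K (fun x => f x - g x) x = conv K f x - conv K g x := by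
  have h := conv_add hK hf hg.neg x
  have h' := conv_const_mul K g (-1) x
  simp only [neg_mul, one_mul] at h'
  simp only [sub_eq_add_neg, h, h']

lemma continuous_conv {K f : Space N → ℝ} {C : ℝ} (hK : Integrable K) (hf : Continuous f)
    (hb : ∀ x, |f x| ≤ C) : Continuous (conv K f) :=
  BddAbove.continuous_convolution_right_of_integrable _
    ⟨C, by rintro _ ⟨x, rfl⟩; exact hb x⟩ hK hf

/-- Fubini, arranged so that the test function meets translates of `f`. This is the form used to put
the derivative on `f`. -/
lemma integral_conv_mul {K f φ : Space N → ℝ} {C : ℝ} (hK : Integrable K)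
    (hf : AEStronglyMeasurable f volume) (hb : ∀ᵐ x, |f x| ≤ C) (hφ : Integrable φ) :
    ∫ x, conv K f x * φ x = ∫ y, K y * ∫ x, f (x - y) * φ x := by
  have hm := hK.aestronglyMeasurable.convolution_integrand (ContinuousLinearMap.mul ℝ ℝ) hf
  have hbp : ∀ᵐ p : Space N × Space N ∂(volume.prod volume), |f (p.1 - p.2)| ≤ C :=
    (quasiMeasurePreserving_sub_of_right_invariant volume volume).ae hb
  have hi : Integrable (Function.uncurry fun x y : Space N => K y * f (x - y) * φ x)
      (volume.prod volume) := by
    refine ((hφ.abs.mul_prod hK.abs).const_mul C).mono'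
      (hm.mul hφ.aestronglyMeasurable.comp_fst) ?_
    filter_upwards [hbp] with p hp
    simp only [Function.uncurry, Real.norm_eq_abs, abs_mul]
    nlinarith [mul_nonneg (abs_nonneg (K p.2)) (abs_nonneg (φ p.1))]
  calc ∫ x, conv K f x * φ x = ∫ x, ∫ y, K y * f (x - y) * φ x := by
        simp_rw [integral_mul_const, conv_apply]
    _ = ∫ y, ∫ x, K y * f (x - y) * φ x := integral_integral_swap hi
    _ = _ := by simp_rw [mul_assoc, integral_const_mul]

/-- The other order of integration: the test function meets translates of the kernel, so that a
derivative can be put on `K`. This is the source of the gain of one derivative. -/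
lemma integral_conv_mul_swap {K f φ : Space N → ℝ} {C : ℝ} (hK : Integrable K)
    (hf : AEStronglyMeasurable f volume) (hb : ∀ᵐ x, |f x| ≤ C) (hφ : Integrable φ) :
    ∫ x, conv K f x * φ x = ∫ z, f z * ∫ x, K (x - z) * φ x := by
  have h1 := (hφ.convolution_integrand (μ := volume) (ContinuousLinearMap.mul ℝ ℝ)
    hK.comp_neg).swap
  have hi : Integrable (Function.uncurry fun x z : Space N => K (x - z) * f z * φ x)
      (volume.prod volume) := by
    have hm : AEStronglyMeasurable (fun p : Space N × Space N =>
        φ p.1 * K (p.1 - p.2)) (volume.prod volume) := by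
      refine h1.aestronglyMeasurable.congr (Eventually.of_forall fun p => ?_)
      simp [neg_sub]
    have hbp : ∀ᵐ p : Space N × Space N ∂(volume.prod volume), |f p.2| ≤ C :=
      Measure.quasiMeasurePreserving_snd.ae hb
    refine (h1.abs.const_mul C).mono' ((hm.mul hf.comp_snd).congr
      (Eventually.of_forall fun p => ?_)) ?_
    · simp only [Function.uncurry]; simp only [Pi.mul_apply]; ring
    · filter_upwards [hbp] with p hp
      simp only [Function.uncurry, Real.norm_eq_abs, abs_mul, Function.comp, Prod.fst_swap,
        Prod.snd_swap, neg_sub, ContinuousLinearMap.mul_apply']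
      nlinarith [mul_nonneg (abs_nonneg (K (p.1 - p.2))) (abs_nonneg (φ p.1))]
  calc ∫ x, conv K f x * φ x = ∫ x, ∫ z, K (x - z) * f z * φ x := by
        simp_rw [integral_mul_const, conv_apply_swap]
    _ = ∫ z, ∫ x, K (x - z) * f z * φ x := integral_integral_swap hi
    _ = _ := by
        congr 1; ext z; rw [← integral_const_mul]; congr 1; ext x; ring

lemma locallyIntegrable_conv {K f : Space N → ℝ} {C : ℝ} (hK : Integrable K)
    (hf : AEStronglyMeasurable f volume) (hb : ∀ᵐ x, |f x| ≤ C) :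
    LocallyIntegrable (conv K f) volume :=
  locallyIntegrable_of_bound (aestronglyMeasurable_conv hK hf)
    (Eventually.of_forall fun x => abs_conv_le hK hb x)

lemma HasWeakPartial.conv_right {i : Fin N} {K f g : Space N → ℝ} {A B : ℝ} (hK : Integrable K)
    (h : HasWeakPartial i f g) (hA : ∀ᵐ x, |f x| ≤ A) (hB : ∀ᵐ x, |g x| ≤ B) :
    HasWeakPartial i (conv K f) (conv K g) where
  locInt_left := locallyIntegrable_conv hK h.locInt_left.aestronglyMeasurable hA
  locInt_right := locallyIntegrable_conv hK h.locInt_right.aestronglyMeasurable hB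
  integral_eq φ hφ hc := by
    rw [integral_conv_mul hK h.locInt_left.aestronglyMeasurable hA
      ((contDiff_partial hφ (basisVec i)).continuous.integrable_of_hasCompactSupport
        (hasCompactSupport_partial hc _)),
      integral_conv_mul hK h.locInt_right.aestronglyMeasurable hB
        (hφ.continuous.integrable_of_hasCompactSupport hc), ← integral_neg]
    congr 1; ext y
    have := (h.shift (-y)).integral_eq φ hφ hc
    simp only [← sub_eq_add_neg] at this
    rw [this]; ring

lemma HasWeakPartial.conv_left {i : Fin N} {K H f : Space N → ℝ} {A : ℝ} (hK : Integrable K)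
    (hH : Integrable H) (h : HasWeakPartial i K H) (hf : AEStronglyMeasurable f volume)
    (hA : ∀ᵐ x, |f x| ≤ A) : HasWeakPartial i (conv K f) (conv H f) where
  locInt_left := locallyIntegrable_conv hK hf hA
  locInt_right := locallyIntegrable_conv hH hf hA
  integral_eq φ hφ hc := by
    rw [integral_conv_mul_swap hK hf hA
      ((contDiff_partial hφ (basisVec i)).continuous.integrable_of_hasCompactSupport
        (hasCompactSupport_partial hc _)),
      integral_conv_mul_swap hH hf hA
        (hφ.continuous.integrable_of_hasCompactSupport hc), ← integral_neg]
    congr 1; ext z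
    have := (h.shift (-z)).integral_eq φ hφ hc
    simp only [← sub_eq_add_neg] at this
    rw [this]; ring

lemma SobolevLE.conv {m : ℕ} {C κ : ℝ} {K f : Space N → ℝ} (hK : Integrable K)
    (hκ : ∫ y, |K y| ≤ κ) (hf : SobolevLE m C f) : SobolevLE m (κ * C) (conv K f) := by
  have h0 : ∀ {m} {f : Space N → ℝ}, SobolevLE m C f →
      SobolevLE 0 (κ * C) (Aggregation.conv K f) := fun hf =>
    ⟨aestronglyMeasurable_conv hK hf.aestronglyMeasurable, Eventually.of_forall fun x =>
      (abs_conv_le hK hf.bound x).trans (mul_le_mul_of_nonneg_right hκ hf.nonneg)⟩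
  induction m generalizing f with
  | zero => exact h0 hf
  | succ m ih =>
    exact SobolevLE.succ (h0 hf)
      (fun i => (hf.hasWeakPartial i).conv_right hK hf.bound (hf.weakD i).bound)
      (fun i => ih (hf.weakD i))

/-- Convolution with a `W^{1,1}` kernel gains one derivative. -/
lemma SobolevLE.conv_succ {m : ℕ} {C κ : ℝ} {K f : Space N → ℝ} {H : Fin N → Space N → ℝ}
    (hK : Integrable K) (hH : ∀ i, Integrable (H i)) (h : ∀ i, HasWeakPartial i K (H i))
    (hκ : ∫ y, |K y| ≤ κ) (hκ' : ∀ i, ∫ y, |H i y| ≤ κ) (hf : SobolevLE m C f) :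
    SobolevLE (m + 1) (κ * C) (Aggregation.conv K f) :=
  SobolevLE.succ (hf.conv hK hκ).zero_level
    (fun i => (h i).conv_left hK (hH i) hf.aestronglyMeasurable hf.bound)
    (fun i => hf.conv (hH i) (hκ' i))

/-! ### Classical regularity -/

/-- The linear form with given values on the canonical basis. -/
def coordForm (g : Fin N → ℝ) : Space N →L[ℝ] ℝ :=
  ∑ i, g i • (EuclideanSpace.proj i : EuclideanSpace ℝ (Fin N) →L[ℝ] ℝ)

lemma coordForm_apply (g : Fin N → ℝ) (v : Space N) : coordForm g v = ∑ i, g i * v i := by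
  simp [coordForm]

lemma coordForm_basisVec (g : Fin N → ℝ) (i : Fin N) : coordForm g (basisVec i) = g i := by
  simp [coordForm_apply]

lemma eq_coordForm (L : Space N →L[ℝ] ℝ) : L = coordForm fun i => L (basisVec i) := by
  ext x
  have hx : x = ∑ i, x i • (basisVec i : Space N) := by
    ext j
    simp [Pi.single_apply]
  conv_lhs => rw [hx]
  simp [coordForm_apply, mul_comm]

lemma continuous_coordForm : Continuous (coordForm : (Fin N → ℝ) → Space N →L[ℝ] ℝ) := by
  unfold coordForm
  fun_prop

/-- A continuous function with Lipschitz weak partial derivatives is differentiable, and its weak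
partial derivatives are the classical ones. -/
lemma hasFDerivAt_of_hasWeakPartial {f : Space N → ℝ} {g : Fin N → Space N → ℝ} {L : NNReal}
    (hf : Continuous f) (hg : ∀ i, LipschitzWith L (g i)) (h : ∀ i, HasWeakPartial i f (g i))
    (x : Space N) : HasFDerivAt f (coordForm fun i => g i x) x := by
  -- The mollified gradients converge uniformly, at the rate `N * L * rOut`, because each `g i` has
  -- Lipschitz constant `L`.
  refine hasFDerivAt_of_tendstoUniformly (l := atTop) (f := fun n => mol n f)
    (f' := fun n x => coordForm fun i => mol n (g i) x) (g' := fun x => coordForm fun i => g i x)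
    ?_ (fun n y => ?_) (fun y => tendsto_mol_of_continuous hf y) x
  · rw [Metric.tendstoUniformly_iff]
    intro ε hε
    have ht : Tendsto (fun n => (N : ℝ) * (L * (bump N n).rOut)) atTop (𝓝 0) := by
      simpa using (tendsto_bump.const_mul (L : ℝ)).const_mul (N : ℝ)
    filter_upwards [ht.eventually_lt_const hε] with n hn y
    refine lt_of_le_of_lt ?_ hn
    rw [dist_eq_norm]
    refine norm_clm_le_sum _ (by have := (bump N n).rOut_pos; positivity) fun i => ?_
    rw [sub_apply, coordForm_basisVec, coordForm_basisVec, ← Real.dist_eq,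
      dist_comm]
    refine dist_mol_le (hg i).continuous fun z hz => ?_
    exact ((hg i).dist_le_mul z y).trans (by gcongr; exact (Metric.mem_ball.1 hz).le)
  · have hd := ((contDiff_mol n hf.locallyIntegrable).differentiable (by simp) y).hasFDerivAt
    rw [eq_coordForm (fderiv ℝ (mol n f) y)] at hd
    simpa only [fderiv_mol (h _)] using hd

/-- With two bounded weak derivatives, the first order ones have Lipschitz representatives, so a
continuous `f` is differentiable in the classical sense. -/
lemma SobolevLE.hasFDerivAt {m : ℕ} {C : ℝ} {f : Space N → ℝ} (hf : SobolevLE (m + 2) C f)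
    (hc : Continuous f) : ∃ g : Fin N → Space N → ℝ, (∀ i, LipschitzWith (N * C).toNNReal (g i)) ∧
      (∀ i, HasWeakPartial i f (g i)) ∧ ∀ x, HasFDerivAt f (coordForm fun i => g i x) x := by
  choose g hg hgf using fun i => (hf.weakD i).exists_lipschitz
  have hw : ∀ i, HasWeakPartial i f (g i) := fun i =>
    (hf.hasWeakPartial i).congr (ae_eq_refl _) (hgf i)
  exact ⟨g, hg, hw, hasFDerivAt_of_hasWeakPartial hc hg hw⟩

lemma SobolevLE.contDiff {m : ℕ} {C : ℝ} {f : Space N → ℝ} (hf : SobolevLE (m + 2) C f)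
    (hc : Continuous f) : ContDiff ℝ 1 f := by
  obtain ⟨g, hg, -, hd⟩ := hf.hasFDerivAt hc
  rw [contDiff_one_iff_fderiv]
  refine ⟨fun x => (hd x).differentiableAt, ?_⟩
  have : fderiv ℝ f = fun x => coordForm fun i => g i x := funext fun x => (hd x).fderiv
  rw [this]
  exact continuous_coordForm.comp (continuous_pi fun i => (hg i).continuous)

lemma SobolevLE.hasWeakPartial_fderiv {m : ℕ} {C : ℝ} {f : Space N → ℝ}
    (hf : SobolevLE (m + 2) C f) (hc : Continuous f) (i : Fin N) :
    HasWeakPartial i f (fun x => fderiv ℝ f x (basisVec i)) := by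
  obtain ⟨g, -, hw, hd⟩ := hf.hasFDerivAt hc
  simpa only [(hd _).fderiv, coordForm_basisVec] using hw i

/-- Comes from the bound on increments, which holds at every point by continuity; continuity of the
derivative plays no role. -/
lemma SobolevLE.abs_fderiv_le {m : ℕ} {C : ℝ} {f : Space N → ℝ} (hf : SobolevLE (m + 1) C f)
    (hd : Differentiable ℝ f) (i : Fin N) (x : Space N) : |fderiv ℝ f x (basisVec i)| ≤ C := by
  have h1 := hasDerivAt_line hd x (basisVec i) 0
  rw [zero_smul, add_zero] at h1
  refine h1.le_of_lip' hf.nonneg (Eventually.of_forall fun s => ?_)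
  have h2 := (hf.difference i s).abs_le (by have := hd.continuous; fun_prop) x
  simpa using h2

end

section

/-! ### The finite difference scheme -/

/-- The symmetric difference quotient in the direction `i`. -/
def dif (i : Fin N) (h : ℝ) (f : Space N → ℝ) : Space N → ℝ := fun x =>
  (f (x + h • basisVec i) - f (x + (-h) • basisVec i)) / (2 * h)

/-- The second difference quotient in the direction `i`. -/
def lap (i : Fin N) (h : ℝ) (f : Space N → ℝ) : Space N → ℝ := fun x =>
  (f (x + h • basisVec i) + f (x + (-h) • basisVec i) - 2 * f x) / h ^ 2

lemma HasWeakPartial.dif {i j : Fin N} {f g : Space N → ℝ} (hf : HasWeakPartial j f g) (h : ℝ) :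
    HasWeakPartial j (dif i h f) (dif i h g) := by
  refine (((hf.shift (h • basisVec i)).sub (hf.shift ((-h) • basisVec i))).const_mul
    (1 / (2 * h))).congr ?_ ?_ <;>
  exact Eventually.of_forall fun x => by simp only [Aggregation.dif]; ring

lemma HasWeakPartial.lap {i j : Fin N} {f g : Space N → ℝ} (hf : HasWeakPartial j f g) (h : ℝ) :
    HasWeakPartial j (lap i h f) (lap i h g) := by
  refine ((((hf.shift (h • basisVec i)).add (hf.shift ((-h) • basisVec i))).sub
    (hf.const_mul 2)).const_mul (1 / h ^ 2)).congr ?_ ?_ <;>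
  exact Eventually.of_forall fun x => by simp only [Aggregation.lap]; ring

lemma SobolevLE.dif {m : ℕ} {C : ℝ} {f : Space N → ℝ} (hf : SobolevLE (m + 1) C f) (i : Fin N)
    {h : ℝ} (hh : 0 < h) : SobolevLE m C (dif i h f) := by
  refine ((((hf.difference i h).sub (hf.difference i (-h))).const_mul (1 / (2 * h))).congr
    (Eventually.of_forall fun x => ?_)).mono (le_of_eq ?_)
  · simp only [Aggregation.dif]; ring
  · rw [abs_neg, abs_of_pos hh, abs_of_pos (by positivity)]; field_simp; ring

/-- Costs no derivative but degenerates as `h → 0`; it serves only for measurability and for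
boundedness at fixed mesh. -/
lemma SobolevLE.dif_coarse {m : ℕ} {C : ℝ} {f : Space N → ℝ} (hf : SobolevLE m C f) (i : Fin N)
    {h : ℝ} (hh : 0 < h) : SobolevLE m (C / h) (Aggregation.dif i h f) := by
  refine ((((hf.shift (h • basisVec i)).sub (hf.shift ((-h) • basisVec i))).const_mul
    (1 / (2 * h))).congr (Eventually.of_forall fun x => ?_)).mono (le_of_eq ?_)
  · simp only [Aggregation.dif]; ring
  · rw [abs_of_pos (by positivity)]; field_simp; ring

lemma SobolevLE.dif_sub {m : ℕ} {C : ℝ} {f g : Space N → ℝ} {i : Fin N}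
    (hf : SobolevLE (m + 2) C f) (hg : HasWeakPartial i f g) {h : ℝ} (hh : 0 < h) :
    SobolevLE m (C * h) (fun x => Aggregation.dif i h f x - g x) := by
  refine ((((hf.taylor hg h).sub (hf.taylor hg (-h))).const_mul (1 / (2 * h))).congr
    (Eventually.of_forall fun x => ?_)).mono (le_of_eq ?_)
  · simp only [Aggregation.dif]; field_simp; ring
  · rw [abs_of_pos (by positivity)]; field_simp; ring

lemma SobolevLE.lap {m : ℕ} {C : ℝ} {f : Space N → ℝ} (hf : SobolevLE (m + 2) C f) (i : Fin N)
    {h : ℝ} (hh : 0 < h) : SobolevLE m (2 * C) (lap i h f) := by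
  have hg := hf.hasWeakPartial i
  refine ((((hf.taylor hg h).add (hf.taylor hg (-h))).const_mul (1 / h ^ 2)).congr
    (Eventually.of_forall fun x => ?_)).mono (le_of_eq ?_)
  · simp only [Aggregation.lap]; field_simp; ring
  · rw [abs_of_pos (by positivity)]; field_simp; ring

/-- The factor `1 / h` is harmless for a viscosity of order `h`: the viscous term stays bounded at
the cost of only one derivative. -/
lemma SobolevLE.lap_coarse {m : ℕ} {C : ℝ} {f : Space N → ℝ} (hf : SobolevLE (m + 1) C f)
    (i : Fin N) {h : ℝ} (hh : 0 < h) : SobolevLE m (2 * C / h) (Aggregation.lap i h f) := by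
  refine ((((hf.difference i h).add (hf.difference i (-h))).const_mul (1 / h ^ 2)).congr
    (Eventually.of_forall fun x => ?_)).mono (le_of_eq ?_)
  · simp only [Aggregation.lap]; ring
  · rw [abs_neg, abs_of_pos hh, abs_of_pos (by positivity)]; field_simp; ring

lemma SobolevLE.lap_coarser {m : ℕ} {C : ℝ} {f : Space N → ℝ} (hf : SobolevLE m C f)
    (i : Fin N) {h : ℝ} (hh : 0 < h) : SobolevLE m (4 * C / h ^ 2) (Aggregation.lap i h f) := by
  refine (((((hf.shift (h • basisVec i)).add (hf.shift ((-h) • basisVec i))).sub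
    (hf.const_mul 2)).const_mul (1 / h ^ 2)).congr
    (Eventually.of_forall fun x => ?_)).mono (le_of_eq ?_)
  · simp only [Aggregation.lap]; ring
  · rw [abs_of_pos (by positivity), abs_of_pos (by norm_num)]; field_simp; ring

/-- One explicit time step for `∂ₜ f = ν Δ f + div (f w)`, discretised in space with mesh `h`. -/
def lin (ν h τ : ℝ) (w : Fin N → Space N → ℝ) (f : Space N → ℝ) : Space N → ℝ := fun x =>
  f x + τ * ∑ i, (ν * lap i h f x + dif i h (fun y => f y * w i y) x)

/-- The mesh, viscosity and time step are such that the scheme is monotone for `|w| ≤ V`. -/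
structure Stable (N : ℕ) (ν h τ V : ℝ) : Prop where
  mesh_pos : 0 < h
  time_pos : 0 < τ
  time_le : 2 * N * (ν * τ) ≤ h ^ 2
  speed_le : V * h ≤ 2 * ν

/-- The step as a combination of values at `x` and its neighbours. The coefficients add up to `1 + τ
* ∑ i, dif i h (w i) x`, and `Stable` makes them nonnegative, so only an upper bound for the
discrete divergence of `w` enters the maximum principle. -/
lemma lin_eq {ν h τ : ℝ} (hh : 0 < h) (w : Fin N → Space N → ℝ) (f : Space N → ℝ) (x : Space N) :
    lin ν h τ w f x = (1 - 2 * N * (ν * τ) / h ^ 2) * f x +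
      ∑ i, ((ν * τ / h ^ 2 + τ / (2 * h) * w i (x + h • basisVec i)) * f (x + h • basisVec i) +
        (ν * τ / h ^ 2 - τ / (2 * h) * w i (x + (-h) • basisVec i)) *
          f (x + (-h) • basisVec i)) := by
  have h1 : 2 * N * (ν * τ) / h ^ 2 * f x = ∑ _i : Fin N, 2 * (ν * τ) / h ^ 2 * f x := by
    simp; ring
  rw [sub_mul, h1, one_mul, sub_add, ← Finset.sum_sub_distrib, sub_eq_add_neg,
    ← Finset.sum_neg_distrib, lin, Finset.mul_sum]
  congr 1
  refine Finset.sum_congr rfl fun i _ => ?_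
  simp only [lap, dif]
  field_simp
  ring

/-- The coefficients of the scheme are nonnegative. -/
lemma Stable.coeff_nonneg {ν h τ V u : ℝ} (hs : Stable N ν h τ V) (hu : |u| ≤ V) :
    0 ≤ ν * τ / h ^ 2 + τ / (2 * h) * u ∧ 0 ≤ ν * τ / h ^ 2 - τ / (2 * h) * u := by
  have h0 := hs.mesh_pos
  have h1 := hs.time_pos
  have h2 := hs.speed_le
  have h3 := abs_le.1 hu
  have e1 : ν * τ / h ^ 2 + τ / (2 * h) * u = τ / (2 * h ^ 2) * (2 * ν + u * h) := by
    field_simp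
  have e2 : ν * τ / h ^ 2 - τ / (2 * h) * u = τ / (2 * h ^ 2) * (2 * ν - u * h) := by
    field_simp
  rw [e1, e2]
  constructor
  · exact mul_nonneg (by positivity) (by nlinarith)
  · exact mul_nonneg (by positivity) (by nlinarith)

lemma Stable.center_nonneg {ν h τ V : ℝ} (hs : Stable N ν h τ V) :
    0 ≤ 1 - 2 * N * (ν * τ) / h ^ 2 := by
  have h0 := hs.mesh_pos
  rw [sub_nonneg, div_le_one (by positivity)]
  exact hs.time_le

lemma aestronglyMeasurable_lin {ν h τ A V : ℝ} (hh : 0 < h) {f : Space N → ℝ}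
    {w : Fin N → Space N → ℝ} (hf : SobolevLE 0 A f) (hw : ∀ i, SobolevLE 0 V (w i)) :
    AEStronglyMeasurable (lin ν h τ w f) volume :=
  (hf.add ((SobolevLE.sum fun i => ((hf.lap_coarser i hh).const_mul ν).add
    ((hf.mul (hw i)).dif_coarse i hh)).const_mul τ)).aestronglyMeasurable

/-- Discrete maximum principle. -/
lemma SobolevLE.lin_zero {ν h τ A V Q : ℝ} {f : Space N → ℝ} {w : Fin N → Space N → ℝ}
    (hs : Stable N ν h τ V) (hf : SobolevLE 0 A f) (hw : ∀ i, SobolevLE 0 V (w i))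
    (hQ : ∀ᵐ x, ∑ i, Aggregation.dif i h (w i) x ≤ Q) :
    SobolevLE 0 (A * (1 + τ * Q)) (lin ν h τ w f) := by
  refine ⟨aestronglyMeasurable_lin hs.mesh_pos hf hw, ?_⟩
  have hw' : ∀ᵐ x, ∀ i, |w i x| ≤ V := ae_all_iff.2 fun i => (hw i).bound
  have hp : ∀ᵐ x, ∀ i, |f (x + h • basisVec i)| ≤ A ∧ ∀ j, |w j (x + h • basisVec i)| ≤ V :=
    ae_all_iff.2 fun i => ae_comp_add (hf.bound.and hw') _
  have hm : ∀ᵐ x, ∀ i, |f (x + (-h) • basisVec i)| ≤ A ∧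
      ∀ j, |w j (x + (-h) • basisVec i)| ≤ V :=
    ae_all_iff.2 fun i => ae_comp_add (hf.bound.and hw') _
  filter_upwards [hf.bound, hp, hm, hQ] with x h1 h2 h3 h4
  rw [lin_eq hs.mesh_pos]
  have hA := hf.nonneg
  have hc := hs.center_nonneg
  have hsum : |∑ i, ((ν * τ / h ^ 2 + τ / (2 * h) * w i (x + h • basisVec i)) *
      f (x + h • basisVec i) + (ν * τ / h ^ 2 - τ / (2 * h) * w i (x + (-h) • basisVec i)) *
          f (x + (-h) • basisVec i))| ≤
      ∑ i, (2 * (ν * τ / h ^ 2) + τ * Aggregation.dif i h (w i) x) * A := by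
    refine (Finset.abs_sum_le_sum_abs _ _).trans (Finset.sum_le_sum fun i _ => ?_)
    have c1 := (hs.coeff_nonneg ((h2 i).2 i)).1
    have c2 := (hs.coeff_nonneg ((h3 i).2 i)).2
    refine (abs_add_le _ _).trans ?_
    rw [abs_mul, abs_mul, abs_of_nonneg c1, abs_of_nonneg c2]
    refine (add_le_add (mul_le_mul_of_nonneg_left (h2 i).1 c1)
      (mul_le_mul_of_nonneg_left (h3 i).1 c2)).trans (le_of_eq ?_)
    have := hs.mesh_pos
    simp only [Aggregation.dif]
    field_simp
    ring
  have e : ∑ i, (2 * (ν * τ / h ^ 2) + τ * Aggregation.dif i h (w i) x) * A =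
      2 * N * (ν * τ) / h ^ 2 * A + τ * (∑ i, Aggregation.dif i h (w i) x) * A := by
    rw [← Finset.sum_mul, Finset.sum_add_distrib, Finset.mul_sum _ _ τ]
    simp; ring
  have hfx : |(1 - 2 * N * (ν * τ) / h ^ 2) * f x| ≤ (1 - 2 * N * (ν * τ) / h ^ 2) * A := by
    rw [abs_mul, abs_of_nonneg hc]
    exact mul_le_mul_of_nonneg_left h1 hc
  have h5 : τ * (∑ i, Aggregation.dif i h (w i) x) * A ≤ τ * Q * A :=
    mul_le_mul_of_nonneg_right (mul_le_mul_of_nonneg_left h4 hs.time_pos.le) hA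
  calc _ ≤ _ := abs_add_le _ _
    _ ≤ (1 - 2 * N * (ν * τ) / h ^ 2) * A + (2 * N * (ν * τ) / h ^ 2 * A +
        τ * (∑ i, Aggregation.dif i h (w i) x) * A) := add_le_add hfx (hsum.trans e.le)
    _ ≤ _ := by linarith

/-- The differentiated scheme is the same scheme for the derivative, with the discrete divergence of
`f ∂ⱼ w` as forcing. -/
lemma HasWeakPartial.lin {ν h τ A V : ℝ} {f : Space N → ℝ} {w : Fin N → Space N → ℝ} {m : ℕ}
    (hf : SobolevLE (m + 1) A f) (hw : ∀ i, SobolevLE (m + 1) V (w i)) (j : Fin N) :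
    HasWeakPartial j (lin ν h τ w f) (fun x => lin ν h τ w (Aggregation.weakD j f) x +
      τ * ∑ i, Aggregation.dif i h (fun y => f y * Aggregation.weakD j (w i) y) x) := by
  have hp := hf.hasWeakPartial j
  have h1 := hp.add ((HasWeakPartial.sum Finset.univ fun i => ((hp.lap (i := i) h).const_mul ν).add
    ((hp.mul ((hw i).hasWeakPartial j) hf.bound (hf.weakD j).bound (hw i).bound
      ((hw i).weakD j).bound).dif (i := i) h)).const_mul τ)
  refine h1.congr (ae_eq_refl _) (Eventually.of_forall fun x => ?_)
  simp only [Aggregation.lin, add_assoc, ← mul_add, ← Finset.sum_add_distrib]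
  congr 2
  refine Finset.sum_congr rfl fun i _ => ?_
  simp only [Aggregation.dif]
  ring

lemma sum_dif_le {m : ℕ} {V h : ℝ} {w : Fin N → Space N → ℝ} (hh : 0 < h)
    (hw : ∀ i, SobolevLE (m + 1) V (w i)) : ∀ᵐ x, ∑ i, dif i h (w i) x ≤ N * V :=
  (SobolevLE.sum fun i => ((hw i).dif i hh)).bound.mono fun _ hx => (le_abs_self _).trans hx

lemma SobolevLE.lin {m : ℕ} {ν h τ A V V₀ : ℝ} {f : Space N → ℝ} {w : Fin N → Space N → ℝ}
    (hs : Stable N ν h τ V₀) (hf : SobolevLE m A f) (hw₀ : ∀ i, SobolevLE 0 V₀ (w i))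
    (hw : ∀ i, SobolevLE (m + 1) V (w i)) :
    SobolevLE m (A * (1 + τ * (N * 2 ^ (m + 1) * V))) (lin ν h τ w f) := by
  have hτ := hs.time_pos
  have h0 : ∀ {m} {f : Space N → ℝ}, SobolevLE m A f → (∀ i, SobolevLE (m + 1) V (w i)) →
      SobolevLE 0 (A * (1 + τ * (N * 2 ^ (m + 1) * V))) (Aggregation.lin ν h τ w f) := by
    intro m f hf hw
    refine (SobolevLE.lin_zero hs hf.zero_level hw₀ (sum_dif_le hs.mesh_pos hw)).mono ?_
    -- An index is needed to infer `0 ≤ V`; in dimension zero the rate vanishes.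
    by_cases hN : Nonempty (Fin N)
    · obtain ⟨i⟩ := hN
      have hV := (hw i).nonneg
      have hA := hf.nonneg
      have : (1 : ℝ) ≤ 2 ^ (m + 1) := one_le_pow₀ (by norm_num)
      gcongr
      exact le_mul_of_one_le_right (by positivity) this
    · have : N = 0 := by
        rcases N with _ | N
        · rfl
        · exact absurd ⟨0⟩ hN
      subst this; simp
  induction m generalizing f with
  | zero => exact h0 hf hw
  | succ m ih =>
    refine SobolevLE.succ (h0 hf hw) (HasWeakPartial.lin hf fun i => (hw i).of_succ) fun j => ?_
    have h1 := ih (hf.weakD j) (fun i => (hw i).of_succ)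
    have h2 := (SobolevLE.sum fun i => (hf.mul ((hw i).weakD j)).dif i hs.mesh_pos).const_mul τ
    refine (h1.add h2).mono (le_of_eq ?_)
    rw [abs_of_pos hτ]
    ring

/-! ### The interaction kernel and the nonlinear step -/

/-- An interaction kernel `K = ∇W` with Hessian `H`, both integrable with norms at most `κ`. -/
structure IsKernel (K : Fin N → Space N → ℝ) (H : Fin N → Fin N → Space N → ℝ) (κ : ℝ) : Prop where
  one_le : 1 ≤ κ
  integrable_grad : ∀ i, Integrable (K i)
  integrable_hess : ∀ i j, Integrable (H i j)
  weak : ∀ i j, HasWeakPartial j (K i) (H i j)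
  grad_le : ∀ i, ∫ y, |K i y| ≤ κ
  hess_le : ∀ i j, ∫ y, |H i j y| ≤ κ

variable {K : Fin N → Space N → ℝ} {H : Fin N → Fin N → Space N → ℝ} {κ : ℝ}

lemma IsKernel.pos (hK : IsKernel K H κ) : 0 < κ := by linarith [hK.one_le]

lemma IsKernel.conv_succ (hK : IsKernel K H κ) {m : ℕ} {A : ℝ} {f : Space N → ℝ}
    (hf : SobolevLE m A f) (i : Fin N) : SobolevLE (m + 1) (κ * A) (conv (K i) f) :=
  hf.conv_succ (hK.integrable_grad i) (hK.integrable_hess i) (hK.weak i) (hK.grad_le i)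
    (hK.hess_le i)

lemma IsKernel.conv_hess (hK : IsKernel K H κ) {m : ℕ} {A : ℝ} {f : Space N → ℝ}
    (hf : SobolevLE m A f) (i j : Fin N) : SobolevLE m (κ * A) (conv (H i j) f) :=
  hf.conv (hK.integrable_hess i j) (hK.hess_le i j)

lemma IsKernel.weak_conv (hK : IsKernel K H κ) {m : ℕ} {A : ℝ} {f : Space N → ℝ}
    (hf : SobolevLE m A f) (i j : Fin N) : HasWeakPartial j (conv (K i) f) (conv (H i j) f) :=
  (hK.weak i j).conv_left (hK.integrable_grad i) (hK.integrable_hess i j)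
    hf.aestronglyMeasurable hf.bound

/-- One time step of the nonlinear scheme. -/
def step (K : Fin N → Space N → ℝ) (ν h τ : ℝ) (ρ : Space N → ℝ) : Space N → ℝ :=
  lin ν h τ (fun i => conv (K i) ρ) ρ

lemma SobolevLE.step_zero {ν h τ A : ℝ} {ρ : Space N → ℝ} (hK : IsKernel K H κ)
    (hs : Stable N ν h τ (κ * A)) (hρ : SobolevLE 0 A ρ) :
    SobolevLE 0 (A * (1 + τ * (N * (κ * A)))) (step K ν h τ ρ) :=
  SobolevLE.lin_zero hs hρ (fun i => (hK.conv_succ hρ i).of_succ)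
    (sum_dif_le hs.mesh_pos fun i => hK.conv_succ hρ i)

/-- The norm of order `m + 1` grows linearly, at a rate that depends on the norm of order `m`. -/
lemma SobolevLE.step_succ {m : ℕ} {ν h τ A A' B : ℝ} {ρ : Space N → ℝ} (hK : IsKernel K H κ)
    (hs : Stable N ν h τ (κ * B)) (h0 : SobolevLE 0 B ρ) (hρ : SobolevLE (m + 1) A ρ)
    (hρ' : SobolevLE m A' ρ) :
    SobolevLE (m + 1) (A * (1 + τ * (N * 2 ^ (m + 2) * (κ * A')))) (step K ν h τ ρ) := by
  have hτ := hs.time_pos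
  have hκ := hK.pos
  have hA := hρ.nonneg
  have hA' := hρ'.nonneg
  have hw₀ : ∀ i, SobolevLE 0 (κ * B) (Aggregation.conv (K i) ρ) := fun i => (hK.conv_succ h0 i).of_succ
  have hw : ∀ i, SobolevLE (m + 1) (κ * A') (Aggregation.conv (K i) ρ) := fun i => hK.conv_succ hρ' i
  refine SobolevLE.succ ?_ (HasWeakPartial.lin (hρ.of_le (Nat.le_add_left 1 m))
    fun i => (hw i).of_le (Nat.le_add_left 1 m)) fun j => ?_
  · refine (SobolevLE.lin_zero hs hρ.zero_level hw₀ (sum_dif_le hs.mesh_pos hw)).mono ?_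
    have : (1 : ℝ) ≤ 2 ^ (m + 2) := one_le_pow₀ (by norm_num)
    gcongr
    exact le_mul_of_one_le_right (by positivity) this
  -- The velocity at order `m + 1` costs only `A'`, by the gain of one derivative. The forcing
  -- contains `ρ (D²W * ρ)` at order `m + 1`; the tame product estimate keeps it linear in `A`. Both
  -- contributions equal `N * 2 ^ (m + 1) * κ * A * A'` per unit time.
  · have h1 := SobolevLE.lin hs (hρ.weakD j) hw₀ hw
    have hq : ∀ i, SobolevLE (m + 1) (2 ^ m * (A * (κ * A') + A' * (κ * A)))
        (fun y => ρ y * Aggregation.weakD j (Aggregation.conv (K i) ρ) y) := fun i =>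
      (hρ.mul_tame hρ' (hK.conv_hess hρ i j) (hK.conv_hess hρ' i j)).congr
        (((hK.weak_conv hρ i j).weakD_ae).symm.mono fun x hx => by simp only [hx])
    have h2 := (SobolevLE.sum fun i => (hq i).dif i hs.mesh_pos).const_mul τ
    refine (h1.add h2).mono (le_of_eq ?_)
    rw [abs_of_pos hτ]
    ring

end

section

variable {K : Fin N → Space N → ℝ} {H : Fin N → Fin N → Space N → ℝ} {κ : ℝ}

/-! ### Consistency and stability of the scheme -/

/-- The flux `ρ (∂ᵢ W * ρ)`. -/
def flux (K : Fin N → Space N → ℝ) (ρ : Space N → ℝ) (i : Fin N) : Space N → ℝ :=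
  fun x => ρ x * conv (K i) ρ x

/-- The weak divergence of the flux. -/
def weakRate (K : Fin N → Space N → ℝ) (ρ : Space N → ℝ) : Space N → ℝ :=
  fun x => ∑ i, weakD i (flux K ρ i) x

/-- The discretisation of the divergence of the flux, with viscosity `ν`. -/
def rate (K : Fin N → Space N → ℝ) (ν h : ℝ) (ρ : Space N → ℝ) : Space N → ℝ :=
  fun x => ∑ i, (ν * lap i h ρ x + dif i h (flux K ρ i) x)

lemma step_eq (ν h τ : ℝ) (ρ : Space N → ℝ) (x : Space N) :
    step K ν h τ ρ x = ρ x + τ * rate K ν h ρ x := rfl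

lemma IsKernel.conv_same (hK : IsKernel K H κ) {m : ℕ} {A : ℝ} {f : Space N → ℝ}
    (hf : SobolevLE m A f) (i : Fin N) : SobolevLE m (κ * A) (conv (K i) f) :=
  (hK.conv_succ hf i).of_succ

lemma IsKernel.flux (hK : IsKernel K H κ) {m : ℕ} {A : ℝ} {ρ : Space N → ℝ}
    (hρ : SobolevLE m A ρ) (i : Fin N) : SobolevLE m (2 ^ m * κ * A ^ 2) (flux K ρ i) :=
  (hρ.mul (hK.conv_same hρ i)).mono (le_of_eq (by ring))

lemma IsKernel.flux_sub (hK : IsKernel K H κ) {m : ℕ} {A D : ℝ} {ρ σ : Space N → ℝ}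
    (hρ : SobolevLE m A ρ) (hσ : SobolevLE m A σ) (hD : SobolevLE m D (fun x => ρ x - σ x))
    (i : Fin N) :
    SobolevLE m (2 ^ (m + 1) * κ * A * D)
      (fun x => Aggregation.flux K ρ i x - Aggregation.flux K σ i x) := by
  refine (((hD.mul (hK.conv_same hρ i)).add (hσ.mul (hK.conv_same hD i))).congr
    (Eventually.of_forall fun x => ?_)).mono (le_of_eq (by ring))
  simp only [Aggregation.flux, conv_sub (hK.integrable_grad i) hρ hσ]
  ring

lemma IsKernel.weakRate (hK : IsKernel K H κ) {m : ℕ} {A : ℝ} {ρ : Space N → ℝ}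
    (hρ : SobolevLE (m + 1) A ρ) : SobolevLE m (N * (2 ^ (m + 1) * κ * A ^ 2)) (weakRate K ρ) :=
  SobolevLE.sum fun i => (hK.flux hρ i).weakD i

lemma IsKernel.weakRate_sub (hK : IsKernel K H κ) {m : ℕ} {A D : ℝ} {ρ σ : Space N → ℝ}
    (hρ : SobolevLE (m + 1) A ρ) (hσ : SobolevLE (m + 1) A σ)
    (hD : SobolevLE (m + 1) D (fun x => ρ x - σ x)) :
    SobolevLE m (N * (2 ^ (m + 2) * κ * A) * D)
      (fun x => Aggregation.weakRate K ρ x - Aggregation.weakRate K σ x) := by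
  have h1 := SobolevLE.sum fun i => (hK.flux_sub hρ hσ hD i).of_hasWeakPartial
    (((hK.flux hρ i).hasWeakPartial i).sub ((hK.flux hσ i).hasWeakPartial i))
  refine (h1.congr (Eventually.of_forall fun x => ?_)).mono (le_of_eq (by ring))
  simp only [Aggregation.weakRate, Finset.sum_sub_distrib]

lemma IsKernel.rate (hK : IsKernel K H κ) {m : ℕ} {A R r h : ℝ} {ρ : Space N → ℝ}
    (hρ : SobolevLE (m + 1) A ρ) (hh : 0 < h) (hr : 0 ≤ r) (hR : r ≤ R) :
    SobolevLE m (N * (2 * R * A + 2 ^ (m + 1) * κ * A ^ 2)) (rate K (r * h) h ρ) := by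
  refine SobolevLE.sum fun i => ?_
  refine (((hρ.lap_coarse i hh).const_mul (r * h)).add ((hK.flux hρ i).dif i hh)).mono ?_
  have hA := hρ.nonneg
  rw [abs_of_nonneg (by positivity)]
  have : r * h * (2 * A / h) = 2 * r * A := by field_simp
  rw [this]
  gcongr

lemma IsKernel.rate_sub (hK : IsKernel K H κ) {m : ℕ} {A R r h : ℝ} {ρ : Space N → ℝ}
    (hρ : SobolevLE (m + 2) A ρ) (hh : 0 < h) (hr : 0 ≤ r) (hR : r ≤ R) :
    SobolevLE m (N * (2 * R * A + 2 ^ (m + 2) * κ * A ^ 2) * h)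
      (fun x => Aggregation.rate K (r * h) h ρ x - Aggregation.weakRate K ρ x) := by
  have h1 := SobolevLE.sum fun i => ((hρ.lap i hh).const_mul (r * h)).add
    ((hK.flux hρ i).dif_sub ((hK.flux hρ i).hasWeakPartial i) hh)
  refine (h1.congr (Eventually.of_forall fun x => ?_)).mono ?_
  · simp only [Aggregation.rate, Aggregation.weakRate, ← Finset.sum_sub_distrib, add_sub_assoc]
  · have hA := hρ.nonneg
    have hκ := hK.pos
    rw [abs_of_nonneg (by positivity), mul_assoc (N : ℝ)]
    have : r * h ≤ R * h := by gcongr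
    have h2 : r * h * (2 * A) ≤ R * h * (2 * A) := by gcongr
    gcongr
    linarith

/-- Stability in `L^∞` without loss of derivatives. The difference `σ - ρ` is transported by the
velocity of `σ`, with divergence at most `N κ A`. The forcing is the discrete divergence of `ρ (K *
(σ - ρ))`, of size `2 N κ A D` since the convolution turns the `L^∞` bound `D` into a `𝒲^{1,∞}`
bound. -/
lemma SobolevLE.step_sub {ν h τ A B D : ℝ} {ρ σ : Space N → ℝ} (hK : IsKernel K H κ)
    (hs : Stable N ν h τ (κ * B)) (h0 : SobolevLE 0 B σ) (hσ : SobolevLE 1 A σ)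
    (hρ : SobolevLE 1 A ρ) (hD : SobolevLE 0 D (fun x => σ x - ρ x)) :
    SobolevLE 0 (D * (1 + τ * (3 * N * κ * A))) (fun x => step K ν h τ σ x - step K ν h τ ρ x) := by
  have h1 := SobolevLE.lin_zero hs hD (fun i => hK.conv_same h0 i)
    (sum_dif_le hs.mesh_pos fun i => (hK.conv_same hσ i))
  have h2 := (SobolevLE.sum fun i => (hρ.mul (hK.conv_succ hD i)).dif i hs.mesh_pos).const_mul τ
  refine ((h1.add h2).congr (Eventually.of_forall fun x => ?_)).mono (le_of_eq ?_)
  · simp only [Aggregation.lin, step, conv_sub (hK.integrable_grad _) hσ hρ]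
    rw [add_assoc, ← mul_add, ← Finset.sum_add_distrib, add_sub_add_comm, ← mul_sub,
      ← Finset.sum_sub_distrib]
    congr 2
    refine Finset.sum_congr rfl fun i _ => ?_
    simp only [Aggregation.lap, Aggregation.dif]
    ring
  · rw [abs_of_pos hs.time_pos]
    ring

/-! ### The approximating sequence -/

/-- The space mesh of the `n`-th discretisation. -/
def mesh (n : ℕ) : ℝ := (1 / 2) ^ n

/-- The time step of the `n`-th discretisation. -/
def tstep (n : ℕ) : ℝ := (1 / 4) ^ n

lemma mesh_pos (n : ℕ) : 0 < mesh n := by unfold mesh; positivity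

lemma tstep_pos (n : ℕ) : 0 < tstep n := by unfold tstep; positivity

lemma tstep_eq (n : ℕ) : tstep n = mesh n ^ 2 := by
  unfold tstep mesh
  rw [← pow_mul, mul_comm, pow_mul]; norm_num

lemma mesh_le_one (n : ℕ) : mesh n ≤ 1 := pow_le_one₀ (by norm_num) (by norm_num)

lemma tstep_le_mesh (n : ℕ) : tstep n ≤ mesh n := by
  rw [tstep_eq, sq]
  exact mul_le_of_le_one_left (mesh_pos n).le (mesh_le_one n)

lemma mesh_succ_le (n : ℕ) : mesh (n + 1) ≤ mesh n := by
  have := mesh_pos n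
  unfold mesh at *
  rw [pow_succ]; linarith

lemma tstep_succ (n : ℕ) : tstep n = 4 * tstep (n + 1) := by
  unfold tstep; rw [pow_succ]; ring

lemma tendsto_mesh : Tendsto mesh atTop (𝓝 0) :=
  tendsto_pow_atTop_nhds_zero_of_lt_one (by norm_num) (by norm_num)

lemma tendsto_tstep : Tendsto tstep atTop (𝓝 0) :=
  tendsto_pow_atTop_nhds_zero_of_lt_one (by norm_num) (by norm_num)

/-- The `n`-th approximation, whose viscosity at time `t` is `R t` times the mesh. -/
def seq (K : Fin N → Space N → ℝ) (R : ℝ → ℝ) (ρ₀ : Space N → ℝ) (n : ℕ) : ℕ → Space N → ℝ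
  | 0 => ρ₀
  | k + 1 => step K (R (k * tstep n) * mesh n) (mesh n) (tstep n) (seq K R ρ₀ n k)

/-- The `n`-th approximation obeys the velocity bound `R` up to time `S`, and the mesh is fine
enough for the scheme to be monotone. -/
structure Admissible (K : Fin N → Space N → ℝ) (κ : ℝ) (R : ℝ → ℝ) (ρ₀ : Space N → ℝ) (S : ℝ)
    (n : ℕ) : Prop where
  fine : 2 * N * R S * mesh n ≤ 1
  bound : ∀ k : ℕ, k * tstep n ≤ S → SobolevLE 0 (R (k * tstep n) / κ) (seq K R ρ₀ n k)

variable {R : ℝ → ℝ} {ρ₀ : Space N → ℝ} {S : ℝ} {n : ℕ}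

/-- A density bounded by `R t / κ` has velocity components at most `R t`, which the viscosity `R t *
mesh n` dominates. As the time step is the square of the mesh, the other condition reduces to `2 N R
t h ≤ 1`. -/
lemma stable_of_fine (hK : IsKernel K H κ) (hR : Monotone R) (hf : 2 * N * R S * mesh n ≤ 1)
    {t : ℝ} (ht : t ≤ S) (h0 : 0 ≤ R t) :
    Stable N (R t * mesh n) (mesh n) (tstep n) (κ * (R t / κ)) where
  mesh_pos := mesh_pos n
  time_pos := tstep_pos n
  time_le := by
    have h1 := mesh_pos n
    have h2 : 2 * N * R t * mesh n ≤ 1 :=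
      le_trans (by have := hR ht; gcongr) hf
    rw [tstep_eq]
    nlinarith [sq_nonneg (mesh n)]
  speed_le := by
    have h1 := mesh_pos n
    have h2 := hK.pos
    rw [mul_div_cancel₀ _ h2.ne']
    nlinarith

lemma Admissible.nonneg (hK : IsKernel K H κ) (ha : Admissible K κ R ρ₀ S n) {k : ℕ}
    (hk : k * tstep n ≤ S) : 0 ≤ R (k * tstep n) := by
  have := (ha.bound k hk).nonneg
  have h2 := hK.pos
  by_contra h
  exact absurd this (not_le.2 (div_neg_of_neg_of_pos (not_le.1 h) h2))

lemma Admissible.stable (hK : IsKernel K H κ) (hR : Monotone R) (ha : Admissible K κ R ρ₀ S n)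
    {k : ℕ} (hk : k * tstep n ≤ S) :
    Stable N (R (k * tstep n) * mesh n) (mesh n) (tstep n) (κ * (R (k * tstep n) / κ)) :=
  stable_of_fine hK hR ha.fine hk (ha.nonneg hK hk)

lemma time_le_of_succ {k : ℕ} (hk : ((k + 1 : ℕ) : ℝ) * tstep n ≤ S) : k * tstep n ≤ S := by
  have := tstep_pos n
  push_cast at hk
  linarith

/-- Discrete Grönwall: growth by `1 + τ C` per step is at most exponential, independently of the
discretisation. -/
lemma one_add_pow_le {C : ℝ} (hC : 0 ≤ C) {k : ℕ} (hk : k * tstep n ≤ S) :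
    (1 + tstep n * C) ^ k ≤ Real.exp (C * S) := by
  have h0 := tstep_pos n
  have h1 : 1 + tstep n * C ≤ Real.exp (tstep n * C) := by
    linarith [Real.add_one_le_exp (tstep n * C)]
  calc (1 + tstep n * C) ^ k ≤ Real.exp (tstep n * C) ^ k := by gcongr
    _ = Real.exp (C * (k * tstep n)) := by rw [← Real.exp_nat_mul]; congr 1; ring
    _ ≤ _ := by gcongr

/-- All Sobolev norms of the initial datum are propagated, uniformly in the discretisation. -/
lemma exists_bound (hK : IsKernel K H κ) (hR : Monotone R)
    (ha : ∀ᶠ n in atTop, Admissible K κ R ρ₀ S n) (m : ℕ) (hm : MemSobolev m ρ₀) :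
    ∃ A, ∀ᶠ n in atTop, ∀ k : ℕ, k * tstep n ≤ S → SobolevLE m A (seq K R ρ₀ n k) := by
  have hκ := hK.pos
  induction m with
  | zero =>
    refine ⟨R S / κ, ha.mono fun n hn k hk => (hn.bound k hk).mono ?_⟩
    have := hR hk
    gcongr
  | succ m ih =>
    obtain ⟨A₀, hA₀⟩ := hm
    obtain ⟨A', hA'⟩ := ih ⟨A₀, hA₀.of_succ⟩
    have hAn := hA₀.nonneg
    refine ⟨A₀ * Real.exp (N * 2 ^ (m + 2) * (κ * A') * S), (ha.and hA').mono ?_⟩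
    rintro n ⟨hn, hn'⟩ k hk
    -- The growth factor involves only `A'`, already known from order `m`, so the recursion is
    -- linear and cannot blow up before `S`.
    have key : ∀ k : ℕ, k * tstep n ≤ S →
        SobolevLE (m + 1) (A₀ * (1 + tstep n * (N * 2 ^ (m + 2) * (κ * A'))) ^ k)
          (seq K R ρ₀ n k) := by
      intro k
      induction k with
      | zero => intro _; simpa [seq] using hA₀
      | succ k ihk =>
        intro hk
        have hk' := time_le_of_succ hk
        refine (SobolevLE.step_succ hK (hn.stable hK hR hk') (hn.bound k hk') (ihk hk')
          (hn' k hk')).mono (le_of_eq ?_)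
        rw [pow_succ]; ring
    have hA'n := (hn' k hk).nonneg
    refine (key k hk).mono ?_
    gcongr
    exact one_add_pow_le (by positivity) hk

lemma seq_succ_apply (k : ℕ) (x : Space N) : seq K R ρ₀ n (k + 1) x = seq K R ρ₀ n k x +
    tstep n * rate K (R (k * tstep n) * mesh n) (mesh n) (seq K R ρ₀ n k) x := rfl

/-- The Lipschitz constant in time of the approximations, for the norm of order `m`. -/
def lipConst (N : ℕ) (κ R : ℝ) (m : ℕ) (A : ℝ) : ℝ := N * (2 * R * A + 2 ^ (m + 1) * κ * A ^ 2)

lemma seq_sub (hK : IsKernel K H κ) (hR : Monotone R) (ha : Admissible K κ R ρ₀ S n) {m : ℕ}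
    {A : ℝ} (hA : ∀ k : ℕ, k * tstep n ≤ S → SobolevLE (m + 1) A (seq K R ρ₀ n k)) (k l : ℕ)
    (hl : ((k + l : ℕ) : ℝ) * tstep n ≤ S) :
    SobolevLE m (lipConst N κ (R S) m A * (l * tstep n))
      (fun x => seq K R ρ₀ n (k + l) x - seq K R ρ₀ n k x) := by
  induction l with
  | zero => simpa using SobolevLE.zero m
  | succ l ih =>
    have hl' : ((k + l : ℕ) : ℝ) * tstep n ≤ S := time_le_of_succ hl
    have h1 := (hK.rate (hA _ hl') (mesh_pos n) (ha.nonneg hK hl') (hR hl')).const_mul (tstep n)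
    refine (((ih hl').add h1).congr (Eventually.of_forall fun x => ?_)).mono (le_of_eq ?_)
    · rw [← add_assoc, seq_succ_apply]; ring
    · rw [abs_of_pos (tstep_pos n), lipConst]; push_cast; ring

/-- The approximations satisfy the equation, up to an error of second order. -/
lemma seq_taylor (hK : IsKernel K H κ) (hR : Monotone R) (ha : Admissible K κ R ρ₀ S n) {m : ℕ}
    {A : ℝ} (hA : ∀ k : ℕ, k * tstep n ≤ S → SobolevLE (m + 2) A (seq K R ρ₀ n k)) (k l : ℕ)
    (hl : ((k + l : ℕ) : ℝ) * tstep n ≤ S) :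
    SobolevLE m (l * tstep n * (N * (2 * R S * A + 2 ^ (m + 2) * κ * A ^ 2) * mesh n +
        N * (2 ^ (m + 2) * κ * A) * lipConst N κ (R S) (m + 1) A * (l * tstep n)))
      (fun x => seq K R ρ₀ n (k + l) x - seq K R ρ₀ n k x -
        l * tstep n * weakRate K (seq K R ρ₀ n k) x) := by
  have hτ := tstep_pos n
  have hκ := hK.pos
  induction l with
  | zero => simpa using SobolevLE.zero m
  | succ l ih =>
    have hl' : ((k + l : ℕ) : ℝ) * tstep n ≤ S := time_le_of_succ hl
    have hk' : (k : ℝ) * tstep n ≤ S := by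
      refine le_trans ?_ hl'
      gcongr
      exact Nat.le_add_right k l
    have h1 := (hK.rate_sub (hA _ hl') (mesh_pos n) (ha.nonneg hK hl') (hR hl')).const_mul (tstep n)
    have hsub := seq_sub hK hR ha hA k l hl'
    have h2 := (hK.weakRate_sub (hA _ hl').of_succ (hA _ hk').of_succ hsub).const_mul (tstep n)
    refine ((((ih hl').add h1).add h2).congr (Eventually.of_forall fun x => ?_)).mono ?_
    · rw [← add_assoc, seq_succ_apply]; push_cast; ring
    · have hn := hsub.nonneg
      have hA0 := (hA _ hk').nonneg
      have hL : 0 ≤ lipConst N κ (R S) (m + 1) A := by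
        have := (ha.nonneg hK hk').trans (hR hk')
        unfold lipConst; positivity
      rw [abs_of_pos hτ]
      set c := N * (2 * R S * A + 2 ^ (m + 2) * κ * A ^ 2) * mesh n
      set L := lipConst N κ (R S) (m + 1) A
      have hM : 0 ≤ N * (2 ^ (m + 2) * κ * A) := by positivity
      set M := N * (2 ^ (m + 2) * κ * A)
      push_cast
      -- The new step contributes a drift `M L l τ²`, while the claimed bound has room for `M L (2 l
      -- + 1) τ²`.
      have : 0 ≤ M * L * tstep n ^ 2 := by positivity
      nlinarith [mul_nonneg this (Nat.cast_nonneg (α := ℝ) l)]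

end

section

variable {K : Fin N → Space N → ℝ} {H : Fin N → Fin N → Space N → ℝ} {κ : ℝ}
  {R : ℝ → ℝ} {ρ₀ : Space N → ℝ} {S : ℝ} {n : ℕ}

/-! ### Convergence of the approximations -/

/-- The consistency constant in the comparison of two successive discretisations. -/
def cmpConst (N : ℕ) (κ R A : ℝ) : ℝ :=
  2 * (N * (2 * R * A + 2 ^ 2 * κ * A ^ 2)) + N * (2 ^ 2 * κ * A) * lipConst N κ R 1 A

/-- The `n`-th approximation, interpolated linearly in time on the next finer grid. -/
def interp (K : Fin N → Space N → ℝ) (R : ℝ → ℝ) (ρ₀ : Space N → ℝ) (n k r : ℕ) : Space N → ℝ :=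
  fun x => seq K R ρ₀ n k x + r * tstep (n + 1) *
    rate K (R (k * tstep n) * mesh n) (mesh n) (seq K R ρ₀ n k) x

lemma interp_zero (k : ℕ) : interp K R ρ₀ n k 0 = seq K R ρ₀ n k := by
  ext x; simp [interp]

lemma interp_four (k : ℕ) : interp K R ρ₀ n k 4 = seq K R ρ₀ n (k + 1) := by
  ext x; rw [seq_succ_apply, interp, tstep_succ n]; norm_num

/-- The interpolant is the convex combination, with weights `1 - r / 4` and `r / 4`, of two
consecutive coarse states; one coarse time step is four fine ones. -/
lemma sobolevLE_interp {m : ℕ} {A : ℝ} {k r : ℕ} (hr : r ≤ 4)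
    (h1 : SobolevLE m A (seq K R ρ₀ n k)) (h2 : SobolevLE m A (seq K R ρ₀ n (k + 1))) :
    SobolevLE m A (interp K R ρ₀ n k r) := by
  have hr' : (r : ℝ) ≤ 4 := by exact_mod_cast hr
  have hA := h1.nonneg
  refine (((h1.const_mul (1 - r / 4)).add (h2.const_mul (r / 4))).congr
    (Eventually.of_forall fun x => ?_)).mono (le_of_eq ?_)
  · beta_reduce
    rw [seq_succ_apply, interp, tstep_succ n]; ring
  · rw [abs_of_nonneg (by linarith), abs_of_nonneg (by positivity)]; ring

/-- Error recursion between the fine approximation and the interpolated coarse one. Stability is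
that of one fine step applied to both. For consistency, the fine and coarse rates are each compared
with the inviscid `weakRate`, so the different viscosities and meshes need no direct comparison. -/
lemma interp_step (hK : IsKernel K H κ) (hR : Monotone R) (ha : Admissible K κ R ρ₀ S n)
    (ha' : Admissible K κ R ρ₀ S (n + 1)) {A D : ℝ}
    (hA : ∀ k : ℕ, k * tstep n ≤ S → SobolevLE 2 A (seq K R ρ₀ n k))
    (hA' : ∀ k : ℕ, k * tstep (n + 1) ≤ S → SobolevLE 2 A (seq K R ρ₀ (n + 1) k)) {k r : ℕ}
    (hr : r < 4) (hk : ((k + 1 : ℕ) : ℝ) * tstep n ≤ S)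
    (hD : SobolevLE 0 D (fun x => seq K R ρ₀ (n + 1) (4 * k + r) x - interp K R ρ₀ n k r x)) :
    SobolevLE 0 (D * (1 + tstep (n + 1) * (3 * N * κ * A)) +
        tstep (n + 1) * (cmpConst N κ (R S) A * mesh n))
      (fun x => seq K R ρ₀ (n + 1) (4 * k + r + 1) x - interp K R ρ₀ n k (r + 1) x) := by
  have hκ := hK.pos
  have hτ := tstep_pos (n + 1)
  have hr' : (r : ℝ) ≤ 4 := by exact_mod_cast hr.le
  have hk' : k * tstep n ≤ S := time_le_of_succ hk
  have hj : ((4 * k + r : ℕ) : ℝ) * tstep (n + 1) ≤ S := by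
    rw [tstep_succ n] at hk
    push_cast at hk ⊢
    nlinarith
  have hA0 := (hA k hk').nonneg
  have hRS : 0 ≤ R S := (ha.nonneg hK hk').trans (hR hk')
  have hσ := sobolevLE_interp hr.le (hA k hk') (hA (k + 1) hk)
  set σ := interp K R ρ₀ n k r with hσdef
  have hst := SobolevLE.step_sub hK (ha'.stable hK hR hj) (ha'.bound _ hj) (hA' _ hj).of_succ
    hσ.of_succ hD
  have hL : 0 ≤ lipConst N κ (R S) 1 A := by unfold lipConst; positivity
  have hdiff : SobolevLE 1 (lipConst N κ (R S) 1 A * mesh n)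
      (fun x => σ x - seq K R ρ₀ n k x) := by
    have h1 := (hK.rate (hA k hk') (mesh_pos n) (ha.nonneg hK hk') (hR hk')).const_mul
      (r * tstep (n + 1))
    refine (h1.congr (Eventually.of_forall fun x => ?_)).mono ?_
    · rw [hσdef, interp]; ring
    · rw [abs_of_nonneg (by positivity), mul_comm]
      refine mul_le_mul_of_nonneg_left ?_ hL
      refine le_trans ?_ (tstep_le_mesh n)
      rw [tstep_succ n]; gcongr
  have e1 := hK.rate_sub hσ (mesh_pos (n + 1)) (ha'.nonneg hK hj) (hR hj)
  have e2 := hK.weakRate_sub hσ.of_succ (hA k hk').of_succ hdiff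
  have e3 := hK.rate_sub (hA k hk') (mesh_pos n) (ha.nonneg hK hk') (hR hk')
  refine ((hst.add (((e1.add e2).sub e3).const_mul (tstep (n + 1)))).congr
    (Eventually.of_forall fun x => ?_)).mono ?_
  · have h1 : interp K R ρ₀ n k (r + 1) x = σ x + tstep (n + 1) *
        rate K (R (k * tstep n) * mesh n) (mesh n) (seq K R ρ₀ n k) x := by
      rw [hσdef, interp, interp]; push_cast; ring
    beta_reduce
    rw [h1, step_eq _ _ _ σ]
    simp only [seq]
    ring
  · rw [abs_of_pos hτ, cmpConst]
    have hc : 0 ≤ N * (2 * R S * A + 2 ^ (0 + 2) * κ * A ^ 2) := by positivity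
    have := mul_le_mul_of_nonneg_left (mesh_succ_le n) hc
    gcongr
    simp only [zero_add] at *
    linarith

/-- The inductive step of the discrete Grönwall inequality for `D_{j+1} ≤ D_j (1 + τ C) + τ c` with
`D_0 = 0`. -/
lemma euler_bound {c C τ : ℝ} {j : ℕ} (hc : 0 ≤ c) (hC : 0 ≤ C) (hτ : 0 ≤ τ) :
    (j : ℝ) * τ * c * (1 + τ * C) ^ j * (1 + τ * C) + τ * c ≤
      ((j + 1 : ℕ) : ℝ) * τ * c * (1 + τ * C) ^ (j + 1) := by
  have h1 : (1 : ℝ) ≤ (1 + τ * C) ^ (j + 1) := one_le_pow₀ (by nlinarith [mul_nonneg hτ hC])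
  have h2 := mul_le_mul_of_nonneg_left h1 (mul_nonneg hτ hc)
  push_cast
  rw [pow_succ] at *
  linarith

/-- Two successive discretisations are close. -/
lemma seq_compare (hK : IsKernel K H κ) (hR : Monotone R) (ha : Admissible K κ R ρ₀ S n)
    (ha' : Admissible K κ R ρ₀ S (n + 1)) {A : ℝ}
    (hA : ∀ k : ℕ, k * tstep n ≤ S → SobolevLE 2 A (seq K R ρ₀ n k))
    (hA' : ∀ k : ℕ, k * tstep (n + 1) ≤ S → SobolevLE 2 A (seq K R ρ₀ (n + 1) k)) (k : ℕ) :
    ∀ r ≤ 4, ((k + 1 : ℕ) : ℝ) * tstep n ≤ S →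
      SobolevLE 0 (((4 * k + r : ℕ) : ℝ) * tstep (n + 1) * (cmpConst N κ (R S) A * mesh n) *
        (1 + tstep (n + 1) * (3 * N * κ * A)) ^ (4 * k + r))
        (fun x => seq K R ρ₀ (n + 1) (4 * k + r) x - interp K R ρ₀ n k r x) := by
  have hκ := hK.pos
  have hτ := tstep_pos (n + 1)
  have hm := mesh_pos n
  induction k with
  | zero =>
    intro r
    induction r with
    | zero => intro _ _; simpa [seq, interp_zero] using SobolevLE.zero 0
    | succ r ih =>
      intro hr hk
      have hk' : ((0 : ℕ) : ℝ) * tstep n ≤ S := time_le_of_succ hk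
      have hA0 := (hA 0 hk').nonneg
      have hRS : 0 ≤ R S := (ha.nonneg hK hk').trans (hR hk')
      refine (interp_step hK hR ha ha' hA hA' (by omega) hk (ih (by omega) hk)).mono ?_
      exact euler_bound (by unfold cmpConst lipConst; positivity) (by positivity) hτ.le
  | succ k ihk =>
    intro r
    induction r with
    | zero =>
      intro _ hk
      -- The start of a coarse step is the end `r = 4` of the preceding one.
      have := ihk 4 le_rfl (time_le_of_succ hk)
      rw [interp_four] at this
      rw [interp_zero]
      exact this
    | succ r ih =>
      intro hr hk
      have hk' := time_le_of_succ hk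
      have hA0 := (hA _ hk').nonneg
      have hRS : 0 ≤ R S := (ha.nonneg hK hk').trans (hR hk')
      refine (interp_step hK hR ha ha' hA hA' (by omega) hk (ih (by omega) hk)).mono ?_
      exact euler_bound (by unfold cmpConst lipConst; positivity) (by positivity) hτ.le

/-- The index of the time step before `t`. -/
def idx (n : ℕ) (t : ℝ) : ℕ := ⌊t / tstep n⌋₊

lemma idx_mul_le {t : ℝ} (ht : 0 ≤ t) (n : ℕ) : idx n t * tstep n ≤ t := by
  have h := tstep_pos n
  have := Nat.floor_le (a := t / tstep n) (by positivity)
  rwa [le_div_iff₀ h] at this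

lemma lt_idx_mul (t : ℝ) (n : ℕ) : t < (idx n t + 1) * tstep n := by
  have h := tstep_pos n
  have := Nat.lt_floor_add_one (t / tstep n)
  rwa [div_lt_iff₀ h] at this

lemma idx_eq_div (t : ℝ) (n : ℕ) : idx n t = idx (n + 1) t / 4 := by
  unfold idx
  rw [← Nat.floor_div_ofNat]
  congr 1
  rw [tstep_succ n]
  have := tstep_pos (n + 1)
  field_simp

/-- Compares the approximations at a common time `t`. The room `t + tstep n ≤ S` places the coarse
grid point following `t` within the range of the bounds; the time offset inside the coarse step is
of order `mesh n`. -/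
lemma exists_seq_sub_le (hK : IsKernel K H κ) (hR : Monotone R)
    (ha : ∀ᶠ n in atTop, Admissible K κ R ρ₀ S n) (hρ₀ : MemSobolev 2 ρ₀) :
    ∃ C : ℝ, 0 ≤ C ∧ ∀ᶠ n in atTop, ∀ t, 0 ≤ t → t + tstep n ≤ S →
      SobolevLE 0 (C * mesh n)
        (fun x => seq K R ρ₀ (n + 1) (idx (n + 1) t) x - seq K R ρ₀ n (idx n t) x) := by
  have hκ := hK.pos
  obtain ⟨A, hA⟩ := exists_bound hK hR ha 2 hρ₀
  by_cases hS : 0 ≤ S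
  swap
  · refine ⟨0, le_rfl, Eventually.of_forall fun n t h1 h2 => ?_⟩
    linarith [tstep_pos n]
  obtain ⟨n₀, hn₀⟩ := (ha.and hA).exists
  have h00 : ((0 : ℕ) : ℝ) * tstep n₀ ≤ S := by simpa using hS
  have hA0 := (hn₀.2 0 h00).nonneg
  have hRS : 0 ≤ R S := (hn₀.1.nonneg hK h00).trans (hR h00)
  have hc : 0 ≤ cmpConst N κ (R S) A := by unfold cmpConst lipConst; positivity
  have hL : 0 ≤ lipConst N κ (R S) 0 A := by unfold lipConst; positivity
  refine ⟨S * cmpConst N κ (R S) A * Real.exp (3 * N * κ * A * S) +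
    lipConst N κ (R S) 0 A, by positivity, ?_⟩
  have hev := (ha.and hA).and ((tendsto_add_atTop_nat 1).eventually (ha.and hA))
  filter_upwards [hev] with n hn t ht htS
  obtain ⟨⟨h1, h2⟩, h3, h4⟩ := hn
  have hτ := tstep_pos n
  have hτ' := tstep_pos (n + 1)
  have hm := mesh_pos n
  set j := idx (n + 1) t with hj
  set k := idx n t with hk
  have hkj : k = j / 4 := idx_eq_div t n
  have hjkr : j = 4 * k + j % 4 := by omega
  have hjt : j * tstep (n + 1) ≤ t := idx_mul_le ht (n + 1)
  have hkt : k * tstep n ≤ t := idx_mul_le ht n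
  have hk1 : ((k + 1 : ℕ) : ℝ) * tstep n ≤ S := by push_cast; linarith
  have hkS : k * tstep n ≤ S := by linarith
  have hjS : j * tstep (n + 1) ≤ S := by linarith
  have hr : j % 4 < 4 := Nat.mod_lt _ (by norm_num)
  have e1 := seq_compare hK hR h1 h3 h2 h4 k (j % 4) hr.le hk1
  have e2 := (hK.rate (h2 k hkS).of_succ hm (h1.nonneg hK hkS) (hR hkS)).const_mul
    (((j % 4 : ℕ) : ℝ) * tstep (n + 1))
  rw [← hjkr] at e1
  refine ((e1.add e2).congr (Eventually.of_forall fun x => ?_)).mono ?_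
  · simp only [interp]; ring
  · have hr' : ((j % 4 : ℕ) : ℝ) ≤ 4 := by exact_mod_cast hr.le
    have hp := one_add_pow_le (n := n + 1) (C := 3 * N * κ * A) (by positivity) hjS
    have hx : ((j % 4 : ℕ) : ℝ) * tstep (n + 1) ≤ mesh n := by
      refine le_trans ?_ (tstep_le_mesh n)
      rw [tstep_succ n]; gcongr
    rw [abs_of_nonneg (by positivity)]
    have f1 : (j : ℝ) * tstep (n + 1) * (cmpConst N κ (R S) A * mesh n) *
        (1 + tstep (n + 1) * (3 * N * κ * A)) ^ j ≤
        S * (cmpConst N κ (R S) A * mesh n) * Real.exp (3 * N * κ * A * S) := by gcongr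
    have f2 := mul_le_mul_of_nonneg_right hx hL
    have f3 : lipConst N κ (R S) 0 A = N * (2 * R S * A + 2 ^ (0 + 1) * κ * A ^ 2) := rfl
    rw [← f3]
    linarith

end

section

variable {K : Fin N → Space N → ℝ} {H : Fin N → Fin N → Space N → ℝ} {κ : ℝ}
  {R : ℝ → ℝ} {ρ₀ : Space N → ℝ} {S : ℝ} {n : ℕ} {T : EReal}

/-! ### The limit of the approximations -/

/-- Absorbs the slack needed when the constants along a sequence converge without being bounded by
their limit. -/
lemma SobolevLE.of_forall_lt {m : ℕ} {C : ℝ} {f : Space N → ℝ}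
    (h : ∀ ε > 0, SobolevLE m (C + ε) f) : SobolevLE m C f := by
  have h0 : ∀ {m} {f : Space N → ℝ}, (∀ ε > 0, SobolevLE m (C + ε) f) → SobolevLE 0 C f := by
    intro m f h
    refine ⟨(h 1 one_pos).aestronglyMeasurable, ?_⟩
    have : ∀ᵐ x, ∀ k : ℕ, |f x| ≤ C + 1 / ((k : ℝ) + 1) :=
      ae_all_iff.2 fun k => (h _ (by positivity)).bound
    filter_upwards [this] with x hx
    have ht := (tendsto_one_div_add_atTop_nhds_zero_nat (𝕜 := ℝ)).const_add C
    rw [add_zero] at ht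
    exact ge_of_tendsto' ht hx
  induction m generalizing f with
  | zero => exact h0 h
  | succ m ih =>
    exact SobolevLE.succ (h0 h) (fun i => (h 1 one_pos).hasWeakPartial i)
      (fun i => ih fun ε hε => (h ε hε).weakD i)

lemma SobolevLE.of_tendsto_eventually {m : ℕ} {C : ℝ} {c : ℕ → ℝ} {f : ℕ → Space N → ℝ}
    {g : Space N → ℝ} (hf : ∀ᶠ n in atTop, SobolevLE m (c n) (f n)) (hc : Tendsto c atTop (𝓝 C))
    (hg : LocallyIntegrable g volume)
    (h : ∀ φ : Space N → ℝ, ContDiff ℝ ∞ φ → HasCompactSupport φ →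
      Tendsto (fun n => ∫ x, f n x * φ x) atTop (𝓝 (∫ x, g x * φ x))) : SobolevLE m C g := by
  refine SobolevLE.of_forall_lt fun ε hε => ?_
  obtain ⟨n₀, hn₀⟩ := eventually_atTop.1 (hf.and (hc.eventually_le_const (by linarith : C < C + ε)))
  refine SobolevLE.of_tendsto (f := fun n => f (n + n₀)) (fun n => ?_) hg fun φ hφ hφc => ?_
  · exact (hn₀ (n + n₀) (Nat.le_add_left _ _)).1.mono (hn₀ (n + n₀) (Nat.le_add_left _ _)).2
  · exact (h φ hφ hφc).comp (tendsto_add_atTop_nat n₀)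

lemma tendsto_integral_of_uniform {f : ℕ → Space N → ℝ} {g φ : Space N → ℝ} {ε : ℕ → ℝ}
    (hg : LocallyIntegrable g volume) (hφ : Continuous φ) (hc : HasCompactSupport φ)
    (hε : Tendsto ε atTop (𝓝 0))
    (h : ∀ᶠ n in atTop, SobolevLE 0 (ε n) (fun x => f n x - g x)) :
    Tendsto (fun n => ∫ x, f n x * φ x) atTop (𝓝 (∫ x, g x * φ x)) := by
  rw [tendsto_iff_dist_tendsto_zero]
  have hz : Tendsto (fun n => ε n * ∫ x, |φ x|) atTop (𝓝 0) := by simpa using hε.mul_const _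
  refine squeeze_zero' (Eventually.of_forall fun n => dist_nonneg) (h.mono fun n hn => ?_) hz
  have hf : LocallyIntegrable (f n) volume :=
    (hn.locallyIntegrable.add hg).congr (Eventually.of_forall fun x => by simp)
  rw [Real.dist_eq, ← integral_sub (integrable_mul_test hf hφ hc) (integrable_mul_test hg hφ hc)]
  simp_rw [← sub_mul]
  exact abs_integral_mul_le hn.bound (hφ.integrable_of_hasCompactSupport hc)

/-- The balls of the Sobolev classes are closed under uniform convergence up to a null set. -/
lemma SobolevLE.of_uniform {m : ℕ} {C : ℝ} {c : ℕ → ℝ} {f : ℕ → Space N → ℝ} {g : Space N → ℝ}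
    {ε : ℕ → ℝ} (hf : ∀ᶠ n in atTop, SobolevLE m (c n) (f n)) (hc : Tendsto c atTop (𝓝 C))
    (hε : Tendsto ε atTop (𝓝 0))
    (h : ∀ᶠ n in atTop, SobolevLE 0 (ε n) (fun x => f n x - g x)) : SobolevLE m C g := by
  have hg : LocallyIntegrable g volume := by
    obtain ⟨n, hn⟩ := (hf.and h).exists
    exact (hn.1.locallyIntegrable.sub hn.2.locallyIntegrable).congr
      (Eventually.of_forall fun x => by simp)
  exact SobolevLE.of_tendsto_eventually hf hc hg fun φ hφ hφc =>
    tendsto_integral_of_uniform hg hφ.continuous hφc hε h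

lemma continuous_step (hK : IsKernel K H κ) {ν h τ C : ℝ} (hh : 0 < h) {ρ : Space N → ℝ}
    (hc : Continuous ρ) (hρ : SobolevLE 0 C ρ) :
    Continuous (step K ν h τ ρ) ∧ ∃ C', SobolevLE 0 C' (step K ν h τ ρ) := by
  constructor
  · have : ∀ i, Continuous (conv (K i) ρ) := fun i =>
      continuous_conv (hK.integrable_grad i) hc (hρ.abs_le hc)
    unfold step lin lap dif
    fun_prop
  · exact ⟨_, hρ.add ((SobolevLE.sum fun i => ((hρ.lap_coarser i hh).const_mul ν).add
      ((hρ.mul (hK.conv_same hρ i)).dif_coarse i hh)).const_mul τ)⟩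

/-- Continuity turns the almost everywhere comparison of approximations into a pointwise one, so
that they converge at every point. -/
lemma continuous_seq (hK : IsKernel K H κ) (hc : Continuous ρ₀) (hρ₀ : MemSobolev 0 ρ₀) (n k : ℕ) :
    Continuous (seq K R ρ₀ n k) ∧ ∃ C, SobolevLE 0 C (seq K R ρ₀ n k) := by
  induction k with
  | zero => exact ⟨hc, hρ₀⟩
  | succ k ih =>
    obtain ⟨h1, C, h2⟩ := ih
    exact continuous_step hK (mesh_pos n) h1 h2

/-- The limit of the approximations. -/
def limSol (K : Fin N → Space N → ℝ) (R : ℝ → ℝ) (ρ₀ : Space N → ℝ) (t : ℝ) (x : Space N) : ℝ :=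
  limUnder atTop fun n => seq K R ρ₀ n (idx n t) x

lemma exists_gt_mem_timeInterval (hS : S ∈ timeInterval T) : ∃ S' ∈ timeInterval T, S < S' := by
  obtain ⟨q, h1, h2⟩ := EReal.lt_iff_exists_real_btwn.1 hS.2
  have hSq : S < q := by exact_mod_cast h1
  exact ⟨q, ⟨hS.1.trans hSq.le, h2⟩, hSq⟩

/-- The assumptions under which the approximations converge on `[0, T)`. -/
structure Convergent (K : Fin N → Space N → ℝ) (H : Fin N → Fin N → Space N → ℝ) (κ : ℝ)
    (R : ℝ → ℝ) (ρ₀ : Space N → ℝ) (T : EReal) : Prop where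
  kernel : IsKernel K H κ
  mono : Monotone R
  admissible : ∀ S ∈ timeInterval T, ∀ᶠ n in atTop, Admissible K κ R ρ₀ S n
  continuous : Continuous ρ₀
  sobolev : MemSobolev 2 ρ₀

lemma MemSobolev.of_le {m m' : ℕ} {f : Space N → ℝ} (h : MemSobolev m' f) (hm : m ≤ m') :
    MemSobolev m f := h.imp fun _ hC => hC.of_le hm

lemma Convergent.continuous_seq (hc : Convergent K H κ R ρ₀ T) (n k : ℕ) :
    Continuous (seq K R ρ₀ n k) :=
  (Aggregation.continuous_seq hc.kernel hc.continuous (hc.sobolev.of_le (by norm_num)) n k).1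

/-- The increments `C * mesh n` form a geometric series of ratio `1 / 2`, hence the constant `2 *
C`. Passing to some `S' > S` leaves room for one time step after `t`. -/
lemma Convergent.exists_rate (hc : Convergent K H κ R ρ₀ T) (hS : S ∈ timeInterval T) :
    ∃ C, ∀ᶠ n in atTop, ∀ t ∈ Icc 0 S, ∀ x,
      |seq K R ρ₀ n (idx n t) x - limSol K R ρ₀ t x| ≤ C * mesh n := by
  obtain ⟨S', hS', hlt⟩ := exists_gt_mem_timeInterval hS
  obtain ⟨C, hC, h⟩ := exists_seq_sub_le hc.kernel hc.mono (hc.admissible S' hS') hc.sobolev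
  obtain ⟨n₀, hn₀⟩ := eventually_atTop.1 (h.and
    (tendsto_tstep.eventually_le_const (by linarith : 0 < S' - S)))
  refine ⟨2 * C, eventually_atTop.2 ⟨n₀, fun n hn t ht x => ?_⟩⟩
  have hstep : ∀ j, dist (seq K R ρ₀ (j + n) (idx (j + n) t) x)
      (seq K R ρ₀ (j + 1 + n) (idx (j + 1 + n) t) x) ≤ C * mesh n * (1 / 2) ^ j := by
    intro j
    obtain ⟨h1, h2⟩ := hn₀ (j + n) (by omega)
    have h3 := (h1 t ht.1 (by linarith [ht.2])).abs_le
      ((hc.continuous_seq _ _).sub (hc.continuous_seq _ _)) x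
    rw [dist_comm, Real.dist_eq, add_right_comm]
    refine h3.trans (le_of_eq ?_)
    simp only [mesh, pow_add]; ring
  have hcs := cauchySeq_of_le_geometric _ _ (by norm_num) hstep
  obtain ⟨a, ha⟩ := cauchySeq_tendsto_of_complete hcs
  have hlim : limSol K R ρ₀ t x = a :=
    ((tendsto_add_atTop_iff_nat (f := fun j => seq K R ρ₀ j (idx j t) x) n).1 ha).limUnder_eq
  have := dist_le_of_le_geometric_of_tendsto₀ _ _ (by norm_num) hstep ha
  rw [hlim, ← Real.dist_eq]
  simp only [zero_add] at this
  refine this.trans (le_of_eq ?_)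
  ring

lemma Convergent.tendsto (hc : Convergent K H κ R ρ₀ T) {t : ℝ} (ht : t ∈ timeInterval T)
    (x : Space N) : Tendsto (fun n => seq K R ρ₀ n (idx n t) x) atTop (𝓝 (limSol K R ρ₀ t x)) := by
  obtain ⟨C, hC⟩ := hc.exists_rate ht
  rw [tendsto_iff_dist_tendsto_zero]
  have hz : Tendsto (fun n => C * mesh n) atTop (𝓝 0) := by simpa using tendsto_mesh.const_mul C
  exact squeeze_zero' (Eventually.of_forall fun n => dist_nonneg)
    (hC.mono fun n hn => hn t ⟨ht.1, le_rfl⟩ x) hz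

lemma Convergent.continuous_limSol (hc : Convergent K H κ R ρ₀ T) {t : ℝ}
    (ht : t ∈ timeInterval T) : Continuous (limSol K R ρ₀ t) := by
  obtain ⟨C, hC⟩ := hc.exists_rate ht
  have hz : Tendsto (fun n => C * mesh n) atTop (𝓝 0) := by simpa using tendsto_mesh.const_mul C
  have hu : TendstoUniformly (fun n => seq K R ρ₀ n (idx n t)) (limSol K R ρ₀ t) atTop := by
    rw [Metric.tendstoUniformly_iff]
    intro ε hε
    filter_upwards [hC, hz.eventually_lt_const hε] with n h1 h2 x
    rw [dist_comm]
    exact (h1 t ⟨ht.1, le_rfl⟩ x).trans_lt h2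
  exact hu.continuous (Frequently.of_forall fun n => hc.continuous_seq _ _)

lemma Convergent.limSol_zero (hc : Convergent K H κ R ρ₀ T) (hT : 0 < T) :
    limSol K R ρ₀ 0 = ρ₀ := by
  ext x
  have h := hc.tendsto (t := 0) ⟨le_rfl, by simpa using hT⟩ x
  simp only [idx, zero_div, Nat.floor_zero, seq] at h
  exact tendsto_nhds_unique h tendsto_const_nhds

lemma mem_timeInterval_of_le {s t : ℝ} (ht : t ∈ timeInterval T) (h0 : 0 ≤ s) (h : s ≤ t) :
    s ∈ timeInterval T := ⟨h0, lt_of_le_of_lt (EReal.coe_le_coe_iff.2 h) ht.2⟩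

/-- The uniform rate of convergence, as a statement in the Sobolev class of order zero. -/
lemma Convergent.exists_rate_sobolev (hc : Convergent K H κ R ρ₀ T) (hS : S ∈ timeInterval T) :
    ∃ C, ∀ᶠ n in atTop, ∀ t ∈ Icc 0 S,
      SobolevLE 0 (C * mesh n) (fun x => seq K R ρ₀ n (idx n t) x - limSol K R ρ₀ t x) := by
  obtain ⟨C, hC⟩ := hc.exists_rate hS
  refine ⟨C, hC.mono fun n hn t ht => ⟨?_, Eventually.of_forall (hn t ht)⟩⟩
  exact ((hc.continuous_seq _ _).sub
    (hc.continuous_limSol (mem_timeInterval_of_le hS ht.1 ht.2))).aestronglyMeasurable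

lemma tendsto_const_mul_mesh (C : ℝ) : Tendsto (fun n => C * mesh n) atTop (𝓝 0) := by
  simpa using tendsto_mesh.const_mul C

lemma Convergent.exists_sobolev (hc : Convergent K H κ R ρ₀ T) (hS : S ∈ timeInterval T) {m : ℕ}
    (hm : MemSobolev m ρ₀) : ∃ A, ∀ t ∈ Icc 0 S, SobolevLE m A (limSol K R ρ₀ t) := by
  obtain ⟨A, hA⟩ := exists_bound hc.kernel hc.mono (hc.admissible S hS) m hm
  obtain ⟨C, hC⟩ := hc.exists_rate_sobolev hS
  refine ⟨A, fun t ht => SobolevLE.of_uniform (f := fun n => seq K R ρ₀ n (idx n t)) ?_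
    tendsto_const_nhds (tendsto_const_mul_mesh C) (hC.mono fun n hn => hn t ht)⟩
  exact hA.mono fun n hn => hn _ ((idx_mul_le ht.1 n).trans ht.2)

lemma idx_mono {s t : ℝ} (h : s ≤ t) (n : ℕ) : idx n s ≤ idx n t := by
  unfold idx
  have := tstep_pos n
  gcongr

lemma tendsto_idx {s t : ℝ} (h0 : 0 ≤ s) (h : s ≤ t) :
    Tendsto (fun n => ((idx n t - idx n s : ℕ) : ℝ) * tstep n) atTop (𝓝 (t - s)) := by
  rw [tendsto_iff_dist_tendsto_zero]
  refine squeeze_zero (fun n => dist_nonneg) (fun n => ?_) tendsto_tstep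
  rw [Nat.cast_sub (idx_mono h n), Real.dist_eq, abs_le]
  have h1 := idx_mul_le h0 n
  have h2 := idx_mul_le (h0.trans h) n
  have h3 := lt_idx_mul s n
  have h4 := lt_idx_mul t n
  constructor <;> linarith

lemma Convergent.exists_lipschitz (hc : Convergent K H κ R ρ₀ T) (hS : S ∈ timeInterval T) {m : ℕ}
    (hm : MemSobolev (m + 1) ρ₀) : ∃ L, ∀ s ∈ Icc 0 S, ∀ t ∈ Icc 0 S,
      SobolevLE m (L * |t - s|) (fun x => limSol K R ρ₀ t x - limSol K R ρ₀ s x) := by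
  obtain ⟨A, hA⟩ := exists_bound hc.kernel hc.mono (hc.admissible S hS) (m + 1) hm
  obtain ⟨C, hC⟩ := hc.exists_rate_sobolev hS
  have key : ∀ s ∈ Icc 0 S, ∀ t ∈ Icc 0 S, s ≤ t →
      SobolevLE m (lipConst N κ (R S) m A * |t - s|)
        (fun x => limSol K R ρ₀ t x - limSol K R ρ₀ s x) := by
    intro s hs t ht hst
    rw [abs_of_nonneg (sub_nonneg.2 hst)]
    refine SobolevLE.of_uniform
      (f := fun n x => seq K R ρ₀ n (idx n t) x - seq K R ρ₀ n (idx n s) x)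
      (c := fun n => lipConst N κ (R S) m A * (((idx n t - idx n s : ℕ) : ℝ) * tstep n))
      (ε := fun n => C * mesh n + C * mesh n) ?_ ((tendsto_idx hs.1 hst).const_mul _) ?_ ?_
    · filter_upwards [hA, hc.admissible S hS] with n h1 h2
      have e : idx n s + (idx n t - idx n s) = idx n t := Nat.add_sub_cancel' (idx_mono hst n)
      have := seq_sub hc.kernel hc.mono h2 h1 (idx n s) (idx n t - idx n s)
        (by rw [e]; exact (idx_mul_le ht.1 n).trans ht.2)
      rwa [e] at this
    · simpa using (tendsto_const_mul_mesh C).add (tendsto_const_mul_mesh C)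
    · filter_upwards [hC] with n hn
      refine ((hn t ht).sub (hn s hs)).congr (Eventually.of_forall fun x => ?_)
      ring
  refine ⟨lipConst N κ (R S) m A, fun s hs t ht => ?_⟩
  rcases le_total s t with h | h
  · exact key s hs t ht h
  · rw [abs_sub_comm]
    refine (key t ht s hs h).neg.congr (Eventually.of_forall fun x => ?_)
    ring

lemma tendsto_integral_weakD {i : Fin N} {f : ℕ → Space N → ℝ} {g φ : Space N → ℝ} {ε : ℕ → ℝ}
    {C : ℝ} {c : ℕ → ℝ} (hg : SobolevLE 1 C g) (hf : ∀ᶠ n in atTop, SobolevLE 1 (c n) (f n))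
    (hφ : ContDiff ℝ ∞ φ) (hc : HasCompactSupport φ) (hε : Tendsto ε atTop (𝓝 0))
    (h : ∀ᶠ n in atTop, SobolevLE 0 (ε n) (fun x => f n x - g x)) :
    Tendsto (fun n => ∫ x, weakD i (f n) x * φ x) atTop (𝓝 (∫ x, weakD i g x * φ x)) := by
  have h1 := (tendsto_integral_of_uniform hg.locallyIntegrable
    (contDiff_partial hφ (basisVec i)).continuous (hasCompactSupport_partial hc _) hε h).neg
  rw [(hg.hasWeakPartial i).integral_eq φ hφ hc, neg_neg] at h1
  refine h1.congr' (hf.mono fun n hn => ?_)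
  rw [(hn.hasWeakPartial i).integral_eq φ hφ hc, neg_neg]

/-- The rates of the approximations converge in the sense of distributions. -/
lemma Convergent.tendsto_weakRate (hc : Convergent K H κ R ρ₀ T) {s : ℝ} (hs : s ∈ timeInterval T)
    {φ : Space N → ℝ} (hφ : ContDiff ℝ ∞ φ) (hφc : HasCompactSupport φ) :
    Tendsto (fun n => ∫ x, weakRate K (seq K R ρ₀ n (idx n s)) x * φ x) atTop
      (𝓝 (∫ x, weakRate K (limSol K R ρ₀ s) x * φ x)) := by
  have hK := hc.kernel
  have h1 : MemSobolev 1 ρ₀ := hc.sobolev.of_le (by norm_num)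
  obtain ⟨A, hA⟩ := exists_bound hK hc.mono (hc.admissible s hs) 1 h1
  obtain ⟨A', hA'⟩ := hc.exists_sobolev hs h1
  obtain ⟨C, hC⟩ := hc.exists_rate_sobolev hs
  have hss : s ∈ Icc 0 s := ⟨hs.1, le_rfl⟩
  have hl := hA' s hss
  have hseq : ∀ᶠ n in atTop, SobolevLE 1 A (seq K R ρ₀ n (idx n s)) :=
    hA.mono fun n hn => hn _ (idx_mul_le hs.1 n)
  have key : ∀ i, Tendsto (fun n => ∫ x, weakD i (flux K (seq K R ρ₀ n (idx n s)) i) x * φ x) atTop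
      (𝓝 (∫ x, weakD i (flux K (limSol K R ρ₀ s) i) x * φ x)) := by
    intro i
    refine tendsto_integral_weakD (hK.flux hl i)
      (hseq.mono fun n hn => hK.flux hn i) hφ hφc
      (ε := fun n => 2 ^ (0 + 1) * κ * max A A' * (C * mesh n)) ?_ ?_
    · have := (tendsto_const_mul_mesh C).const_mul (2 ^ (0 + 1) * κ * max A A')
      rwa [mul_zero] at this
    · filter_upwards [hseq, hC] with n h1 h2
      exact hK.flux_sub (h1.zero_level.mono (le_max_left A A'))
        (hl.zero_level.mono (le_max_right A A')) (h2 s hss) i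
  have hsum : ∀ {B : ℝ} {ρ : Space N → ℝ}, SobolevLE 1 B ρ → ∫ x, weakRate K ρ x * φ x =
      ∑ i, ∫ x, weakD i (flux K ρ i) x * φ x := by
    intro B ρ hρ
    simp only [weakRate, Finset.sum_mul]
    exact integral_finsetSum _ fun i _ => integrable_mul_test
      ((hK.flux hρ i).hasWeakPartial i).locInt_right hφ.continuous hφc
  rw [hsum hl]
  exact (tendsto_finsetSum _ fun i _ => key i).congr' (hseq.mono fun n hn => (hsum hn).symm)

/-- The limit satisfies the equation, with a quadratic remainder. -/
lemma Convergent.exists_taylor (hc : Convergent K H κ R ρ₀ T) (hS : S ∈ timeInterval T) {m : ℕ}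
    (hm : MemSobolev (m + 2) ρ₀) : ∃ C, ∀ s ∈ Icc 0 S, ∀ t ∈ Icc 0 S,
      SobolevLE m (C * |t - s| ^ 2) (fun x => limSol K R ρ₀ t x - limSol K R ρ₀ s x -
        (t - s) * weakRate K (limSol K R ρ₀ s) x) := by
  have hK := hc.kernel
  obtain ⟨A, hA⟩ := exists_bound hK hc.mono (hc.admissible S hS) (m + 2) hm
  obtain ⟨A', hA'⟩ := hc.exists_sobolev hS hm
  obtain ⟨L, hL⟩ := hc.exists_lipschitz hS hm
  obtain ⟨C, hC⟩ := hc.exists_rate_sobolev hS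
  set M := N * (2 ^ (m + 2) * κ * A) * lipConst N κ (R S) (m + 1) A with hM
  set M' := N * (2 ^ (m + 2) * κ * A') with hM'
  have hlim : ∀ t ∈ Icc 0 S, LocallyIntegrable (limSol K R ρ₀ t) volume := fun t ht =>
    (hA' t ht).locallyIntegrable
  have hrate : ∀ t ∈ Icc 0 S, LocallyIntegrable (weakRate K (limSol K R ρ₀ t)) volume :=
    fun t ht => (hK.weakRate (hA' t ht)).locallyIntegrable
  have key : ∀ s ∈ Icc 0 S, ∀ t ∈ Icc 0 S, s ≤ t → SobolevLE m (M * |t - s| ^ 2)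
      (fun x => limSol K R ρ₀ t x - limSol K R ρ₀ s x -
        (t - s) * weakRate K (limSol K R ρ₀ s) x) := by
    intro s hs t ht hst
    rw [abs_of_nonneg (sub_nonneg.2 hst)]
    have hti := tendsto_idx hs.1 hst
    refine SobolevLE.of_tendsto_eventually
      (f := fun n x => seq K R ρ₀ n (idx n t) x - seq K R ρ₀ n (idx n s) x -
        ((idx n t - idx n s : ℕ) : ℝ) * tstep n * weakRate K (seq K R ρ₀ n (idx n s)) x)
      (c := fun n => ((idx n t - idx n s : ℕ) : ℝ) * tstep n *
        (N * (2 * R S * A + 2 ^ (m + 2) * κ * A ^ 2) * mesh n +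
          M * (((idx n t - idx n s : ℕ) : ℝ) * tstep n))) ?_ ?_ ?_ ?_
    · filter_upwards [hA, hc.admissible S hS] with n h1 h2
      have e : idx n s + (idx n t - idx n s) = idx n t := Nat.add_sub_cancel' (idx_mono hst n)
      have := seq_taylor hK hc.mono h2 h1 (idx n s) (idx n t - idx n s)
        (by rw [e]; exact (idx_mul_le ht.1 n).trans ht.2)
      rwa [e] at this
    · have := hti.mul ((tendsto_const_mul_mesh
        (N * (2 * R S * A + 2 ^ (m + 2) * κ * A ^ 2))).add (hti.const_mul M))
      convert this using 2
      ring
    · exact ((hlim t ht).sub (hlim s hs)).sub ((hrate s hs).smul (t - s))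
    -- The rates converge only in the sense of distributions, because the derivatives of the
    -- approximations are merely bounded; this suffices to pass the bound to the limit.
    · intro φ hφ hφc
      have hφi := hφ.continuous
      have t1 : ∀ t ∈ Icc 0 S, Tendsto (fun n => ∫ x, seq K R ρ₀ n (idx n t) x * φ x) atTop
          (𝓝 (∫ x, limSol K R ρ₀ t x * φ x)) := fun t ht =>
        tendsto_integral_of_uniform (hlim t ht) hφi hφc (tendsto_const_mul_mesh C)
          (hC.mono fun n hn => hn t ht)
      have t2 := hti.mul (hc.tendsto_weakRate (mem_timeInterval_of_le hS hs.1 hs.2) hφ hφc)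
      have split : ∀ {a b r : Space N → ℝ} {c : ℝ}, LocallyIntegrable a volume →
          LocallyIntegrable b volume → LocallyIntegrable r volume →
          ∫ x, (a x - b x - c * r x) * φ x =
            (∫ x, a x * φ x) - (∫ x, b x * φ x) - c * ∫ x, r x * φ x := by
        intro a b r c ha hb hr
        have ia := integrable_mul_test ha hφi hφc
        have ib := integrable_mul_test hb hφi hφc
        have ir := integrable_mul_test hr hφi hφc
        have iab : Integrable (fun x => a x * φ x - b x * φ x) := ia.sub ib
        rw [← integral_const_mul, ← integral_sub ia ib, ← integral_sub iab (ir.const_mul c)]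
        congr 1; ext x; ring
      rw [split (hlim t ht) (hlim s hs) (hrate s hs)]
      refine (((t1 t ht).sub (t1 s hs)).sub t2).congr' (hA.mono fun n hn => ?_)
      have hn1 := hn _ ((idx_mul_le ht.1 n).trans ht.2)
      have hn2 := hn _ ((idx_mul_le hs.1 n).trans hs.2)
      exact (split hn1.locallyIntegrable hn2.locallyIntegrable
        (hK.weakRate hn2).locallyIntegrable).symm
  refine ⟨|M| + |M' * L|, fun s hs t ht => ?_⟩
  rcases le_total s t with h | h
  · refine (key s hs t ht h).mono ?_
    have : 0 ≤ |M' * L| := abs_nonneg _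
    have := le_abs_self M
    gcongr; linarith
  -- For `t ≤ s` the expansion at the earlier time `t` is used. Replacing its rate by the one at `s`
  -- costs another `M' * L * |t - s|`, as the limit is Lipschitz in time at order `m + 1`.
  · have h1 := (key t ht s hs h).neg
    have h2 := (hK.weakRate_sub (hA' t ht).of_succ (hA' s hs).of_succ (hL s hs t ht)).const_mul
      (t - s)
    refine ((h1.add h2).congr (Eventually.of_forall fun x => ?_)).mono ?_
    · ring
    · rw [abs_sub_comm s t]
      have e1 := le_abs_self M
      have e2 := le_abs_self (M' * L)
      have e3 := sq_nonneg |t - s|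
      nlinarith

end

section

variable {K : Fin N → Space N → ℝ} {H : Fin N → Fin N → Space N → ℝ} {κ : ℝ}
  {R : ℝ → ℝ} {ρ₀ : Space N → ℝ} {S : ℝ} {n : ℕ} {T : EReal}

/-! ### Admissibility of the approximations -/

lemma Stable.mono {ν h τ V V' : ℝ} (hs : Stable N ν h τ V') (hV : V ≤ V') :
    Stable N ν h τ V where
  mesh_pos := hs.mesh_pos
  time_pos := hs.time_pos
  time_le := hs.time_le
  speed_le := le_trans (by have := hs.mesh_pos; gcongr) hs.speed_le

lemma eventually_fine (N : ℕ) (r : ℝ) : ∀ᶠ n in atTop, 2 * N * r * mesh n ≤ 1 :=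
  (tendsto_const_mul_mesh (2 * N * r)).eventually_le_const one_pos

/-- For bounded data the approximations are bounded on a short time interval. -/
lemma admissible_local (hK : IsKernel K H κ) {B : ℝ} (hB : 0 < B) (hρ₀ : SobolevLE 0 B ρ₀)
    (hS : S * (4 * N * κ * B) ≤ 1) :
    ∀ᶠ n in atTop, Admissible K κ (fun _ => 2 * κ * B) ρ₀ S n := by
  have hκ := hK.pos
  have hR : Monotone fun _ : ℝ => 2 * κ * B := monotone_const
  filter_upwards [eventually_fine N (2 * κ * B)] with n hn
  have e : 2 * κ * B / κ = 2 * B := by field_simp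
  have hτ := tstep_pos n
  -- Discrete Riccati comparison: a step adds `τ N κ A²`, at most `4 N κ B² τ` as long as `A ≤ 2 B`,
  -- and the smallness of `S` keeps `A` below `2 B`.
  have key : ∀ k : ℕ, k * tstep n ≤ S →
      SobolevLE 0 (B + k * tstep n * (4 * N * κ * B ^ 2)) (seq K (fun _ => 2 * κ * B) ρ₀ n k) ∧
      B + k * tstep n * (4 * N * κ * B ^ 2) ≤ 2 * B := by
    intro k
    have hle : ∀ k : ℕ, k * tstep n ≤ S → B + k * tstep n * (4 * N * κ * B ^ 2) ≤ 2 * B := by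
      intro k hk
      have h1 : k * tstep n * (4 * N * κ * B) ≤ 1 := le_trans (by gcongr) hS
      nlinarith
    induction k with
    | zero => intro hk; exact ⟨by simpa [seq] using hρ₀, hle 0 hk⟩
    | succ k ih =>
      intro hk
      have hk' := time_le_of_succ hk
      obtain ⟨h1, h2⟩ := ih hk'
      refine ⟨?_, hle _ hk⟩
      have hst := (stable_of_fine (S := S) hK hR hn hk' (by positivity)).mono
        (V := κ * (B + k * tstep n * (4 * N * κ * B ^ 2))) (by rw [e]; gcongr)
      refine (SobolevLE.step_zero hK hst h1).mono ?_
      set A := B + k * tstep n * (4 * N * κ * B ^ 2) with hA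
      have hA0 : 0 ≤ A := by positivity
      have h3 : A ^ 2 ≤ (2 * B) ^ 2 := by gcongr
      have h4 : tstep n * (N * κ) * A ^ 2 ≤ tstep n * (N * κ) * (2 * B) ^ 2 := by gcongr
      push_cast
      rw [hA] at *
      nlinarith
  refine ⟨hn, fun k hk => ?_⟩
  rw [e]
  exact (key k hk).1.mono (key k hk).2

/-! ### Conservation of mass, positivity and the global bound -/

lemma integrable_dif {f : Space N → ℝ} (hf : Integrable f) (i : Fin N) (h : ℝ) :
    Integrable (dif i h f) :=
  ((hf.comp_add_right _).sub (hf.comp_add_right _)).div_const _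

lemma integral_dif {f : Space N → ℝ} (hf : Integrable f) (i : Fin N) (h : ℝ) :
    ∫ x, dif i h f x = 0 := by
  simp only [dif]
  rw [integral_div, integral_sub (hf.comp_add_right _) (hf.comp_add_right _),
    integral_add_right_eq_self, integral_add_right_eq_self]
  simp

lemma integrable_lap {f : Space N → ℝ} (hf : Integrable f) (i : Fin N) (h : ℝ) :
    Integrable (lap i h f) :=
  (((hf.comp_add_right _).add (hf.comp_add_right _)).sub (hf.const_mul 2)).div_const _

lemma integral_lap {f : Space N → ℝ} (hf : Integrable f) (i : Fin N) (h : ℝ) :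
    ∫ x, lap i h f x = 0 := by
  simp only [lap]
  have h1 : Integrable (fun x => f (x + h • basisVec i) + f (x + (-h) • basisVec i)) :=
    (hf.comp_add_right _).add (hf.comp_add_right _)
  rw [integral_div, integral_sub h1 (hf.const_mul 2),
    integral_add (hf.comp_add_right _) (hf.comp_add_right _),
    integral_add_right_eq_self, integral_add_right_eq_self, integral_const_mul]
  ring

/-- The scheme is conservative. -/
lemma integral_step (hK : IsKernel K H κ) {ν h τ A : ℝ} {ρ : Space N → ℝ}
    (hρ : SobolevLE 0 A ρ) (hi : Integrable ρ) :
    Integrable (step K ν h τ ρ) ∧ ∫ x, step K ν h τ ρ x = ∫ x, ρ x := by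
  have hfl : ∀ i, Integrable (flux K ρ i) := fun i =>
    hi.mul_bdd (c := κ * A) (hK.conv_same hρ i).aestronglyMeasurable (hK.conv_same hρ i).bound
  have h1 : ∀ i, Integrable (fun x => ν * lap i h ρ x + dif i h (flux K ρ i) x) := fun i =>
    ((integrable_lap hi i h).const_mul ν).add (integrable_dif (hfl i) i h)
  have h2 : Integrable (rate K ν h ρ) := integrable_finsetSum _ fun i _ => h1 i
  refine ⟨hi.add (h2.const_mul τ), ?_⟩
  simp only [step_eq]
  rw [integral_add hi (h2.const_mul τ), integral_const_mul]
  have h3 : ∫ x, rate K ν h ρ x = 0 := by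
    simp only [rate]
    rw [integral_finsetSum _ fun i _ => h1 i]
    refine Finset.sum_eq_zero fun i _ => ?_
    rw [integral_add ((integrable_lap hi i h).const_mul ν) (integrable_dif (hfl i) i h),
      integral_const_mul, integral_lap hi, integral_dif (hfl i)]
    simp
  rw [h3]; simp

/-- The scheme preserves nonnegativity. -/
lemma step_nonneg (hK : IsKernel K H κ) {ν h τ A : ℝ} {ρ : Space N → ℝ}
    (hs : Stable N ν h τ (κ * A)) (hρ : SobolevLE 0 A ρ) (h0 : ∀ᵐ x, 0 ≤ ρ x) :
    ∀ᵐ x, 0 ≤ step K ν h τ ρ x := by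
  have hb : ∀ i x, |conv (K i) ρ x| ≤ κ * A := fun i x =>
    (abs_conv_le (hK.integrable_grad i) hρ.bound x).trans
      (mul_le_mul_of_nonneg_right (hK.grad_le i) hρ.nonneg)
  have hp : ∀ᵐ x, ∀ i : Fin N, 0 ≤ ρ (x + h • basisVec i) :=
    ae_all_iff.2 fun i => ae_comp_add h0 _
  have hm : ∀ᵐ x, ∀ i : Fin N, 0 ≤ ρ (x + (-h) • basisVec i) :=
    ae_all_iff.2 fun i => ae_comp_add h0 _
  filter_upwards [h0, hp, hm] with x h1 h2 h3
  rw [step, lin_eq hs.mesh_pos]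
  refine add_nonneg (mul_nonneg hs.center_nonneg h1) (Finset.sum_nonneg fun i _ => add_nonneg ?_ ?_)
  · exact mul_nonneg (hs.coeff_nonneg (hb i _)).1 (h2 i)
  · exact mul_nonneg (hs.coeff_nonneg (hb i _)).2 (h3 i)

/-- The compression rate of a density is controlled by its mass. -/
lemma sum_conv_hess_le (hK : IsKernel K H κ) {Λ A : ℝ} {ρ : Space N → ℝ}
    (hΛ : ∀ᵐ x, ∑ i, H i i x ≤ Λ) (hρ : SobolevLE 0 A ρ) (h0 : ∀ᵐ x, 0 ≤ ρ x)
    (hi : Integrable ρ) (x : Space N) : ∑ i, conv (H i i) ρ x ≤ Λ * ∫ y, ρ y := by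
  have h1 : ∀ i, Integrable (fun y => H i i y * ρ (x - y)) := fun i =>
    integrable_conv_integrand (hK.integrable_hess i i) hρ.aestronglyMeasurable hρ.bound x
  simp only [conv_apply]
  rw [← integral_finsetSum _ fun i _ => h1 i, ← integral_sub_left_eq_self ρ volume x,
    ← integral_const_mul]
  refine integral_mono_ae (integrable_finsetSum _ fun i _ => h1 i)
    ((hi.comp_sub_left x).const_mul Λ) ?_
  filter_upwards [hΛ, ae_comp_sub_left h0 x] with y h2 h3
  rw [← Finset.sum_mul]
  exact mul_le_mul_of_nonneg_right h2 h3

/-- For nonnegative integrable data the approximations are bounded on all time intervals. -/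
lemma admissible_global (hK : IsKernel K H κ) {B A₀ Λ : ℝ} (hB : 0 < B) (hρ₀ : SobolevLE 0 B ρ₀)
    (hρ₁ : SobolevLE 1 A₀ ρ₀) (hΛ0 : 0 ≤ Λ) (hΛ : ∀ᵐ x, ∑ i, H i i x ≤ Λ)
    (h0 : ∀ᵐ x, 0 ≤ ρ₀ x) (hi : Integrable ρ₀) (S : ℝ) :
    ∀ᶠ n in atTop, Admissible K κ
      (fun t => κ * (B * Real.exp ((Λ * ∫ x, ρ₀ x) * t + t))) ρ₀ S n := by
  have hκ := hK.pos
  have hM : 0 ≤ ∫ x, ρ₀ x := integral_nonneg_of_ae h0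
  set Q := Λ * ∫ x, ρ₀ x with hQ
  have hQ0 : 0 ≤ Q := mul_nonneg hΛ0 hM
  set R : ℝ → ℝ := fun t => κ * (B * Real.exp (Q * t + t)) with hRdef
  have hR : Monotone R := by
    intro s t hst
    simp only [hRdef]
    gcongr
  have hRpos : ∀ t, 0 ≤ R t := fun t => by simp only [hRdef]; positivity
  have hRκ : ∀ t, R t / κ = B * Real.exp (Q * t + t) := fun t => by
    simp only [hRdef]; field_simp
  have hA₀ := hρ₁.nonneg
  -- Growth rate and bound `G` for the `𝒲^{1,∞}` norm, given the `L^∞` bound up to `S`. They are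
  -- used only to make the error between discrete and exact divergence of the velocity at most `1`;
  -- this error accounts for the extra `t` in the exponent of `R`.
  set C := N * 2 ^ (0 + 2) * (κ * (R S / κ)) with hC
  have hC0 : 0 ≤ C := by have := hRpos S; positivity
  set G := A₀ * Real.exp (C * S) with hG
  filter_upwards [eventually_fine N (R S),
    (tendsto_const_mul_mesh (N * (κ * G))).eventually_le_const one_pos] with n hn hnG
  have hτ := tstep_pos n
  -- The properties must be propagated together: the `L^∞` bound needs sign, mass and the `𝒲^{1,∞}`
  -- bound, which in turn rely on the stability furnished by the `L^∞` bound.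
  have key : ∀ k : ℕ, k * tstep n ≤ S → SobolevLE 0 (R (k * tstep n) / κ) (seq K R ρ₀ n k) ∧
      SobolevLE 1 (A₀ * (1 + tstep n * C) ^ k) (seq K R ρ₀ n k) ∧
      (∀ᵐ x, 0 ≤ seq K R ρ₀ n k x) ∧ Integrable (seq K R ρ₀ n k) ∧
      ∫ x, seq K R ρ₀ n k x = ∫ x, ρ₀ x := by
    intro k
    induction k with
    | zero =>
      intro _
      refine ⟨?_, by simpa [seq] using hρ₁, h0, hi, rfl⟩
      rw [hRκ]; simpa [seq] using hρ₀
    | succ k ih =>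
      intro hk
      have hk' := time_le_of_succ hk
      obtain ⟨i0, i1, i2, i3, i4⟩ := ih hk'
      have hst := stable_of_fine hK hR hn hk' (hRpos _)
      obtain ⟨j1, j2⟩ := integral_step hK (ν := R (k * tstep n) * mesh n) (h := mesh n)
        (τ := tstep n) i0 i3
      refine ⟨?_, ?_, step_nonneg hK hst i0 i2, j1, j2.trans i4⟩
      · have hG1 : SobolevLE 1 G (seq K R ρ₀ n k) :=
          i1.mono (mul_le_mul_of_nonneg_left (one_add_pow_le hC0 hk') hA₀)
        have hd := SobolevLE.sum fun i => (hK.conv_succ hG1 i).dif_sub (hK.weak_conv hG1 i i)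
          (mesh_pos n)
        have hq : ∀ᵐ x, ∑ i, dif i (mesh n) (conv (K i) (seq K R ρ₀ n k)) x ≤ Q + 1 := by
          filter_upwards [hd.bound] with x hx
          have hs := sum_conv_hess_le hK hΛ i0 i2 i3 x
          rw [i4] at hs
          rw [Finset.sum_sub_distrib] at hx
          have := (le_abs_self _).trans hx
          linarith
        refine (SobolevLE.lin_zero hst i0 (fun i => hK.conv_same i0 i) hq).mono ?_
        rw [hRκ, hRκ, mul_assoc]
        have e1 : Real.exp (Q * ((k + 1 : ℕ) * tstep n) + (k + 1 : ℕ) * tstep n) =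
            Real.exp (Q * (k * tstep n) + k * tstep n) * Real.exp (tstep n * (Q + 1)) := by
          rw [← Real.exp_add]; congr 1; push_cast; ring
        rw [e1]
        gcongr
        linarith [Real.add_one_le_exp (tstep n * (Q + 1))]
      · refine (SobolevLE.step_succ hK hst i0 i1 (i0.mono (C' := R S / κ) ?_)).mono (le_of_eq ?_)
        · have := hR hk'
          gcongr
        · rw [pow_succ]; ring
  exact ⟨hn, fun k hk => (key k hk).1⟩

end

section

variable {K : Fin N → Space N → ℝ} {H : Fin N → Fin N → Space N → ℝ} {κ : ℝ}
  {R : ℝ → ℝ} {ρ₀ : Space N → ℝ} {S : ℝ} {T : EReal}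

/-! ### Regularity in time -/

/-- Local boundedness in time for the norm of order `m`. -/
def LocBdd (T : EReal) (m : ℕ) (u : ℝ → Space N → ℝ) : Prop :=
  ∀ S ∈ timeInterval T, ∃ C : ℝ, ∀ t ∈ Icc 0 S, SobolevLE m C (u t)

/-- Local Lipschitz continuity in time for the norm of order `m`. -/
def LocLip (T : EReal) (m : ℕ) (u : ℝ → Space N → ℝ) : Prop :=
  ∀ S ∈ timeInterval T, ∃ L : ℝ, ∀ s ∈ Icc 0 S, ∀ t ∈ Icc 0 S,
    SobolevLE m (L * |t - s|) (fun x => u t x - u s x)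

/-- `v` is the time derivative of `u` for the norm of order `m`, with a quadratic remainder. -/
def LocTaylor (T : EReal) (m : ℕ) (u v : ℝ → Space N → ℝ) : Prop :=
  ∀ S ∈ timeInterval T, ∃ C : ℝ, ∀ s ∈ Icc 0 S, ∀ t ∈ Icc 0 S,
    SobolevLE m (C * |t - s| ^ 2) (fun x => u t x - u s x - (t - s) * v s x)

/-- A variant of `MemTimeSobolev` that is stable under products: all time derivatives are taken with
a quadratic remainder. -/
def Reg (T : EReal) : ℕ → ℕ → (ℝ → Space N → ℝ) → Prop
  | 0, m, u => LocBdd T m u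
  | j + 1, m, u => LocBdd T m u ∧ LocLip T m u ∧
      (1 ≤ j → ∃ u' : ℝ → Space N → ℝ, Reg T j m u' ∧ LocTaylor T m u u')

lemma Reg.locBdd {j m : ℕ} {u : ℝ → Space N → ℝ} (h : Reg T j m u) : LocBdd T m u := by
  cases j with
  | zero => exact h
  | succ j => exact h.1

lemma LocTaylor.exists_delta {m : ℕ} {u u' : ℝ → Space N → ℝ} (h : LocTaylor T m u u') {t : ℝ}
    (ht : t ∈ timeInterval T) {ε : ℝ} (hε : 0 < ε) :
    ∃ δ > 0, ∀ s ∈ timeInterval T, |s - t| < δ →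
      SobolevLE m (ε * |s - t|) (fun x => u s x - u t x - (s - t) * u' t x) := by
  obtain ⟨S, hS, hlt⟩ := exists_gt_mem_timeInterval ht
  obtain ⟨C, hC⟩ := h S hS
  -- The first entry keeps `s` inside `[0, S]`; the second turns the quadratic remainder into `ε *
  -- |s - t|`.
  refine ⟨min (S - t) (ε / (|C| + 1)), by
    have := abs_nonneg C
    exact lt_min (by linarith) (by positivity), fun s hs hst => ?_⟩
  have h1 := hst.trans_le (min_le_left _ _)
  have h2 := hst.trans_le (min_le_right _ _)
  refine (hC t ⟨ht.1, hlt.le⟩ s ⟨hs.1, by linarith [le_abs_self (s - t)]⟩).mono ?_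
  rw [lt_div_iff₀ (by positivity)] at h2
  rw [sq, ← mul_assoc]
  gcongr
  nlinarith [le_abs_self C, abs_nonneg (s - t)]

lemma Reg.memTimeSobolev {j m : ℕ} {u : ℝ → Space N → ℝ} (h : Reg T j m u) :
    MemTimeSobolev T j m u := by
  induction j generalizing u with
  | zero => exact h
  | succ j ih =>
    cases j with
    | zero => exact ⟨h.1, h.2.1⟩
    | succ j =>
      obtain ⟨u', h1, h2⟩ := h.2.2 (Nat.le_add_left 1 j)
      exact ⟨h.1, u', ih h1, fun t ht ε hε => h2.exists_delta ht hε⟩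

lemma Reg.of_succ {j m : ℕ} {u : ℝ → Space N → ℝ} (h : Reg T (j + 1) m u) : Reg T j m u := by
  induction j generalizing u with
  | zero => exact h.1
  | succ j ih =>
    obtain ⟨u', h1, h2⟩ := h.2.2 (Nat.le_add_left 1 j)
    exact ⟨h.1, h.2.1, fun _ => ⟨u', ih h1, h2⟩⟩

lemma LocBdd.linear {m m' : ℕ} {c : ℝ} {Φ : (Space N → ℝ) → Space N → ℝ} {u : ℝ → Space N → ℝ}
    (hb : ∀ C f, SobolevLE m C f → SobolevLE m' (c * C) (Φ f)) (h : LocBdd T m u) :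
    LocBdd T m' fun t => Φ (u t) := fun S hS => by
  obtain ⟨C, hC⟩ := h S hS
  exact ⟨c * C, fun t ht => hb _ _ (hC t ht)⟩

/-- Bounded linear operators preserve regularity in time. -/
lemma Reg.linear {m m' : ℕ} {c : ℝ} {Φ : (Space N → ℝ) → Space N → ℝ}
    (hb : ∀ C f, SobolevLE m C f → SobolevLE m' (c * C) (Φ f))
    (hl : ∀ C D f g (a : ℝ), SobolevLE m C f → SobolevLE m D g →
      Φ (fun x => f x - a * g x) =ᵐ[volume] fun x => Φ f x - a * Φ g x)
    {j : ℕ} {u : ℝ → Space N → ℝ} (h : Reg T j m u) : Reg T j m' fun t => Φ (u t) := by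
  have hl' : ∀ C D f g, SobolevLE m C f → SobolevLE m D g →
      Φ (fun x => f x - g x) =ᵐ[volume] fun x => Φ f x - Φ g x := fun C D f g hf hg => by
    simpa using hl C D f g 1 hf hg
  induction j generalizing u with
  | zero => exact LocBdd.linear hb h
  | succ j ih =>
    refine ⟨LocBdd.linear hb h.1, fun S hS => ?_, fun hj => ?_⟩
    · obtain ⟨C, hC⟩ := h.1 S hS
      obtain ⟨L, hL⟩ := h.2.1 S hS
      refine ⟨c * L, fun s hs t ht => ?_⟩
      refine ((hb _ _ (hL s hs t ht)).congr (hl' C C _ _ (hC t ht) (hC s hs))).mono (le_of_eq ?_)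
      ring
    · obtain ⟨u', h1, h2⟩ := h.2.2 hj
      refine ⟨fun t => Φ (u' t), ih h1, fun S hS => ?_⟩
      obtain ⟨C, hC⟩ := h.1 S hS
      obtain ⟨C', hC'⟩ := h1.locBdd S hS
      obtain ⟨M, hM⟩ := h2 S hS
      refine ⟨c * M, fun s hs t ht => ?_⟩
      refine ((hb _ _ (hM s hs t ht)).congr ?_).mono (le_of_eq (by ring))
      refine (hl _ C' _ _ (t - s) ((hC t ht).sub (hC s hs)) (hC' s hs)).trans ?_
      filter_upwards [hl' C C _ _ (hC t ht) (hC s hs)] with x hx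
      rw [hx]

lemma Reg.add {m j : ℕ} {u v : ℝ → Space N → ℝ} (hu : Reg T j m u) (hv : Reg T j m v) :
    Reg T j m fun t x => u t x + v t x := by
  have hbdd : ∀ {u v : ℝ → Space N → ℝ}, LocBdd T m u → LocBdd T m v →
      LocBdd T m fun t x => u t x + v t x := fun h1 h2 S hS => by
    obtain ⟨A, hA⟩ := h1 S hS
    obtain ⟨B, hB⟩ := h2 S hS
    exact ⟨A + B, fun t ht => (hA t ht).add (hB t ht)⟩
  induction j generalizing u v with
  | zero => exact hbdd hu hv
  | succ j ih =>
    refine ⟨hbdd hu.1 hv.1, fun S hS => ?_, fun hj => ?_⟩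
    · obtain ⟨A, hA⟩ := hu.2.1 S hS
      obtain ⟨B, hB⟩ := hv.2.1 S hS
      refine ⟨A + B, fun s hs t ht => (((hA s hs t ht).add (hB s hs t ht)).congr
        (Eventually.of_forall fun x => ?_)).mono (le_of_eq (by ring))⟩
      ring
    · obtain ⟨u', h1, h2⟩ := hu.2.2 hj
      obtain ⟨v', h3, h4⟩ := hv.2.2 hj
      refine ⟨_, ih h1 h3, fun S hS => ?_⟩
      obtain ⟨A, hA⟩ := h2 S hS
      obtain ⟨B, hB⟩ := h4 S hS
      refine ⟨A + B, fun s hs t ht => (((hA s hs t ht).add (hB s hs t ht)).congr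
        (Eventually.of_forall fun x => ?_)).mono (le_of_eq (by ring))⟩
      ring

lemma Reg.zero (m j : ℕ) : Reg T j m fun _ (_ : Space N) => 0 := by
  have h0 : LocBdd T m fun _ (_ : Space N) => 0 := fun S _ => ⟨0, fun t _ => SobolevLE.zero m⟩
  induction j with
  | zero => exact h0
  | succ j ih =>
    refine ⟨h0, fun S _ => ⟨0, fun s _ t _ => by simpa using SobolevLE.zero m⟩, fun _ =>
      ⟨_, ih, fun S _ => ⟨0, fun s _ t _ => by simpa using SobolevLE.zero m⟩⟩⟩

lemma Reg.sum {ι : Type*} {m j : ℕ} {u : ι → ℝ → Space N → ℝ} (s : Finset ι)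
    (h : ∀ i, Reg T j m (u i)) : Reg T j m fun t x => ∑ i ∈ s, u i t x := by
  classical
  induction s using Finset.induction_on with
  | empty => simpa using Reg.zero m j
  | insert a s ha ih =>
    simp only [Finset.sum_insert ha]
    exact (h a).add ih

lemma Reg.mul {m j : ℕ} {u v : ℝ → Space N → ℝ} (hu : Reg T j m u) (hv : Reg T j m v) :
    Reg T j m fun t x => u t x * v t x := by
  have hbdd : ∀ {u v : ℝ → Space N → ℝ}, LocBdd T m u → LocBdd T m v →
      LocBdd T m fun t x => u t x * v t x := fun h1 h2 S hS => by
    obtain ⟨A, hA⟩ := h1 S hS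
    obtain ⟨B, hB⟩ := h2 S hS
    exact ⟨_, fun t ht => (hA t ht).mul (hB t ht)⟩
  induction j generalizing u v with
  | zero => exact hbdd hu hv
  | succ j ih =>
    refine ⟨hbdd hu.1 hv.1, fun S hS => ?_, fun hj => ?_⟩
    · obtain ⟨A, hA⟩ := hu.1 S hS
      obtain ⟨B, hB⟩ := hv.1 S hS
      obtain ⟨A', hA'⟩ := hu.2.1 S hS
      obtain ⟨B', hB'⟩ := hv.2.1 S hS
      refine ⟨2 ^ m * (A' * B + A * B'), fun s hs t ht =>
        ((((hA' s hs t ht).mul (hB t ht)).add ((hA s hs).mul (hB' s hs t ht))).congr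
          (Eventually.of_forall fun x => ?_)).mono (le_of_eq (by ring))⟩
      ring
    · obtain ⟨u', h1, h2⟩ := hu.2.2 hj
      obtain ⟨v', h3, h4⟩ := hv.2.2 hj
      refine ⟨_, (ih h1 hv.of_succ).add (ih hu.of_succ h3), fun S hS => ?_⟩
      obtain ⟨A, hA⟩ := hu.1 S hS
      obtain ⟨B, hB⟩ := hv.1 S hS
      obtain ⟨A', hA'⟩ := h1.locBdd S hS
      obtain ⟨B', hB'⟩ := hv.2.1 S hS
      obtain ⟨C, hC⟩ := h2 S hS
      obtain ⟨D, hD⟩ := h4 S hS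
      -- The remainder of `u v` is `r_u v(t) + u(s) r_v + (t - s) u'(s) (v(t) - v(s))`, where `r_u`
      -- and `r_v` are the remainders of the factors. The last term is quadratic because `v` is
      -- Lipschitz.
      refine ⟨2 ^ m * (C * B + A * D + A' * B'), fun s hs t ht => ?_⟩
      refine (((((hC s hs t ht).mul (hB t ht)).add ((hA s hs).mul (hD s hs t ht))).add
        (((hA' s hs).mul (hB' s hs t ht)).const_mul (t - s))).congr
          (Eventually.of_forall fun x => ?_)).mono (le_of_eq (by ring))
      ring

lemma Reg.conv {m j : ℕ} {u : ℝ → Space N → ℝ} {k : Space N → ℝ} (hk : Integrable k)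
    (hu : Reg T j m u) : Reg T j m fun t => conv k (u t) := by
  refine Reg.linear (c := ∫ y, |k y|) (fun C f hf => hf.conv hk le_rfl) ?_ hu
  intro C D f g a hf hg
  refine Eventually.of_forall fun x => ?_
  have h1 := conv_sub hk hf (hg.const_mul a) x
  rw [conv_const_mul] at h1
  exact h1

lemma Reg.weakD {m j : ℕ} {u : ℝ → Space N → ℝ} (i : Fin N) (hu : Reg T j (m + 1) u) :
    Reg T j m fun t => weakD i (u t) := by
  refine Reg.linear (c := 1) (fun C f hf => by simpa using hf.weakD i) ?_ hu
  intro C D f g a hf hg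
  exact ((hf.hasWeakPartial i).sub ((hg.hasWeakPartial i).const_mul a)).weakD_ae

lemma Reg.flux {m j : ℕ} {u : ℝ → Space N → ℝ} (hK : IsKernel K H κ) (hu : Reg T j m u)
    (i : Fin N) : Reg T j m fun t => flux K (u t) i :=
  hu.mul (hu.conv (hK.integrable_grad i))

lemma Reg.weakRate {m j : ℕ} {u : ℝ → Space N → ℝ} (hK : IsKernel K H κ)
    (hu : Reg T j (m + 1) u) : Reg T j m fun t => weakRate K (u t) :=
  Reg.sum Finset.univ fun i => (hu.flux hK i).weakD i

/-- The limit is as regular as the initial datum allows. -/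
lemma Convergent.reg (hc : Convergent K H κ R ρ₀ T) {p : ℕ} (hp : MemSobolev p ρ₀) (j m : ℕ)
    (hjm : j + m ≤ p) : Reg T j m (limSol K R ρ₀) := by
  have hbdd : ∀ {m}, m ≤ p → LocBdd T m (limSol K R ρ₀) := fun hm S hS =>
    hc.exists_sobolev hS (hp.of_le hm)
  induction j generalizing m with
  | zero => exact hbdd (by omega)
  | succ j ih =>
    refine ⟨hbdd (by omega), fun S hS => hc.exists_lipschitz hS (hp.of_le (by omega)), fun hj => ?_⟩
    -- The time derivative is the weak rate of the limit: one time derivative is exchanged for one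
    -- space derivative, and `j + m` is unchanged.
    exact ⟨_, (ih (m + 1) (by omega)).weakRate hc.kernel, fun S hS =>
      hc.exists_taylor hS (hp.of_le (by omega))⟩

end

section

variable {K : Fin N → Space N → ℝ} {H : Fin N → Fin N → Space N → ℝ} {κ : ℝ}
  {R : ℝ → ℝ} {ρ₀ : Space N → ℝ} {S : ℝ} {T : EReal}

/-! ### The limit is a classical solution -/

/-- The classical divergence of the flux. -/
def classicalRate (K : Fin N → Space N → ℝ) (ρ : Space N → ℝ) : Space N → ℝ :=
  fun x => ∑ i, fderiv ℝ (flux K ρ i) x (basisVec i)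

lemma continuous_flux (hK : IsKernel K H κ) {m : ℕ} {C : ℝ} {ρ : Space N → ℝ}
    (hρ : SobolevLE m C ρ) (hc : Continuous ρ) (i : Fin N) : Continuous (flux K ρ i) :=
  hc.mul (continuous_conv (hK.integrable_grad i) hc (hρ.abs_le hc))

lemma contDiff_flux (hK : IsKernel K H κ) {C : ℝ} {ρ : Space N → ℝ}
    (hρ : SobolevLE 2 C ρ) (hc : Continuous ρ) (i : Fin N) : ContDiff ℝ 1 (flux K ρ i) :=
  (hK.flux hρ i).contDiff (continuous_flux hK hρ hc i)

lemma continuous_classicalRate (hK : IsKernel K H κ) {C : ℝ} {ρ : Space N → ℝ}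
    (hρ : SobolevLE 2 C ρ) (hc : Continuous ρ) : Continuous (classicalRate K ρ) :=
  continuous_finsetSum _ fun i _ =>
    ((contDiff_flux hK hρ hc i).continuous_fderiv one_ne_zero).clm_apply continuous_const

lemma weakRate_ae_eq (hK : IsKernel K H κ) {C : ℝ} {ρ : Space N → ℝ}
    (hρ : SobolevLE 2 C ρ) (hc : Continuous ρ) : weakRate K ρ =ᵐ[volume] classicalRate K ρ := by
  have h : ∀ᵐ x, ∀ i, weakD i (flux K ρ i) x = fderiv ℝ (flux K ρ i) x (basisVec i) :=
    ae_all_iff.2 fun i =>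
      ((hK.flux hρ i).hasWeakPartial_fderiv (continuous_flux hK hρ hc i) i).weakD_ae
  filter_upwards [h] with x hx
  simp only [weakRate, classicalRate, hx]

lemma velocity_eq (ρ : Space N → ℝ) (i : Fin N) (x : Space N) :
    velocity K ρ i x = -conv (K i) ρ x := rfl

lemma neg_divergence_eq (ρ : Space N → ℝ) (x : Space N) :
    -divergence (fun i y => ρ y * velocity K ρ i y) x = classicalRate K ρ x := by
  have h : ∀ i, (fun y => ρ y * velocity K ρ i y) = fun y => -flux K ρ i y := fun i => by
    ext y; simp [velocity_eq, flux]
  simp only [divergence, classicalRate, h, fderiv_fun_neg, neg_apply,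
    Finset.sum_neg_distrib, neg_neg]

/-- Joint continuity from continuity in space and a Lipschitz bound in time that is uniform in
space. -/
lemma continuousOn_uncurry_of_lip {g : ℝ → Space N → ℝ} (hg : ∀ t ∈ timeInterval T, Continuous (g t))
    (h : ∀ S ∈ timeInterval T, ∃ L : ℝ, ∀ s ∈ Icc 0 S, ∀ t ∈ Icc 0 S, ∀ x,
      |g t x - g s x| ≤ L * |t - s|) :
    ContinuousOn (Function.uncurry g) (timeInterval T ×ˢ univ) := by
  rintro ⟨t, x⟩ ⟨ht, -⟩
  obtain ⟨S, hS, hlt⟩ := exists_gt_mem_timeInterval ht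
  obtain ⟨L, hL⟩ := h S hS
  rw [ContinuousWithinAt, tendsto_iff_dist_tendsto_zero]
  have h1 : Tendsto (fun p : ℝ × Space N => L * |p.1 - t| + |g t p.2 - g t x|)
      (𝓝[timeInterval T ×ˢ univ] (t, x)) (𝓝 0) := by
    have hc : Continuous fun p : ℝ × Space N => L * |p.1 - t| + |g t p.2 - g t x| := by
      have := hg t ht
      fun_prop
    have := hc.tendsto (t, x)
    simp only [sub_self, abs_zero, mul_zero, add_zero] at this
    exact this.mono_left nhdsWithin_le_nhds
  refine squeeze_zero' (Eventually.of_forall fun _ => dist_nonneg) ?_ h1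
  have h2 : ∀ᶠ p : ℝ × Space N in 𝓝[timeInterval T ×ˢ univ] (t, x), p.1 < S :=
    nhdsWithin_le_nhds (continuous_fst.continuousAt.eventually_lt_const hlt)
  filter_upwards [h2, self_mem_nhdsWithin] with p hp1 hp2
  have h3 := hL t ⟨ht.1, hlt.le⟩ p.1 ⟨hp2.1.1, hp1.le⟩ p.2
  simp only [Function.uncurry, Real.dist_eq]
  calc |g p.1 p.2 - g t x| = |(g p.1 p.2 - g t p.2) + (g t p.2 - g t x)| := by congr 1; ring
    _ ≤ _ := (abs_add_le _ _).trans (by gcongr)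

lemma abs_fderiv_sub_le {f g : Space N → ℝ} {C : ℝ} (hf : Differentiable ℝ f)
    (hg : Differentiable ℝ g) (h : SobolevLE 1 C fun x => f x - g x) (i : Fin N) (x : Space N) :
    |fderiv ℝ f x (basisVec i) - fderiv ℝ g x (basisVec i)| ≤ C := by
  have h1 := h.abs_fderiv_le (hf.sub hg) i x
  rwa [fderiv_fun_sub (hf x) (hg x), sub_apply] at h1

lemma Convergent.reg_low (hc : Convergent K H κ R ρ₀ T) :
    Reg T 1 1 (limSol K R ρ₀) := hc.reg hc.sobolev 1 1 (by norm_num)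

lemma Convergent.sobolev_two (hc : Convergent K H κ R ρ₀ T) {t : ℝ} (ht : t ∈ timeInterval T) :
    ∃ C, SobolevLE 2 C (limSol K R ρ₀ t) := by
  obtain ⟨C, hC⟩ := hc.exists_sobolev ht hc.sobolev
  exact ⟨C, hC t ⟨ht.1, le_rfl⟩⟩

lemma Convergent.continuousOn_classicalRate (hc : Convergent K H κ R ρ₀ T) :
    ContinuousOn (Function.uncurry fun t => classicalRate K (limSol K R ρ₀ t))
      (timeInterval T ×ˢ univ) := by
  have hK := hc.kernel
  refine continuousOn_uncurry_of_lip (fun t ht => ?_) fun S hS => ?_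
  · obtain ⟨C, hC⟩ := hc.sobolev_two ht
    exact continuous_classicalRate hK hC (hc.continuous_limSol ht)
  · choose L hL using fun i => (hc.reg_low.flux hK i).2.1 S hS
    refine ⟨∑ i, L i, fun s hs t ht x => ?_⟩
    have hd : ∀ t ∈ Icc 0 S, ∀ i, Differentiable ℝ (flux K (limSol K R ρ₀ t) i) := fun t ht i => by
      have ht' := mem_timeInterval_of_le hS ht.1 ht.2
      obtain ⟨C, hC⟩ := hc.sobolev_two ht'
      exact (contDiff_flux hK hC (hc.continuous_limSol ht') i).differentiable one_ne_zero
    simp only [classicalRate]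
    rw [← Finset.sum_sub_distrib, Finset.sum_mul]
    exact (Finset.abs_sum_le_sum_abs _ _).trans (Finset.sum_le_sum fun i _ =>
      abs_fderiv_sub_le (hd t ht i) (hd s hs i) (hL i s hs t ht) i x)

lemma Convergent.contDiff_limSol (hc : Convergent K H κ R ρ₀ T) {t : ℝ}
    (ht : t ∈ timeInterval T) : ContDiff ℝ 1 (limSol K R ρ₀ t) := by
  obtain ⟨C, hC⟩ := hc.sobolev_two ht
  exact hC.contDiff (hc.continuous_limSol ht)

lemma Convergent.continuousOn_fderiv (hc : Convergent K H κ R ρ₀ T) :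
    ContinuousOn (fun p : ℝ × Space N => fderiv ℝ (limSol K R ρ₀ p.1) p.2)
      (timeInterval T ×ˢ univ) := by
  have h : ∀ i : Fin N, ContinuousOn (Function.uncurry fun t x =>
      fderiv ℝ (limSol K R ρ₀ t) x (basisVec i)) (timeInterval T ×ˢ univ) := by
    intro i
    refine continuousOn_uncurry_of_lip (fun t ht => ?_) fun S hS => ?_
    · exact ((hc.contDiff_limSol ht).continuous_fderiv one_ne_zero).clm_apply continuous_const
    · obtain ⟨L, hL⟩ := hc.reg_low.2.1 S hS
      have hd : ∀ t ∈ Icc 0 S, Differentiable ℝ (limSol K R ρ₀ t) := fun t ht =>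
        (hc.contDiff_limSol (mem_timeInterval_of_le hS ht.1 ht.2)).differentiable one_ne_zero
      exact ⟨L, fun s hs t ht x => abs_fderiv_sub_le (hd t ht) (hd s hs) (hL s hs t ht) i x⟩
  have h2 := continuous_coordForm.comp_continuousOn (continuousOn_pi.2 h)
  refine h2.congr fun p _ => ?_
  exact eq_coordForm _

/-- The weak rate may be replaced by its continuous classical representative, after which the bound
holds at every point. -/
lemma Convergent.exists_taylor_pointwise (hc : Convergent K H κ R ρ₀ T)
    (hS : S ∈ timeInterval T) : ∃ C, ∀ s ∈ Icc 0 S, ∀ t ∈ Icc 0 S, ∀ x,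
      |limSol K R ρ₀ t x - limSol K R ρ₀ s x -
        (t - s) * classicalRate K (limSol K R ρ₀ s) x| ≤ C * |t - s| ^ 2 := by
  obtain ⟨C, hC⟩ := hc.exists_taylor hS (m := 0) hc.sobolev
  refine ⟨C, fun s hs t ht x => ?_⟩
  have hs' := mem_timeInterval_of_le hS hs.1 hs.2
  have ht' := mem_timeInterval_of_le hS ht.1 ht.2
  obtain ⟨A, hA⟩ := hc.sobolev_two hs'
  have hcs := hc.continuous_limSol hs'
  refine ((hC s hs t ht).congr ?_).abs_le
    (((hc.continuous_limSol ht').sub hcs).sub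
      (continuous_const.mul (continuous_classicalRate hc.kernel hA hcs))) x
  filter_upwards [weakRate_ae_eq hc.kernel hA hcs] with y hy
  simp only [Pi.sub_apply, Pi.mul_apply, hy]

lemma isLittleO_sq {l : Filter (ℝ × Space N)} {p : ℝ × Space N} (hl : l ≤ 𝓝 p) :
    (fun q : ℝ × Space N => |q.1 - p.1| ^ 2) =o[l] fun q => q - p := by
  have h1 : (fun q : ℝ × Space N => q.1 - p.1) =O[l] fun q => ‖q - p‖ :=
    Asymptotics.IsBigO.of_bound 1 (Eventually.of_forall fun q => by
      simpa using norm_fst_le (q - p))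
  have h2 : (fun q : ℝ × Space N => q.1 - p.1) =o[l] fun _ => (1 : ℝ) := by
    rw [Asymptotics.isLittleO_one_iff]
    have : Continuous fun q : ℝ × Space N => q.1 - p.1 := by fun_prop
    have := this.tendsto p
    rw [sub_self] at this
    exact this.mono_left hl
  have h3 := h2.mul_isBigO h1
  have h4 : (fun q : ℝ × Space N => |q.1 - p.1| ^ 2) = fun q => (q.1 - p.1) * (q.1 - p.1) := by
    ext q; rw [sq_abs, sq]
  rw [h4]
  simp only [one_mul] at h3
  exact h3.of_norm_right

/-- The space-time derivative of the limit. -/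
def spaceTimeDeriv (K : Fin N → Space N → ℝ) (R : ℝ → ℝ) (ρ₀ : Space N → ℝ) (p : ℝ × Space N) :
    ℝ × Space N →L[ℝ] ℝ :=
  (ContinuousLinearMap.fst ℝ ℝ (Space N)).smulRight (classicalRate K (limSol K R ρ₀ p.1) p.2) +
    (fderiv ℝ (limSol K R ρ₀ p.1) p.2).comp (ContinuousLinearMap.snd ℝ ℝ (Space N))

/-- The increment splits into three negligible parts: the time expansion at the moved position,
uniform in space (`o1`), the displacement of the rate back to `x` (`o2`), and the spatial
differentiability at time `t` (`o3`). -/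
lemma Convergent.hasFDerivWithinAt (hc : Convergent K H κ R ρ₀ T) {p : ℝ × Space N}
    (hp : p.1 ∈ timeInterval T) :
    HasFDerivWithinAt (Function.uncurry (limSol K R ρ₀)) (spaceTimeDeriv K R ρ₀ p)
      (timeInterval T ×ˢ univ) p := by
  obtain ⟨t, x⟩ := p
  change t ∈ timeInterval T at hp
  obtain ⟨S, hS, hlt⟩ := exists_gt_mem_timeInterval hp
  obtain ⟨C, hC⟩ := hc.exists_taylor_pointwise hS
  obtain ⟨A, hA⟩ := hc.sobolev_two hp
  have hcr := continuous_classicalRate hc.kernel hA (hc.continuous_limSol hp)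
  rw [hasFDerivWithinAt_iff_isLittleO]
  have hle : 𝓝[timeInterval T ×ˢ univ] (t, x) ≤ 𝓝 (t, x) := nhdsWithin_le_nhds
  set u := limSol K R ρ₀
  have o1 : (fun q : ℝ × Space N => u q.1 q.2 - u t q.2 - (q.1 - t) * classicalRate K (u t) q.2)
      =o[𝓝[timeInterval T ×ˢ univ] (t, x)] fun q => q - (t, x) := by
    refine Asymptotics.IsBigO.trans_isLittleO ?_ (isLittleO_sq hle)
    refine Asymptotics.IsBigO.of_bound C ?_
    have h2 : ∀ᶠ p : ℝ × Space N in 𝓝[timeInterval T ×ˢ univ] (t, x), p.1 < S :=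
      hle (continuous_fst.continuousAt.eventually_lt_const hlt)
    filter_upwards [h2, self_mem_nhdsWithin] with q hq1 hq2
    have := hC t ⟨hp.1, hlt.le⟩ q.1 ⟨hq2.1.1, hq1.le⟩ q.2
    simpa using this
  have o2 : (fun q : ℝ × Space N => (q.1 - t) * (classicalRate K (u t) q.2 - classicalRate K (u t) x))
      =o[𝓝[timeInterval T ×ˢ univ] (t, x)] fun q => q - (t, x) := by
    have h1 : (fun q : ℝ × Space N => q.1 - t) =O[𝓝[timeInterval T ×ˢ univ] (t, x)]
        fun q => ‖q - (t, x)‖ := Asymptotics.IsBigO.of_bound 1 (Eventually.of_forall fun q => by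
      simpa using norm_fst_le (q - (t, x)))
    have h2 : (fun q : ℝ × Space N => classicalRate K (u t) q.2 - classicalRate K (u t) x)
        =o[𝓝[timeInterval T ×ˢ univ] (t, x)] fun _ => (1 : ℝ) := by
      rw [Asymptotics.isLittleO_one_iff]
      have : Continuous fun q : ℝ × Space N =>
        classicalRate K (u t) q.2 - classicalRate K (u t) x := by fun_prop
      have := this.tendsto (t, x)
      rw [sub_self] at this
      exact this.mono_left hle
    have := h1.mul_isLittleO h2
    simp only [mul_one] at this
    exact this.of_norm_right
  have o3 : (fun q : ℝ × Space N => u t q.2 - u t x - fderiv ℝ (u t) x (q.2 - x))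
      =o[𝓝[timeInterval T ×ˢ univ] (t, x)] fun q => q - (t, x) := by
    have hd := ((hc.contDiff_limSol hp).differentiable one_ne_zero x).hasFDerivAt
    have h1 : HasFDerivAt (fun q : ℝ × Space N => u t q.2)
        ((fderiv ℝ (u t) x).comp (ContinuousLinearMap.snd ℝ ℝ (Space N))) (t, x) :=
      HasFDerivAt.comp (t, x) (g := u t) hd hasFDerivAt_snd
    exact h1.isLittleO.mono hle
  refine ((o1.add o2).add o3).congr_left fun q => ?_
  simp only [spaceTimeDeriv, Function.uncurry, add_apply, ContinuousLinearMap.smulRight_apply,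
    ContinuousLinearMap.comp_apply, ContinuousLinearMap.coe_fst', ContinuousLinearMap.coe_snd',
    Prod.fst_sub, Prod.snd_sub, smul_eq_mul]
  ring

lemma Convergent.continuousOn_spaceTimeDeriv (hc : Convergent K H κ R ρ₀ T) :
    ContinuousOn (spaceTimeDeriv K R ρ₀) (timeInterval T ×ˢ univ) := by
  unfold spaceTimeDeriv
  refine ContinuousOn.add ?_ (hc.continuousOn_fderiv.clm_comp continuousOn_const)
  exact ((ContinuousLinearMap.smulRightL ℝ (ℝ × Space N) ℝ
    (ContinuousLinearMap.fst ℝ ℝ (Space N))).continuous.comp_continuousOn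
      hc.continuousOn_classicalRate)

/-- The limit of the approximations is a classical solution. -/
lemma Convergent.isClassicalSolution (hc : Convergent K H κ R ρ₀ T) (hT : 0 < T) :
    IsClassicalSolution K ρ₀ T (limSol K R ρ₀) where
  contDiffOn := by
    have h := contDiffOn_succ_iff_hasFDerivWithinAt (𝕜 := ℝ) (n := 0)
      (f := Function.uncurry (limSol K R ρ₀)) (s := timeInterval T ×ˢ univ) (by simp)
    rw [zero_add] at h
    rw [h]
    intro p hp
    refine ⟨timeInterval T ×ˢ univ, ?_, by simp, spaceTimeDeriv K R ρ₀,
      fun q hq => hc.hasFDerivWithinAt hq.1, contDiffOn_zero.2 hc.continuousOn_spaceTimeDeriv⟩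
    rw [insert_eq_of_mem hp]
    exact self_mem_nhdsWithin
  memTimeSobolev := hc.reg_low.memTimeSobolev
  initial := by rw [hc.limSol_zero hT]
  flux_differentiable t ht i := by
    obtain ⟨C, hC⟩ := hc.sobolev_two ht
    have h := ((contDiff_flux hc.kernel hC (hc.continuous_limSol ht) i).differentiable
      one_ne_zero).neg
    have e : (fun x => limSol K R ρ₀ t x * velocity K (limSol K R ρ₀ t) i x) =
        -flux K (limSol K R ρ₀ t) i := by
      ext x; simp [flux, velocity_eq]
    rwa [e]
  equation t ht x := by
    rw [neg_divergence_eq]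
    have h1 := hc.hasFDerivWithinAt (p := (t, x)) ht
    have h2 : HasDerivWithinAt (fun s : ℝ => (s, x)) (1, 0) (timeInterval T) t :=
      ((hasDerivAt_id t).prodMk (hasDerivAt_const t x)).hasDerivWithinAt
    have h3 := HasFDerivWithinAt.comp_hasDerivWithinAt (t := timeInterval T ×ˢ univ) t h1 h2
      fun s hs => ⟨hs, mem_univ _⟩
    simpa [spaceTimeDeriv, Function.comp_def] using h3

end

section

variable {K : Fin N → Space N → ℝ} {H : Fin N → Fin N → Space N → ℝ} {κ : ℝ}
  {ρ₀ : Space N → ℝ} {T T' : EReal} {ρ σ : ℝ → Space N → ℝ} {C : ℝ}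

/-! ### Uniqueness -/

lemma IsClassicalSolution.contDiff (h : IsClassicalSolution K ρ₀ T ρ) {t : ℝ}
    (ht : t ∈ timeInterval T) : ContDiff ℝ 1 (ρ t) := by
  have h1 : ContDiff ℝ 1 fun x : Space N => (t, x) := contDiff_prodMk_right t
  exact contDiffOn_univ.1 (h.contDiffOn.comp h1.contDiffOn fun x _ => ⟨ht, mem_univ _⟩)

/-- Chain rule along a curve. The space-time derivative is identified through its values on `(1,
0)`, by the equation, and on `(0, v)`. Since `s < t`, one-sided time derivatives on `Icc 0 t` are
unique, including at the initial time. -/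
lemma IsClassicalSolution.hasDerivWithinAt_comp (h : IsClassicalSolution K ρ₀ T ρ) {s t : ℝ}
    (ht : t ∈ timeInterval T) (hs : s ∈ Ico 0 t) {Y : ℝ → Space N} {v : Space N}
    (hY : HasDerivWithinAt Y v (Icc 0 t) s) :
    HasDerivWithinAt (fun r => ρ r (Y r))
      (classicalRate K (ρ s) (Y s) + fderiv ℝ (ρ s) (Y s) v) (Icc 0 t) s := by
  have hsub : Icc 0 t ⊆ timeInterval T := fun r hr => mem_timeInterval_of_le ht hr.1 hr.2
  have hs' : s ∈ timeInterval T := hsub ⟨hs.1, hs.2.le⟩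
  have hd := (h.contDiffOn.differentiableOn one_ne_zero (s, Y s) ⟨hs', mem_univ _⟩).hasFDerivWithinAt
  set D := fderivWithin ℝ (Function.uncurry ρ) (timeInterval T ×ˢ univ) (s, Y s)
  have hd' : HasFDerivWithinAt (Function.uncurry ρ) D (Icc 0 t ×ˢ univ) (s, Y s) :=
    hd.mono (prod_mono hsub subset_rfl)
  have hu : UniqueDiffWithinAt ℝ (Icc 0 t) s :=
    uniqueDiffOn_Icc (hs.1.trans_lt hs.2) s ⟨hs.1, hs.2.le⟩
  have e1 : D (1, 0) = classicalRate K (ρ s) (Y s) := by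
    have h2 : HasDerivWithinAt (fun r : ℝ => (r, Y s)) (1, 0) (Icc 0 t) s :=
      ((hasDerivAt_id s).prodMk (hasDerivAt_const s (Y s))).hasDerivWithinAt
    have h3 := HasFDerivWithinAt.comp_hasDerivWithinAt (t := Icc 0 t ×ˢ univ) s hd' h2
      fun r hr => ⟨hr, mem_univ _⟩
    have h4 := (h.equation s hs' (Y s)).mono hsub
    rw [neg_divergence_eq] at h4
    exact hu.eq_deriv _ h3 h4
  have e2 : D (0, v) = fderiv ℝ (ρ s) (Y s) v := by
    have h2 : HasFDerivWithinAt (fun y : Space N => (s, y))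
        (ContinuousLinearMap.inr ℝ ℝ (Space N)) univ (Y s) :=
      (hasFDerivAt_prodMk_right s (Y s)).hasFDerivWithinAt
    have h3 := HasFDerivWithinAt.comp (t := timeInterval T ×ˢ univ) (Y s) hd h2
      fun y _ => ⟨hs', mem_univ _⟩
    have h4 : HasFDerivAt (ρ s) _ (Y s) := hasFDerivWithinAt_univ.1 h3
    rw [h4.fderiv]
    simp
  have h5 : HasDerivWithinAt (fun r : ℝ => (r, Y r)) (1, v) (Icc 0 t) s :=
    (hasDerivAt_id s).hasDerivWithinAt.prodMk hY
  have h6 := HasFDerivWithinAt.comp_hasDerivWithinAt (t := Icc 0 t ×ˢ univ) s hd' h5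
    fun r hr => ⟨hr, mem_univ _⟩
  have e3 : D (1, v) = classicalRate K (ρ s) (Y s) + fderiv ℝ (ρ s) (Y s) v := by
    rw [← e1, ← e2, ← map_add]; simp
  rw [← e3]
  exact h6

lemma IsKernel.contDiff_conv (hK : IsKernel K H κ) {u : Space N → ℝ} (hu : SobolevLE 1 C u)
    (hc : Continuous u) (i : Fin N) : ContDiff ℝ 1 (conv (K i) u) :=
  (hK.conv_succ hu i).contDiff (continuous_conv (hK.integrable_grad i) hc (hu.abs_le hc))

lemma classicalRate_eq (hK : IsKernel K H κ) {u : Space N → ℝ} (hu : SobolevLE 1 C u)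
    (hd : Differentiable ℝ u) (x : Space N) :
    classicalRate K u x = ∑ i, (u x * fderiv ℝ (conv (K i) u) x (basisVec i) +
      conv (K i) u x * fderiv ℝ u x (basisVec i)) := by
  refine Finset.sum_congr rfl fun i _ => ?_
  have h := (hK.contDiff_conv hu hd.continuous i).differentiable one_ne_zero x
  have := fderiv_fun_mul (hd x) h
  change fderiv ℝ (fun y => u y * conv (K i) u y) x _ = _
  rw [this]
  simp

/-- The velocity field generated by a density, as a vector. -/
def velocityVec (K : Fin N → Space N → ℝ) (u : Space N → ℝ) (x : Space N) : Space N :=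
  ∑ i, (-conv (K i) u x) • basisVec i

lemma norm_sum_smul_basisVec_le {B : ℝ} {a : Fin N → ℝ} (ha : ∀ i, |a i| ≤ B) :
    ‖∑ i, a i • (basisVec i : Space N)‖ ≤ N * B := by
  refine (norm_sum_le _ _).trans ?_
  calc ∑ i, ‖a i • (basisVec i : Space N)‖ ≤ ∑ _i : Fin N, B :=
        Finset.sum_le_sum fun i _ => by simpa [norm_smul] using ha i
    _ = N * B := by simp

/-- The difference of two solutions, differentiated along the characteristics of the first. -/
lemma abs_rate_sub_le (hK : IsKernel K H κ) {u w : Space N → ℝ} {M : ℝ} (hu : SobolevLE 1 C u)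
    (hw : SobolevLE 1 C w) (hdu : Differentiable ℝ u) (hdw : Differentiable ℝ w)
    (hM : ∀ x, |u x - w x| ≤ M) (x : Space N) :
    |(classicalRate K u x + fderiv ℝ u x (velocityVec K u x)) -
      (classicalRate K w x + fderiv ℝ w x (velocityVec K u x))| ≤ 3 * N * κ * C * M := by
  have hM0 : SobolevLE 0 M fun x => u x - w x :=
    ⟨(hdu.continuous.sub hdw.continuous).aestronglyMeasurable, Eventually.of_forall hM⟩
  have hC := hu.nonneg
  have hκ := hK.pos.le
  have hcu i := (hK.contDiff_conv hu hdu.continuous i).differentiable one_ne_zero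
  have hcw i := (hK.contDiff_conv hw hdw.continuous i).differentiable one_ne_zero
  have hsub : ∀ i, SobolevLE 1 (κ * M) fun x => conv (K i) u x - conv (K i) w x := fun i =>
    (hK.conv_succ hM0 i).congr (Eventually.of_forall fun x => conv_sub (hK.integrable_grad i) hu hw x)
  rw [classicalRate_eq hK hu hdu, classicalRate_eq hK hw hdw]
  simp only [velocityVec, map_sum, map_smul, smul_eq_mul]
  rw [← Finset.sum_add_distrib, ← Finset.sum_add_distrib, ← Finset.sum_sub_distrib]
  refine (Finset.abs_sum_le_sum_abs _ _).trans ?_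
  have hterm : ∀ i : Fin N, |u x * fderiv ℝ (conv (K i) u) x (basisVec i) +
      conv (K i) u x * fderiv ℝ u x (basisVec i) +
        -conv (K i) u x * fderiv ℝ u x (basisVec i) -
      (w x * fderiv ℝ (conv (K i) w) x (basisVec i) +
        conv (K i) w x * fderiv ℝ w x (basisVec i) +
        -conv (K i) u x * fderiv ℝ w x (basisVec i))| ≤ 3 * κ * C * M := by
    intro i
    have b1 := hM x
    have b2 := (hK.conv_succ hu i).abs_fderiv_le (hcu i) i x
    have b3 := hw.abs_le hdw.continuous x
    have b4 := abs_fderiv_sub_le (hcu i) (hcw i) (hsub i) i x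
    have b5 := (hsub i).abs_le ((hcu i).continuous.sub (hcw i).continuous) x
    have b6 := hw.abs_fderiv_le hdw i x
    have hM1 : 0 ≤ M := (abs_nonneg _).trans b1
    -- The terms in the gradient of `u` cancel along its own characteristics. Each of the three
    -- remaining products contains `u - w`, directly or through a convolution that gains a
    -- derivative.
    have key : u x * fderiv ℝ (conv (K i) u) x (basisVec i) +
      conv (K i) u x * fderiv ℝ u x (basisVec i) +
        -conv (K i) u x * fderiv ℝ u x (basisVec i) -
      (w x * fderiv ℝ (conv (K i) w) x (basisVec i) +
        conv (K i) w x * fderiv ℝ w x (basisVec i) +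
        -conv (K i) u x * fderiv ℝ w x (basisVec i)) =
        (u x - w x) * fderiv ℝ (conv (K i) u) x (basisVec i) +
        w x * (fderiv ℝ (conv (K i) u) x (basisVec i) -
          fderiv ℝ (conv (K i) w) x (basisVec i)) +
        (conv (K i) u x - conv (K i) w x) * fderiv ℝ w x (basisVec i) := by ring
    rw [key]
    calc _ ≤ M * (κ * C) + C * (κ * M) + (κ * M) * C := by
          refine (abs_add_le _ _).trans (add_le_add ((abs_add_le _ _).trans (add_le_add ?_ ?_)) ?_)
          all_goals rw [abs_mul]; gcongr
      _ = _ := by ring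
  calc _ ≤ ∑ _i : Fin N, 3 * κ * C * M := Finset.sum_le_sum fun i _ => hterm i
    _ = _ := by simp; ring

/-- Backward characteristics. -/
lemma exists_characteristic (hK : IsKernel K H κ) (h : IsClassicalSolution K ρ₀ T ρ) {t : ℝ}
    (ht : t ∈ timeInterval T) (x : Space N) : ∃ Y : ℝ → Space N, Y t = x ∧
      ∀ s ∈ Icc 0 t, HasDerivWithinAt Y (velocityVec K (ρ s) (Y s)) (Icc 0 t) s := by
  have hsub : ∀ s ∈ Icc 0 t, s ∈ timeInterval T := fun s hs => mem_timeInterval_of_le ht hs.1 hs.2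
  obtain ⟨C, hC⟩ := h.memTimeSobolev.1 t ht
  obtain ⟨L, hL⟩ := h.memTimeSobolev.2 t ht
  have hC0 : 0 ≤ C := (hC 0 ⟨le_rfl, ht.1⟩).nonneg
  have hκ := hK.pos.le
  have hcont s (hs : s ∈ Icc 0 t) : Continuous (ρ s) := (h.contDiff (hsub s hs)).continuous
  have hB : 0 ≤ N * (κ * C) := by positivity
  have hA : 0 ≤ N * (N * (κ * C)) := by positivity
  -- The field is bounded by `N * (κ * C)` and Lipschitz on the whole space, so a ball of radius
  -- speed times `t` lets a single application, started at the final time, cover all of `[0, t]`.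
  have hPL : IsPicardLindelof (fun s y => velocityVec K (ρ s) y)
      (⟨t, ht.1, le_rfl⟩ : Icc (0 : ℝ) t) x (N * (κ * C) * t).toNNReal 0
      (N * (κ * C)).toNNReal (N * (N * (κ * C))).toNNReal := by
    refine ⟨fun s hs => ?_, fun y _ => ?_, fun s hs y _ => ?_, ?_⟩
    · refine LipschitzOnWith.of_dist_le_mul fun y _ z _ => ?_
      rw [dist_eq_norm, velocityVec, velocityVec, ← Finset.sum_sub_distrib]
      simp only [← sub_smul]
      refine (norm_sum_smul_basisVec_le (B := N * (κ * C) * dist y z) fun i => ?_).trans_eq ?_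
      · have hd := (hK.contDiff_conv (hC s hs) (hcont s hs) i).differentiable one_ne_zero
        have := (lipschitzWith_of_partial (by positivity) hd fun x j =>
          (hK.conv_succ (hC s hs) i).abs_fderiv_le hd j x).dist_le_mul y z
        rw [Real.coe_toNNReal _ hB, Real.dist_eq, abs_sub_comm] at this
        rwa [neg_sub_neg]
      · rw [Real.coe_toNNReal _ hA]; ring
    · refine continuousOn_finsetSum _ fun i _ => ?_
      suffices hi : ContinuousOn (fun s => conv (K i) (ρ s) y) (Icc 0 t) by
        exact hi.fun_neg.fun_smul continuousOn_const
      refine LipschitzOnWith.continuousOn (K := (κ * L).toNNReal)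
        (LipschitzOnWith.of_dist_le_mul fun r hr s hs => ?_)
      rw [Real.dist_eq, ← conv_sub (hK.integrable_grad i) (hC r hr) (hC s hs)]
      have h1 := hK.conv_same (hL s hs r hr) i
      have h2 := h1.abs_le (continuous_conv (hK.integrable_grad i)
        ((hcont r hr).sub (hcont s hs)) ((hL s hs r hr).abs_le ((hcont r hr).sub (hcont s hs)))) y
      rw [Real.dist_eq]
      calc _ ≤ κ * (L * |r - s|) := h2
        _ = κ * L * |r - s| := by ring
        _ ≤ _ := mul_le_mul_of_nonneg_right (Real.le_coe_toNNReal _) (abs_nonneg _)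
    · rw [Real.coe_toNNReal _ hB]
      refine norm_sum_smul_basisVec_le fun i => ?_
      rw [abs_neg]
      exact (hK.conv_succ (hC s hs) i).abs_le
        (hK.contDiff_conv (hC s hs) (hcont s hs) i).continuous y
    · rw [Real.coe_toNNReal _ hB, Real.coe_toNNReal _ (mul_nonneg hB ht.1)]
      simp [ht.1]
  obtain ⟨Y, hY0, hY⟩ := hPL.exists_eq_forall_mem_Icc_hasDerivWithinAt₀
  exact ⟨Y, hY0, hY⟩

/-- Grönwall in a weighted sup norm. With `c = 3 N κ C`, the derivative along a characteristic is at
most `c D e^{2cs}`, whose primitive `(D / 2) e^{2cs}` has half the constant. No regularity in time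
of the supremum over space is required. -/
lemma IsClassicalSolution.abs_sub_le_half (hK : IsKernel K H κ) (hρ : IsClassicalSolution K ρ₀ T ρ)
    (hσ : IsClassicalSolution K ρ₀ T' σ) {S : ℝ} (hS : S ∈ timeInterval T)
    (hS' : S ∈ timeInterval T') (hCρ : ∀ s ∈ Icc 0 S, SobolevLE 1 C (ρ s))
    (hCσ : ∀ s ∈ Icc 0 S, SobolevLE 1 C (σ s)) {D : ℝ}
    (hD : ∀ s ∈ Icc 0 S, ∀ y, |ρ s y - σ s y| ≤ D * Real.exp (2 * (3 * N * κ * C) * s)) :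
    ∀ s ∈ Icc 0 S, ∀ y, |ρ s y - σ s y| ≤ D / 2 * Real.exp (2 * (3 * N * κ * C) * s) := by
  intro t ht x
  have htT := mem_timeInterval_of_le hS ht.1 ht.2
  have htT' := mem_timeInterval_of_le hS' ht.1 ht.2
  have hD0 : 0 ≤ D := by
    have := (abs_nonneg _).trans (hD t ht x)
    exact nonneg_of_mul_nonneg_left this (Real.exp_pos _)
  -- The data agree almost everywhere and both solutions are continuous.
  have h0 : ρ 0 = σ 0 :=
    (hρ.contDiff ⟨le_rfl, lt_of_le_of_lt (by exact_mod_cast ht.1) htT.2⟩).continuous.ae_eq_iff_eq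
      volume (hσ.contDiff ⟨le_rfl, lt_of_le_of_lt (by exact_mod_cast ht.1) htT'.2⟩).continuous |>.1
      (hρ.initial.trans hσ.initial.symm)
  obtain ⟨Y, hYt, hY⟩ := exists_characteristic hK hρ htT x
  have hder : ∀ s ∈ Ico 0 t, HasDerivWithinAt (fun r => ρ r (Y r) - σ r (Y r))
      ((classicalRate K (ρ s) (Y s) + fderiv ℝ (ρ s) (Y s) (velocityVec K (ρ s) (Y s))) -
        (classicalRate K (σ s) (Y s) + fderiv ℝ (σ s) (Y s) (velocityVec K (ρ s) (Y s))))
      (Icc 0 t) s := fun s hs =>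
    (hρ.hasDerivWithinAt_comp htT hs (hY s ⟨hs.1, hs.2.le⟩)).sub
      (hσ.hasDerivWithinAt_comp htT' hs (hY s ⟨hs.1, hs.2.le⟩))
  have hYc : ContinuousOn (fun r => (r, Y r)) (Icc 0 t) :=
    continuousOn_id.prodMk fun s hs => (hY s hs).continuousWithinAt
  have hc : ContinuousOn (fun r => ρ r (Y r) - σ r (Y r)) (Icc 0 t) :=
    (hρ.contDiffOn.continuousOn.comp hYc
      fun r hr => ⟨mem_timeInterval_of_le htT hr.1 hr.2, mem_univ _⟩).sub
    (hσ.contDiffOn.continuousOn.comp hYc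
      fun r hr => ⟨mem_timeInterval_of_le htT' hr.1 hr.2, mem_univ _⟩)
  have hB : ∀ s, HasDerivAt (fun s => D / 2 * Real.exp (2 * (3 * N * κ * C) * s))
      (3 * N * κ * C * (D * Real.exp (2 * (3 * N * κ * C) * s))) s := fun s => by
    have h1 := (((hasDerivAt_id s).const_mul (2 * (3 * N * κ * C))).exp).const_mul (D / 2)
    refine HasDerivAt.congr_deriv (f := fun s => D / 2 * Real.exp (2 * (3 * N * κ * C) * s)) h1 ?_
    simp only [mul_one, id]
    ring
  have := image_norm_le_of_norm_deriv_right_le_deriv_boundary hc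
    (fun s hs => (hder s hs).mono_of_mem_nhdsWithin (Icc_mem_nhdsGE_of_mem hs))
    (by rw [h0]; simp; positivity) hB (fun s hs => ?_) (right_mem_Icc.2 ht.1)
  · simpa [hYt] using this
  · have hs' : s ∈ Icc 0 S := ⟨hs.1, hs.2.le.trans ht.2⟩
    exact abs_rate_sub_le hK (hCρ s hs') (hCσ s hs')
      ((hρ.contDiff (mem_timeInterval_of_le hS hs'.1 hs'.2)).differentiable one_ne_zero)
      ((hσ.contDiff (mem_timeInterval_of_le hS' hs'.1 hs'.2)).differentiable one_ne_zero)
      (hD s hs') (Y s)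

/-- Classical solutions with the same initial datum coincide. -/
theorem IsClassicalSolution.unique (hK : IsKernel K H κ) (hρ : IsClassicalSolution K ρ₀ T ρ)
    (hσ : IsClassicalSolution K ρ₀ T' σ) {t : ℝ} (ht : t ∈ timeInterval T)
    (ht' : t ∈ timeInterval T') (x : Space N) : ρ t x = σ t x := by
  obtain ⟨A, hA⟩ := hρ.memTimeSobolev.1 t ht
  obtain ⟨B, hB⟩ := hσ.memTimeSobolev.1 t ht'
  set C := max A B
  have hCρ : ∀ s ∈ Icc 0 t, SobolevLE 1 C (ρ s) := fun s hs => (hA s hs).mono (le_max_left _ _)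
  have hCσ : ∀ s ∈ Icc 0 t, SobolevLE 1 C (σ s) := fun s hs => (hB s hs).mono (le_max_right _ _)
  have htt : t ∈ Icc 0 t := ⟨ht.1, le_rfl⟩
  have hC0 : 0 ≤ C := (hCρ t htt).nonneg
  have hκ := hK.pos.le
  -- Iteration starts from the trivial bound `2 * C` and gains a factor `1 / 2` each time.
  have main : ∀ n : ℕ, ∀ s ∈ Icc 0 t, ∀ y,
      |ρ s y - σ s y| ≤ 2 * C * (1 / 2) ^ n * Real.exp (2 * (3 * N * κ * C) * s) := by
    intro n
    induction n with
    | zero =>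
      intro s hs y
      have h1 := (hCρ s hs).abs_le
        (hρ.contDiff (mem_timeInterval_of_le ht hs.1 hs.2)).continuous y
      have h2 := (hCσ s hs).abs_le
        (hσ.contDiff (mem_timeInterval_of_le ht' hs.1 hs.2)).continuous y
      have h3 : 1 ≤ Real.exp (2 * (3 * N * κ * C) * s) :=
        Real.one_le_exp (mul_nonneg (by positivity) hs.1)
      calc |ρ s y - σ s y| ≤ |ρ s y| + |σ s y| := abs_sub _ _
        _ ≤ 2 * C * (1 / 2) ^ 0 * 1 := by linarith
        _ ≤ _ := by gcongr
    | succ n ih =>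
      intro s hs y
      refine (hρ.abs_sub_le_half hK hσ ht ht' hCρ hCσ ih s hs y).trans_eq ?_
      ring
  have hlim : Tendsto (fun n : ℕ => 2 * C * (1 / 2 : ℝ) ^ n * Real.exp (2 * (3 * N * κ * C) * t))
      atTop (𝓝 (2 * C * 0 * Real.exp (2 * (3 * N * κ * C) * t))) :=
    ((tendsto_pow_atTop_nhds_zero_of_lt_one (by norm_num) (by norm_num)).const_mul _).mul_const _
  have h := ge_of_tendsto' hlim fun n => main n t htt x
  rw [mul_zero, zero_mul] at h
  exact sub_eq_zero.1 (abs_eq_zero.1 (le_antisymm h (abs_nonneg _)))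

end

section

variable {K : Fin N → Space N → ℝ} {H : Fin N → Fin N → Space N → ℝ} {κ : ℝ}
  {ρ₀ : Space N → ℝ}

/-! ### Existence -/

lemma exists_isKernel (hw : ∀ i j, HasWeakPartial j (K i) (H i j)) (hK : ∀ i, Integrable (K i))
    (hH : ∀ i j, Integrable (H i j)) : ∃ κ, IsKernel K H κ := by
  have h0 : ∀ f : Space N → ℝ, 0 ≤ ∫ y, |f y| := fun f => integral_nonneg fun y => abs_nonneg _
  have hA : 0 ≤ ∑ i, ∫ y, |K i y| := Finset.sum_nonneg fun i _ => h0 _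
  have hB : 0 ≤ ∑ i, ∑ j, ∫ y, |H i j y| :=
    Finset.sum_nonneg fun i _ => Finset.sum_nonneg fun j _ => h0 _
  refine ⟨1 + ∑ i, (∫ y, |K i y|) + ∑ i, ∑ j, ∫ y, |H i j y|, by linarith, hK, hH, hw,
    fun i => ?_, fun i j => ?_⟩
  · have := Finset.single_le_sum (f := fun i => ∫ y, |K i y|) (fun i _ => h0 _)
      (Finset.mem_univ i)
    linarith
  · have h1 := Finset.single_le_sum (f := fun j => ∫ y, |H i j y|) (fun j _ => h0 _)
      (Finset.mem_univ j)
    have h2 := Finset.single_le_sum (f := fun i => ∑ j, ∫ y, |H i j y|)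
      (fun i _ => Finset.sum_nonneg fun j _ => h0 _) (Finset.mem_univ i)
    linarith

lemma exists_ae_le_of_memLp_top {f : Space N → ℝ}
    (h : MemLp (fun x => max (f x) 0) ⊤ volume) : ∃ Λ, 0 ≤ Λ ∧ ∀ᵐ x, f x ≤ Λ := by
  refine ⟨(eLpNorm (fun x => max (f x) 0) ⊤ volume).toReal, ENNReal.toReal_nonneg, ?_⟩
  have h1 := ae_le_eLpNormEssSup (f := fun x => max (f x) 0) (μ := (volume : Measure (Space N)))
  rw [← eLpNorm_exponent_top] at h1
  filter_upwards [h1] with x hx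
  have h2 := ENNReal.toReal_mono h.2.ne hx
  rw [toReal_enorm] at h2
  exact (le_max_left _ _).trans ((le_abs_self _).trans h2)

lemma exists_continuous_representative (h : MemSobolev 2 ρ₀) :
    ∃ ρ₁ : Space N → ℝ, Continuous ρ₁ ∧ ρ₀ =ᵐ[volume] ρ₁ := by
  obtain ⟨C, hC⟩ := h
  obtain ⟨g, hg, he⟩ := hC.of_succ.exists_lipschitz
  exact ⟨g, hg.continuous, he⟩

lemma MemSobolev.congr {m : ℕ} {f g : Space N → ℝ} (h : MemSobolev m f) (he : f =ᵐ[volume] g) :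
    MemSobolev m g := by
  obtain ⟨C, hC⟩ := h
  exact ⟨C, hC.congr he⟩

lemma IsClassicalSolution.congr {T : EReal} {ρ : ℝ → Space N → ℝ} {ρ₁ : Space N → ℝ}
    (h : IsClassicalSolution K ρ₁ T ρ) (he : ρ₀ =ᵐ[volume] ρ₁) : IsClassicalSolution K ρ₀ T ρ :=
  { h with initial := h.initial.trans he.symm }

lemma exists_convergent (hK : IsKernel K H κ) {Λ : ℝ} (hΛ0 : 0 ≤ Λ)
    (hΛ : ∀ᵐ x, ∑ i, H i i x ≤ Λ) (hc : Continuous ρ₀) (hs : MemSobolev 2 ρ₀) :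
    ∃ (T : EReal) (R : ℝ → ℝ), 0 < T ∧ ((∀ᵐ x, 0 ≤ ρ₀ x) → Integrable ρ₀ → T = ⊤) ∧
      Convergent K H κ R ρ₀ T := by
  obtain ⟨C, hC⟩ := hs
  have hC0 := hC.nonneg
  have hκ := hK.pos
  have hB : 0 < C + 1 := by linarith
  have h1 : SobolevLE 1 (C + 1) ρ₀ := hC.of_succ.mono (by linarith)
  by_cases hm : (∀ᵐ x, 0 ≤ ρ₀ x) ∧ Integrable ρ₀
  · have hI : 0 ≤ ∫ x, ρ₀ x := integral_nonneg_of_ae hm.1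
    refine ⟨⊤, _, EReal.zero_lt_top, fun _ _ => rfl, hK, ?_, fun S _ =>
      admissible_global hK hB h1.of_succ h1 hΛ0 hΛ hm.1 hm.2 S, hc, ⟨C, hC⟩⟩
    intro s t hst
    have : 0 ≤ Λ * ∫ x, ρ₀ x := mul_nonneg hΛ0 hI
    dsimp only
    gcongr
  -- The summand `1` keeps the denominator positive in every dimension; the bound `C + 1` replaces
  -- `C` because a positive constant is required.
  · have hQ : 0 < (4 * N * κ * (C + 1)) + 1 := by positivity
    refine ⟨((1 / (4 * N * κ * (C + 1) + 1) : ℝ) : EReal), fun _ => 2 * κ * (C + 1),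
      by exact_mod_cast (by positivity), fun h h' => absurd ⟨h, h'⟩ hm, hK,
      monotone_const, fun S hS => ?_, hc, ⟨C, hC⟩⟩
    refine admissible_local hK hB h1.of_succ ?_
    have h2 : S < 1 / (4 * N * κ * (C + 1) + 1) := by exact_mod_cast hS.2
    rw [lt_div_iff₀ hQ] at h2
    have := hS.1
    nlinarith

end

end Aggregation

end

/-! ### Existence, regularity and uniqueness -/

theorem theorem5p1 {N : ℕ} (hN : 1 ≤ N)
    (W : Aggregation.Space N → ℝ)
    (gradW : Fin N → Aggregation.Space N → ℝ)
    (hessW : Fin N → Fin N → Aggregation.Space N → ℝ)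
    (hgrad : ∀ i, Aggregation.HasWeakPartial i W (gradW i))
    (hhess : ∀ i j, Aggregation.HasWeakPartial j (gradW i) (hessW i j))
    (hgradL1 : ∀ i, MeasureTheory.Integrable (gradW i))
    (hhessL1 : ∀ i j, MeasureTheory.Integrable (hessW i j))
    (hlap : MeasureTheory.MemLp (fun x => max (∑ i, hessW i i x) 0) ⊤ MeasureTheory.volume)
    (ρ₀ : Aggregation.Space N → ℝ) (hρ₀ : Aggregation.MemSobolev 2 ρ₀) :
    ∃ (T : EReal) (ρ : ℝ → Aggregation.Space N → ℝ),
      0 < T ∧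
      ((∀ᵐ x, 0 ≤ ρ₀ x) → MeasureTheory.Integrable ρ₀ → T = ⊤) ∧
      Aggregation.IsClassicalSolution gradW ρ₀ T ρ ∧
      (∀ κ : ℕ, 2 ≤ κ → Aggregation.MemSobolev κ ρ₀ →
        ∀ j m : ℕ, j + m ≤ κ → Aggregation.MemTimeSobolev T j m ρ) ∧
      (MeasureTheory.Integrable ρ₀ → MeasureTheory.Integrable (fun x => ‖x‖ ^ 2 * ρ₀ x) →
        ∀ (T' : EReal) (σ : ℝ → Aggregation.Space N → ℝ),
          Aggregation.IsClassicalSolution gradW ρ₀ T' σ →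
          ∀ t : ℝ, t ∈ Aggregation.timeInterval T → t ∈ Aggregation.timeInterval T' →
            ∀ x, ρ t x = σ t x) := by
  obtain ⟨κ, hK⟩ := Aggregation.exists_isKernel hhess hgradL1 hhessL1
  obtain ⟨Λ, hΛ0, hΛ⟩ := Aggregation.exists_ae_le_of_memLp_top hlap
  -- The scheme is run from the continuous representative; as the initial condition is an almost
  -- everywhere equality, the result is a solution for `ρ₀` as well. The same limit serves all
  -- regularity orders, because `T` and `R` do not depend on them.
  obtain ⟨ρ₁, hc, he⟩ := Aggregation.exists_continuous_representative hρ₀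
  obtain ⟨T, R, hT, htop, hconv⟩ := Aggregation.exists_convergent hK hΛ0 hΛ hc (hρ₀.congr he)
  have hsol := (hconv.isClassicalSolution hT).congr he
  refine ⟨T, Aggregation.limSol gradW R ρ₁, hT, fun h0 hi => htop ?_ (hi.congr he), hsol,
    fun p _ hp j m hjm => (hconv.reg (hp.congr he) j m hjm).memTimeSobolev,
    fun _ _ T' σ hσ t ht ht' x => hsol.unique hK hσ ht ht' x⟩
  filter_upwards [h0, he] with x hx hx'
  rwa [← hx']
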